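/- **Setting.** Let $(\mathcal B_\beta,|\cdot|_\beta)_{\beta\in\mathbb R}$ be a monotone family of interpolation spaces: separable Banach spaces with $\mathcal B_b\subset\mathcal B_a$ densely and continuously for $a\le b$, and $|x|_b^{c-a}\lesssim|x|_a^{c-b}|x|_c^{b-a}$ for $a\le b\le c$, $x\in\mathcal B_c$. Let $(S_t)_{t\ge0}$ be a semigroup acting consistently and strongly continuously on every $\mathcal B_\beta$ with $|(S_t-\mathrm{Id})x|_\beta\lesssim t|x|_{\beta+1}$ and $|S_tx|_{\beta+1}\lesssim t^{-1}|x|_\beta$ for $t\in(0,1]$. Fix $\alpha\in\mathbb R$, $\gamma\in(1/3,1/2]$, $\sigma\in[0,\gamma)$, $\delta\in[0,1)$, and a $C^3$ cut-off function $f:[0,\infty)\to[0,1]$ with $f=1$ on $[0,1/2]$ and $f=0$ on $[1,\infty)$. A $\gamma$-Hölder rough path $\mathbf W=(W,\mathbb W)$ on $[0,1]$ consists of $W:[0,1]\to\mathbb R$ with $W_0=0$ and $\mathbb W_{s,t}\in\mathbb R$ ($0\le s\le t\le 1$), with $|W|_\gamma=\sup_{s<t}\frac{|W_t-W_s|}{(t-s)^\gamma}<\infty$,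 $|\mathbb W|_{2\gamma}=\sup_{s<t}\frac{|\mathbb W_{s,t}|}{(t-s)^{2\gamma}}<\infty$ and $\mathbb W_{s,t}-\mathbb W_{s,u}-\mathbb W_{u,t}=(W_u-W_s)(W_t-W_u)$ for $s\le u\le t$. Put $\rho_\gamma(\mathbf W)=|W|_\gamma+|\mathbb W|_{2\gamma}$. The space $\mathcal D=D^{2\gamma}_{W,\alpha}([0,1])$ consists of all pairs $(U,U')$ with $U\in C([0,1];\mathcal B_\alpha)$, $U'\in C([0,1];\mathcal B_{\alpha-\gamma})\cap C^\gamma([0,1];\mathcal B_{\alpha-2\gamma})$, whose remainder $R^U_{s,t}=U_t-U_s-U'_s(W_t-W_s)$ is $\gamma$-Hölder in $\mathcal B_{\alpha-\gamma}$ and $2\gamma$-Hölder in $\mathcal B_{\alpha-2\gamma}$; its norm is $$\|U,U'\|_{\mathcal D}=\|U\|_{\infty,\mathcal B_\alpha}+\|U'\|_{\infty,\mathcal B_{\alpha-\gamma}}+\|U'\|_{\gamma,\mathcal B_{\alpha-2\gamma}}+\|R^U\|_{2\gamma,\mathcal B_{\alpha-2\gamma}}.$$ *Assumption on $F$.* $F:\mathcal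 B_\alpha\to\mathcal B_{\alpha-\delta}$ is globally Lipschitz, Fréchet differentiable with Lipschitz derivative in a neighbourhood of $0$, and $F(0)=DF(0)=0$. *Assumption on $G$.* For each $\theta\in\{0,\gamma,2\gamma\}$, $G:\mathcal B_{\alpha-\theta}\to\mathcal B_{\alpha-\theta-\sigma}$ (consistently in $\theta$) is three times Fréchet differentiable with bounded derivatives of orders $1,2,3$, and $G(0)=DG(0)=D^2G(0)=0$. For $R>0$ and $(Y,Y')\in\mathcal D$ put $\chi_R(Y)_t=f(\|Y,Y'\|_{\mathcal D}/R)\,Y_t$, $\chi_R(Y)'_t=f(\|Y,Y'\|_{\mathcal D}/R)\,Y'_t$, $F_R(Y)(t)=F(\chi_R(Y)_t)$, $G_R(Y)(t)=G(\chi_R(Y)_t)$, $G_R(Y)'(t)=DG(\chi_R(Y)_t)\chi_R(Y)'_t$, and, for $t\in[0,1]$, $$T_R(W,Y,Y')[t]=\int_0^tS_{t-r}F_R(Y)(r)\,dr+\int_0^tS_{t-r}G_R(Y)(r)\,d\mathbf W_r,\qquad T_R(W,Y,Y')'=G_R(Y),$$ where $\int_0^tS_{t-r}V_r\,d\mathbf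 W_r=\lim_{|\mathcal P|\to0}\sum_{[u,v]\in\mathcal P}\big(S_{t-u}V_u(W_v-W_u)+S_{t-u}V'_u\mathbb W_{u,v}\big)$ over partitions $\mathcal P$ of $[0,t]$; for $V=G_R(Y)$, $V'=G_R(Y)'$ the limit is taken in $\mathcal B_{\alpha-2\gamma-\sigma}$. **Lemma.** There are positive constants $C_F$, $C_G$ and a positive function $\widetilde C[\cdot]$ of $\rho_\gamma(\mathbf W)$ such that the following holds. Besides $f$, the family of spaces, the semigroup and $\alpha,\gamma,\sigma,\delta$, the constant $C_F$ depends only on $F$ and $C_G$ only on $G$, while $\widetilde C$ depends on neither $F$ nor $G$. For every $F$, $G$ as above, every $\gamma$-Hölder rough path $\mathbf W$ and every $K>0$, let $\widetilde R(W)$ be the unique solution of $$(C_F+C_G\,\widetilde C[\rho_\gamma(\mathbf W)])\,\widetilde R(W)=K,\qquad R=R(W):=\min\{\widetilde R(W),1\}.$$ Then for every $(Y,Y')\in\mathcal D$ both integrals defining $T_R(W,Y,Y')[t]$, $t\in[0,1]$, exist and lie in $\mathcal B_\alpha$, the map $(Y,Y')\mapsto(T_R(W,Y,Y'),G_R(Y))$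 sends $\mathcal D$ into itself, and for all $(Y,Y'),(\widetilde Y,\widetilde Y')\in\mathcal D$ $$\|T_R(W,Y,Y')-T_R(W,\widetilde Y,\widetilde Y'),\ G_R(Y)-G_R(\widetilde Y)\|_{\mathcal D}\le K\,\|Y-\widetilde Y,Y'-\widetilde Y'\|_{\mathcal D}.$$ -/

import Mathlib

open Set Filter Topology

noncomputable section

namespace RoughCut

/-- A monotone family of interpolation spaces: separable Banach spaces `B β`, `β ∈ ℝ`, with
dense continuous embeddings `B b ⊂ B a` for `a ≤ b` (given as compatible injective continuous linear
maps) and the interpolation inequality. -/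
structure InterpolationFamily (B : ℝ → Type*) [∀ β, NormedAddCommGroup (B β)]
    [∀ β, NormedSpace ℝ (B β)] where
  complete : ∀ β, CompleteSpace (B β)
  separable : ∀ β, TopologicalSpace.SeparableSpace (B β)
  incl : ∀ {a b : ℝ}, a ≤ b → (B b →L[ℝ] B a)
  incl_refl : ∀ (a : ℝ) (x : B a), incl (le_refl a) x = x
  incl_incl : ∀ {a b c : ℝ} (hab : a ≤ b) (hbc : b ≤ c) (x : B c),
    incl hab (incl hbc x) = incl (hab.trans hbc) x
  incl_injective : ∀ {a b : ℝ} (hab : a ≤ b), Function.Injective (incl hab)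
  incl_dense : ∀ {a b : ℝ} (hab : a ≤ b), DenseRange (incl hab)
  interpolation : ∀ {a b c : ℝ} (hab : a ≤ b) (hbc : b ≤ c), ∃ C : ℝ, ∀ x : B c,
    ‖incl hbc x‖ ^ (c - a) ≤ C * ‖incl (hab.trans hbc) x‖ ^ (c - b) * ‖x‖ ^ (b - a)

section Family

variable {B : ℝ → Type*} [∀ β, NormedAddCommGroup (B β)] [∀ β, NormedSpace ℝ (B β)]

/-- The embedding `B a ⊂ B b` for `b ≤ a`, as a total function of the indices. It is only ever
used for `b ≤ a`; the value for `a < b` is irrelevant. -/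
def InterpolationFamily.emb (𝓑 : InterpolationFamily B) (a b : ℝ) : B a →L[ℝ] B b :=
  if h : b ≤ a then 𝓑.incl h else 0

/-- A strongly continuous semigroup acting consistently on all spaces of the family, with the
parabolic endpoint bounds `|(S_t - Id) x|_β ≲ t |x|_{β+1}` and `|S_t x|_{β+1} ≲ t⁻¹ |x|_β` for
`t ∈ (0,1]`. Only times `t ≥ 0` matter. -/
structure ParabolicSemigroup (𝓑 : InterpolationFamily B) where
  S : ∀ β : ℝ, ℝ → (B β →L[ℝ] B β)
  map_zero : ∀ (β : ℝ) (x : B β), S β 0 x = x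
  map_add : ∀ (β s t : ℝ), 0 ≤ s → 0 ≤ t → ∀ x : B β, S β (s + t) x = S β s (S β t x)
  continuousOn : ∀ (β : ℝ) (x : B β), ContinuousOn (fun t => S β t x) (Ici 0)
  map_incl : ∀ {a b : ℝ} (hab : a ≤ b) (t : ℝ), 0 ≤ t → ∀ x : B b,
    𝓑.incl hab (S b t x) = S a t (𝓑.incl hab x)
  sub_id_le : ∀ β : ℝ, ∃ C : ℝ, ∀ t ∈ Ioc (0 : ℝ) 1, ∀ x : B (β + 1),
    ‖S β t (𝓑.emb (β + 1) β x) - 𝓑.emb (β + 1) β x‖ ≤ C * t * ‖x‖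
  smoothing : ∀ β : ℝ, ∃ C : ℝ, ∀ t ∈ Ioc (0 : ℝ) 1, ∀ x : B β,
    ∃ y : B (β + 1), 𝓑.emb (β + 1) β y = S β t x ∧ ‖y‖ ≤ C * t⁻¹ * ‖x‖

end Family

/-- The simplex `{(s,t) : 0 ≤ s ≤ t ≤ 1}`. -/
def simplex : Set (ℝ × ℝ) := {p | 0 ≤ p.1 ∧ p.1 ≤ p.2 ∧ p.2 ≤ 1}

/-- Supremum norm on `[0,1]`. -/
def supNorm {E : Type*} [NormedAddCommGroup E] (U : ℝ → E) : ℝ :=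
  ⨆ t : Icc (0 : ℝ) 1, ‖U t‖

/-- `θ`-Hölder (semi)norm of a two-parameter function on the simplex
(for `θ > 0` the quotient at `s = t` is `0` by convention). -/
def holderNorm {E : Type*} [NormedAddCommGroup E] (θ : ℝ) (Q : ℝ → ℝ → E) : ℝ :=
  ⨆ p : simplex, ‖Q p.1.1 p.1.2‖ / (p.1.2 - p.1.1) ^ θ

/-- Finiteness of the `θ`-Hölder norm on the simplex. -/
def IsHolder {E : Type*} [NormedAddCommGroup E] (θ : ℝ) (Q : ℝ → ℝ → E) : Prop :=
  ∃ C : ℝ, ∀ p ∈ simplex, ‖Q p.1 p.2‖ ≤ C * (p.2 - p.1) ^ θ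

/-- A one-dimensional `γ`-Hölder rough path `(W, 𝕎)` on `[0,1]` with `W_0 = 0`. -/
structure RoughPath (γ : ℝ) where
  path : ℝ → ℝ
  area : ℝ → ℝ → ℝ
  path_zero : path 0 = 0
  path_holder : IsHolder γ (fun s t => path t - path s)
  area_holder : IsHolder (2 * γ) area
  chen : ∀ s u t : ℝ, 0 ≤ s → s ≤ u → u ≤ t → t ≤ 1 →
    area s t - area s u - area u t = (path u - path s) * (path t - path u)

/-- `ρ_γ(W)`, the inhomogeneous rough path distance of `(W, 𝕎)` to `0` on `[0,1]`. -/
def RoughPath.rho {γ : ℝ} (W : RoughPath γ) : ℝ :=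
  holderNorm γ (fun s t => W.path t - W.path s) + holderNorm (2 * γ) W.area

section Controlled

variable {B : ℝ → Type*} [∀ β, NormedAddCommGroup (B β)] [∀ β, NormedSpace ℝ (B β)]
variable (𝓑 : InterpolationFamily B) {γ : ℝ} (α : ℝ) (W : RoughPath γ)

/-- The remainder `R^U_{s,t} = U_t - U_s - U'_s (W_t - W_s)`, an element of `B (α - γ)`. -/
def remainder (U : ℝ → B α) (U' : ℝ → B (α - γ)) (s t : ℝ) : B (α - γ) :=
  𝓑.emb α (α - γ) (U t - U s) - (W.path t - W.path s) • U' s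

/-- Membership of `(U, U')` in the space `𝓓 = D^{2γ}_{W,α}([0,1])` of controlled rough paths. -/
structure IsControlled (U : ℝ → B α) (U' : ℝ → B (α - γ)) : Prop where
  cont : ContinuousOn U (Icc 0 1)
  cont_deriv : ContinuousOn U' (Icc 0 1)
  holder_deriv : IsHolder γ (fun s t => 𝓑.emb (α - γ) (α - 2 * γ) (U' t - U' s))
  holder_remainder : IsHolder γ (remainder 𝓑 α W U U')
  holder_remainder_two : IsHolder (2 * γ)
    (fun s t => 𝓑.emb (α - γ) (α - 2 * γ) (remainder 𝓑 α W U U' s t))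

/-- The norm `‖U, U'‖_𝓓` of `D^{2γ}_{W,α}([0,1])`. -/
def crpNorm (U : ℝ → B α) (U' : ℝ → B (α - γ)) : ℝ :=
  supNorm U + supNorm U'
    + holderNorm γ (fun s t => 𝓑.emb (α - γ) (α - 2 * γ) (U' t - U' s))
    + holderNorm (2 * γ)
        (fun s t => 𝓑.emb (α - γ) (α - 2 * γ) (remainder 𝓑 α W U U' s t))

end Controlled

/-- A `C³` cut-off function `f : [0,∞) → [0,1]`, equal to `1` on `[0,1/2]` and to `0` on `[1,∞)`
(so that its derivatives are automatically bounded). Only its values on `[0,∞)` matter. -/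
structure IsCutoff (f : ℝ → ℝ) : Prop where
  contDiffOn : ContDiffOn ℝ 3 f (Ici 0)
  mem_Icc : ∀ x, 0 ≤ x → f x ∈ Icc (0 : ℝ) 1
  eq_one : ∀ x, 0 ≤ x → x ≤ 1 / 2 → f x = 1
  eq_zero : ∀ x, 1 ≤ x → f x = 0

/-- The assumption on the drift `F : E → E'` (with `E = B α`, `E' = B (α - δ)`): globally Lipschitz,
`F(0) = DF(0) = 0`, and `F` is differentiable with Lipschitz derivative near `0`. -/
structure IsDrift {E E' : Type*} [NormedAddCommGroup E] [NormedSpace ℝ E]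
    [NormedAddCommGroup E'] [NormedSpace ℝ E'] (F : E → E') : Prop where
  lipschitz : ∃ L, LipschitzWith L F
  map_zero : F 0 = 0
  fderiv_zero : fderiv ℝ F 0 = 0
  fderiv_lipschitz : ∃ r > 0, (∀ x ∈ Metric.ball (0 : E) r, DifferentiableAt ℝ F x) ∧
    ∃ M, LipschitzOnWith M (fderiv ℝ F) (Metric.ball 0 r)

section Equation

variable {B : ℝ → Type*} [∀ β, NormedAddCommGroup (B β)] [∀ β, NormedSpace ℝ (B β)]
variable {𝓑 : InterpolationFamily B}

/-- The assumption on the diffusion coefficient `G`. The map `G β : B β → B (β - σ)` is the action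
of `G` on the space `B β`; only `β = α - θ`, `θ ∈ {0, γ, 2γ}`, matters. The actions are restrictions
of each other, three times Fréchet differentiable with bounded derivatives (hence Lipschitz), and
`G(0) = DG(0) = D²G(0) = 0`. -/
structure IsDiffusion (𝓑 : InterpolationFamily B) (α γ σ : ℝ)
    (G : ∀ β : ℝ, B β → B (β - σ)) : Prop where
  compat : ∀ a ∈ ({α, α - γ, α - 2 * γ} : Set ℝ), ∀ b ∈ ({α, α - γ, α - 2 * γ} : Set ℝ),
    b ≤ a → ∀ x : B a, 𝓑.emb (a - σ) (b - σ) (G a x) = G b (𝓑.emb a b x)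
  differentiable : ∀ β ∈ ({α, α - γ, α - 2 * γ} : Set ℝ), ∀ k : ℕ, k ≤ 2 →
    Differentiable ℝ (iteratedFDeriv ℝ k (G β))
  bounded : ∀ β ∈ ({α, α - γ, α - 2 * γ} : Set ℝ), ∀ k : ℕ, 1 ≤ k → k ≤ 3 →
    ∃ C : ℝ, ∀ x : B β, ‖iteratedFDeriv ℝ k (G β) x‖ ≤ C
  map_zero : ∀ β ∈ ({α, α - γ, α - 2 * γ} : Set ℝ), G β 0 = 0
  fderiv_zero : ∀ β ∈ ({α, α - γ, α - 2 * γ} : Set ℝ), fderiv ℝ (G β) 0 = 0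
  fderiv_two_zero : ∀ β ∈ ({α, α - γ, α - 2 * γ} : Set ℝ), iteratedFDeriv ℝ 2 (G β) 0 = 0

/-- The compensated Riemann sum
`∑_{i<n} S_{t-u} V_u W_{u,v} + S_{t-u} V'_u 𝕎_{u,v}`, `u = p i`, `v = p (i+1)`, computed in `B c`. -/
def riemannSum (S : ParabolicSemigroup 𝓑) {γ : ℝ} (W : RoughPath γ) {a b : ℝ} (c : ℝ)
    (V : ℝ → B a) (V' : ℝ → B b) (t : ℝ) (n : ℕ) (p : ℕ → ℝ) : B c :=
  ∑ i ∈ Finset.range n,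
    ((W.path (p (i + 1)) - W.path (p i)) • S.S c (t - p i) (𝓑.emb a c (V (p i)))
      + W.area (p i) (p (i + 1)) • S.S c (t - p i) (𝓑.emb b c (V' (p i))))

/-- `z = ∫₀ᵗ S_{t-r} V_r d𝐖_r`: the compensated Riemann sums over partitions
`0 = p 0 < ⋯ < p n = t` converge to `z` in `B c` as the mesh tends to `0`. -/
def IsRoughConvolution (S : ParabolicSemigroup 𝓑) {γ : ℝ} (W : RoughPath γ) {a b : ℝ} (c : ℝ)
    (V : ℝ → B a) (V' : ℝ → B b) (t : ℝ) (z : B c) : Prop :=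
  ∀ ε > 0, ∃ η > 0, ∀ (n : ℕ) (p : ℕ → ℝ), p 0 = 0 → p n = t →
    (∀ i < n, p i < p (i + 1) ∧ p (i + 1) - p i < η) →
    ‖riemannSum S W c V V' t n p - z‖ < ε

variable (S : ParabolicSemigroup 𝓑) {γ : ℝ} (α σ δ : ℝ) (f : ℝ → ℝ)
  (F : B α → B (α - δ)) (G : ∀ β : ℝ, B β → B (β - σ)) (W : RoughPath γ) (R : ℝ)
  (Y : ℝ → B α) (Y' : ℝ → B (α - γ))

/-- The cut-off path `χ_R(Y)_t = f(‖Y, Y'‖_𝓓 / R) Y_t`. -/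
def cut (𝓑 : InterpolationFamily B) (t : ℝ) : B α := f (crpNorm 𝓑 α W Y Y' / R) • Y t

/-- Its Gubinelli derivative `χ_R(Y)'_t = f(‖Y, Y'‖_𝓓 / R) Y'_t`. -/
def cutDeriv (𝓑 : InterpolationFamily B) (t : ℝ) : B (α - γ) :=
  f (crpNorm 𝓑 α W Y Y' / R) • Y' t

/-- `F_R(Y)(t) = F(χ_R(Y)_t)`. -/
def truncF (𝓑 : InterpolationFamily B) (t : ℝ) : B (α - δ) := F (cut α f W R Y Y' 𝓑 t)

/-- `G_R(Y)(t) = G(χ_R(Y)_t)`. -/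
def truncG (𝓑 : InterpolationFamily B) (t : ℝ) : B (α - σ) := G α (cut α f W R Y Y' 𝓑 t)

/-- The Gubinelli derivative `G_R(Y)'(t) = DG(χ_R(Y)_t) χ_R(Y)'_t`, where `DG` is the derivative of
`G : B (α - γ) → B (α - γ - σ)`. -/
def truncGDeriv (𝓑 : InterpolationFamily B) (t : ℝ) : B (α - γ - σ) :=
  fderiv ℝ (G (α - γ)) (𝓑.emb α (α - γ) (cut α f W R Y Y' 𝓑 t)) (cutDeriv α f W R Y Y' 𝓑 t)

/-- `z ∈ B α` is the value `∫₀ᵗ S_{t-r} F_R(Y)(r) dr + ∫₀ᵗ S_{t-r} G_R(Y)(r) d𝐖_r`.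
The first integral is a Bochner integral in `B (α - δ)`, the second one a limit in `B (α - 2γ - σ)`;
both are required to lie in `B α`. As the embeddings are injective, `z` is unique. -/
def IsTruncValue (t : ℝ) (z : B α) : Prop :=
  ∃ d q : B α, z = d + q ∧
    IntervalIntegrable (fun r => S.S (α - δ) (t - r) (truncF α δ f F W R Y Y' 𝓑 r))
      MeasureTheory.volume 0 t ∧
    𝓑.emb α (α - δ) d = ∫ r in (0 : ℝ)..t, S.S (α - δ) (t - r) (truncF α δ f F W R Y Y' 𝓑 r) ∧
    IsRoughConvolution S W (α - 2 * γ - σ) (truncG α σ f G W R Y Y' 𝓑)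
      (truncGDeriv α σ f G W R Y Y' 𝓑) t (𝓑.emb α (α - 2 * γ - σ) q)

open Classical in
/-- `T_R(W, Y, Y')[t]` (with value `0` should the integrals not exist). -/
def truncMap (t : ℝ) : B α :=
  if h : ∃ z : B α, IsTruncValue S α σ δ f F G W R Y Y' t z then h.choose else 0

/-- The Gubinelli derivative `T_R(W, Y, Y')' = G_R(Y)`, as a path in `B (α - γ)`. -/
def truncMapDeriv (𝓑 : InterpolationFamily B) (t : ℝ) : B (α - γ) :=
  𝓑.emb (α - σ) (α - γ) (truncG α σ f G W R Y Y' 𝓑 t)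

end Equation

end RoughCut

end

/-! The map `T_R` is a linear operation, the mild integral, applied to the nonlinear data `F_R(Y)`
and `(G_R(Y), G_R(Y)')`. The difference of two values of `T_R` is therefore the mild integral of the
differences of the data, and the estimate splits into a linear bound and a smallness statement.

Smallness. The derivatives of `F` and `G` vanish at the origin and are Lipschitz near it, so on a
ball of radius `R` both maps have Lipschitz constant of order `R` (for `F` at large radii the global
Lipschitz bound suffices). The cut-off keeps the controlled path in a ball of radius `R`, and it is
Lipschitz with a constant independent of `R`: the factor `1 / R` from the argument of `f` is
compensated by a path of norm at most `R`. For `G` the difference must be measured in the controlled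
norm; this takes second order differences of `DG`, hence three derivatives, and costs three factors
`1 + ρ` (`IsDiffusion.exists_controlledBound`). Terms quadratic in `R` are absorbed because `R ≤ 1`.

Linear bound. The rough integral is sewn in `B (α - 2γ - σ)`, where the germ twisted by the
semigroup has a defect of order `3γ > 1` (`exists_isTwistedGerm`, `IsTwistedGerm.exists_sewing`).
Returning to `B α` costs `2γ + σ < 3γ`, so a positive power of time survives; summing along points
that approach the end time geometrically then gives values in `B α`
(`ParabolicSemigroup.exists_lift_of_increments`). Interpolation between the two spaces yields the
`2γ`-Hölder remainder in `B (α - 2γ)`. The drift is treated in the same way, starting from a Bochner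
integral in `B (α - δ)` with `δ < 1`. The outcome, `exists_mildIntegral`, costs one more factor `1 +
ρ`.

Together the Lipschitz constant of `T_R` is at most `(C_F + C_G (1 + ρ)⁴) R`, which is at most `K`
by the choice of `R`. -/

namespace RoughCut

/-! ### Fractional smoothing estimates by interpolation -/

section Spaces

variable {B : ℝ → Type*} [∀ β, NormedAddCommGroup (B β)] [∀ β, NormedSpace ℝ (B β)]
variable {𝓑 : InterpolationFamily B}

namespace InterpolationFamily

theorem emb_of_le (𝓑 : InterpolationFamily B) {a b : ℝ} (h : b ≤ a) : 𝓑.emb a b = 𝓑.incl h := by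
  simp [emb, h]

theorem emb_emb (𝓑 : InterpolationFamily B) {a b c : ℝ} (hab : a ≤ b) (hbc : b ≤ c) (x : B c) :
    𝓑.emb b a (𝓑.emb c b x) = 𝓑.emb c a x := by
  rw [𝓑.emb_of_le hab, 𝓑.emb_of_le hbc, 𝓑.emb_of_le (hab.trans hbc), 𝓑.incl_incl]

theorem emb_injective (𝓑 : InterpolationFamily B) {a b : ℝ} (h : b ≤ a) :
    Function.Injective (𝓑.emb a b) := by
  rw [𝓑.emb_of_le h]; exact 𝓑.incl_injective h

/-- The interpolation inequality applied to power bounds in a small parameter `τ`. -/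
theorem interpolation_rpow (𝓑 : InterpolationFamily B) {a b c : ℝ} (hab : a ≤ b) (hbc : b ≤ c)
    (hac : a < c) : ∃ C : ℝ, 0 ≤ C ∧ ∀ (x : B c) (N τ p q r : ℝ), 0 ≤ N → 0 < τ → τ ≤ 1 →
      ‖𝓑.emb c a x‖ ≤ N * τ ^ p → ‖x‖ ≤ N * τ ^ q →
      r * (c - a) ≤ p * (c - b) + q * (b - a) → ‖𝓑.emb c b x‖ ≤ C * N * τ ^ r := by
  obtain ⟨C, hC⟩ := 𝓑.interpolation hab hbc
  have hk : 0 < c - a := sub_pos.2 hac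
  -- The interpolation inequality is homogeneous of degree `c - a`, so its constant enters through
  -- the root of that order; `max` supplies the sign that is not assumed.
  refine ⟨(max C 0) ^ (1 / (c - a)), by positivity, fun x N τ p q r hN hτ hτ1 hp hq hr => ?_⟩
  have h := hC x
  rw [← 𝓑.emb_of_le, ← 𝓑.emb_of_le] at h
  have h1 : ‖𝓑.emb c b x‖ ^ (c - a) ≤
      max C 0 * ((N * τ ^ p) ^ (c - b) * (N * τ ^ q) ^ (b - a)) := by
    refine h.trans ?_
    rw [mul_assoc]
    have : 0 ≤ c - b := sub_nonneg.2 hbc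
    have : 0 ≤ b - a := sub_nonneg.2 hab
    gcongr
    exact le_max_left _ _
  have h2 : (N * τ ^ p) ^ (c - b) * (N * τ ^ q) ^ (b - a)
      = N ^ (c - a) * τ ^ (p * (c - b) + q * (b - a)) := by
    rw [Real.mul_rpow hN (by positivity), Real.mul_rpow hN (by positivity),
      ← Real.rpow_mul hτ.le, ← Real.rpow_mul hτ.le, Real.rpow_add hτ]
    have : N ^ (c - a) = N ^ (c - b) * N ^ (b - a) := by
      rw [← Real.rpow_add_of_nonneg hN (sub_nonneg.2 hbc) (sub_nonneg.2 hab)]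
      congr 1; ring
    rw [this]; ring
  have h3 : ‖𝓑.emb c b x‖ ^ (c - a) ≤ ((max C 0) ^ (1 / (c - a)) * N * τ ^ r) ^ (c - a) := by
    rw [mul_assoc, Real.mul_rpow (by positivity) (by positivity), ← Real.rpow_mul (le_max_right _ _),
      one_div_mul_cancel hk.ne', Real.rpow_one, Real.mul_rpow hN (by positivity),
      ← Real.rpow_mul hτ.le]
    refine h1.trans ?_
    rw [h2]
    have := Real.rpow_le_rpow_of_exponent_ge hτ hτ1 hr
    gcongr
  exact (Real.rpow_le_rpow_iff (norm_nonneg _) (by positivity) hk).1 h3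

/-- The embedding is bounded by a nonnegative constant. -/
theorem exists_norm_emb_le (𝓑 : InterpolationFamily B) (a b : ℝ) :
    ∃ C : ℝ, 0 ≤ C ∧ ∀ x : B a, ‖𝓑.emb a b x‖ ≤ C * ‖x‖ :=
  ⟨‖𝓑.emb a b‖, norm_nonneg _, (𝓑.emb a b).le_opNorm⟩

end InterpolationFamily

namespace ParabolicSemigroup

theorem emb_S (S : ParabolicSemigroup 𝓑) {a b : ℝ} (h : b ≤ a) {t : ℝ} (ht : 0 ≤ t) (x : B a) :
    𝓑.emb a b (S.S a t x) = S.S b t (𝓑.emb a b x) := by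
  rw [𝓑.emb_of_le h, S.map_incl h t ht]

/-- Banach–Steinhaus: each orbit is continuous, hence bounded, on `[0, 1]`. -/
theorem exists_norm_le (S : ParabolicSemigroup 𝓑) (β : ℝ) :
    ∃ M : ℝ, 1 ≤ M ∧ ∀ t ∈ Icc (0 : ℝ) 1, ∀ x : B β, ‖S.S β t x‖ ≤ M * ‖x‖ := by
  have := 𝓑.complete β
  obtain ⟨M, hM⟩ := banach_steinhaus (g := fun t : Icc (0 : ℝ) 1 => S.S β t) (fun x => by
    obtain ⟨C, hC⟩ := isCompact_Icc.exists_bound_of_continuousOn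
      ((S.continuousOn β x).mono (Icc_subset_Ici_self : Icc (0 : ℝ) 1 ⊆ Ici 0))
    exact ⟨C, fun t => hC t t.2⟩)
  refine ⟨max M 1, le_max_right _ _, fun t ht x => ((S.S β t).le_opNorm x).trans ?_⟩
  gcongr
  exact (hM ⟨t, ht⟩).trans (le_max_left _ _)

/-- Interpolation between `B a`, where `S t` is bounded, and `B (a + 1)`, where it costs `t⁻¹`. -/
theorem exists_smoothing_one (S : ParabolicSemigroup 𝓑) {a b : ℝ} (hab : a ≤ b) (hb : b ≤ a + 1) :
    ∃ C : ℝ, 0 ≤ C ∧ ∀ t ∈ Ioc (0 : ℝ) 1, ∀ x : B a,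
      ∃ y : B b, 𝓑.emb b a y = S.S a t x ∧ ‖y‖ ≤ C * t ^ (-(b - a)) * ‖x‖ := by
  obtain ⟨C, hC⟩ := S.smoothing a
  obtain ⟨M, hM1, hM⟩ := S.exists_norm_le a
  obtain ⟨D, hD, hI⟩ := 𝓑.interpolation_rpow hab hb (by linarith)
  refine ⟨D * max C M, by positivity, fun t ht x => ?_⟩
  obtain ⟨y, hy, hyn⟩ := hC t ht x
  refine ⟨𝓑.emb (a + 1) b y, by rw [𝓑.emb_emb hab hb, hy], ?_⟩
  have := hI y (max C M * ‖x‖) t 0 (-1) (-(b - a)) (by positivity) ht.1 ht.2 ?_ ?_ (by linarith)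
  · exact this.trans_eq (by ring)
  · rw [hy, Real.rpow_zero, mul_one]
    refine (hM t (Ioc_subset_Icc_self ht) x).trans ?_
    gcongr; exact le_max_right _ _
  · rw [Real.rpow_neg_one]
    have h1 := ht.1
    calc ‖y‖ ≤ C * t⁻¹ * ‖x‖ := hyn
      _ ≤ max C M * t⁻¹ * ‖x‖ := by gcongr; exact le_max_left _ _
      _ = _ := by ring

/-- Two half-steps `S (t / 2)`, each gaining half of `b - a`. Gains beyond `1` are needed because
the rough integral is sewn `2γ + σ` below `B α`, which may exceed `1`. -/
theorem exists_smoothing (S : ParabolicSemigroup 𝓑) {a b : ℝ} (hab : a ≤ b) (hb : b ≤ a + 2) :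
    ∃ C : ℝ, 0 ≤ C ∧ ∀ t ∈ Ioc (0 : ℝ) 1, ∀ x : B a,
      ∃ y : B b, 𝓑.emb b a y = S.S a t x ∧ ‖y‖ ≤ C * t ^ (-(b - a)) * ‖x‖ := by
  obtain ⟨C, hC0, hC⟩ := S.exists_smoothing_one (a := a) (b := (a + b) / 2)
    (by linarith) (by linarith)
  obtain ⟨D, hD0, hD⟩ := S.exists_smoothing_one (a := (a + b) / 2) (b := b)
    (by linarith) (by linarith)
  refine ⟨D * C * (1 / 2) ^ (-(b - a)), by positivity, fun t ht x => ?_⟩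
  have ht2 : t / 2 ∈ Ioc (0 : ℝ) 1 := ⟨half_pos ht.1, by linarith [ht.1, ht.2]⟩
  obtain ⟨y, hy, hyn⟩ := hC _ ht2 x
  obtain ⟨z, hz, hzn⟩ := hD _ ht2 y
  refine ⟨z, ?_, hzn.trans ?_⟩
  · rw [← 𝓑.emb_emb (a := a) (b := (a + b) / 2) (by linarith) (by linarith), hz,
      S.emb_S (by linarith) ht2.1.le, hy, ← S.map_add _ _ _ ht2.1.le ht2.1.le, add_halves]
  · have h0 := ht2.1
    calc D * (t / 2) ^ (-(b - (a + b) / 2)) * ‖y‖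
        ≤ D * (t / 2) ^ (-(b - (a + b) / 2)) * (C * (t / 2) ^ (-((a + b) / 2 - a)) * ‖x‖) := by
          gcongr
      _ = D * C * ((t / 2) ^ (-(b - (a + b) / 2)) * (t / 2) ^ (-((a + b) / 2 - a))) * ‖x‖ := by
          ring
      _ = D * C * (t / 2) ^ (-(b - a)) * ‖x‖ := by
          rw [← Real.rpow_add h0]; congr 3; ring
      _ = _ := by
          rw [div_eq_mul_one_div t, Real.mul_rpow ht.1.le (by norm_num)]; ring

/-- Interpolation of `S t x - x` between `B (b - 1)`, where it is of order `t`, and `B b`, where it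
is only bounded. -/
theorem exists_sub_id_le (S : ParabolicSemigroup 𝓑) {a b : ℝ} (hab : a ≤ b) (hb : b ≤ a + 1) :
    ∃ C : ℝ, 0 ≤ C ∧ ∀ t ∈ Icc (0 : ℝ) 1, ∀ x : B b,
      ‖S.S a t (𝓑.emb b a x) - 𝓑.emb b a x‖ ≤ C * t ^ (b - a) * ‖x‖ := by
  obtain ⟨C, hC⟩ := S.sub_id_le (b - 1)
  obtain ⟨M, hM1, hM⟩ := S.exists_norm_le b
  -- The endpoint bound at index `b - 1` concerns `B (b - 1 + 1)`, which is not definitionally `B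
  -- b`; passing between them costs the factor `E`.
  obtain ⟨E, hE0, hE⟩ := 𝓑.exists_norm_emb_le b (b - 1 + 1)
  obtain ⟨D, hD, hI⟩ := 𝓑.interpolation_rpow (a := b - 1) (b := a) (c := b) (by linarith) hab
    (by linarith)
  refine ⟨D * max (C * E) (M + 1), by positivity, fun t ht x => ?_⟩
  rcases ht.1.eq_or_lt with h0 | h0
  · rw [← h0, S.map_zero, sub_self, norm_zero]; positivity
  have ht' : t ∈ Ioc (0 : ℝ) 1 := ⟨h0, ht.2⟩
  have hC0 : 0 ≤ max C 0 := le_max_right _ _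
  have := hI (S.S b t x - x) (max (C * E) (M + 1) * ‖x‖) t 1 0 (b - a) (by positivity) h0 ht.2
    ?_ ?_ (by linarith)
  · rw [map_sub, S.emb_S hab h0.le] at this
    exact this.trans_eq (by ring)
  · have key := hC t ht' (𝓑.emb b (b - 1 + 1) x)
    rw [𝓑.emb_emb (by linarith) (by linarith)] at key
    rw [map_sub, S.emb_S (by linarith) h0.le, Real.rpow_one]
    refine key.trans ?_
    rcases le_or_gt 0 C with hc | hc
    · calc C * t * ‖𝓑.emb b (b - 1 + 1) x‖ ≤ C * t * (E * ‖x‖) := by gcongr; exact hE x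
        _ = (C * E) * ‖x‖ * t := by ring
        _ ≤ _ := by gcongr; exact le_max_left _ _
    · have : C * t * ‖𝓑.emb b (b - 1 + 1) x‖ ≤ 0 :=
        mul_nonpos_of_nonpos_of_nonneg (mul_nonpos_of_nonpos_of_nonneg hc.le h0.le)
          (norm_nonneg _)
      exact this.trans (by positivity)
  · rw [Real.rpow_zero, mul_one]
    calc ‖S.S b t x - x‖ ≤ ‖S.S b t x‖ + ‖x‖ := norm_sub_le _ _
      _ ≤ M * ‖x‖ + ‖x‖ := by gcongr; exact hM t ht x
      _ = (M + 1) * ‖x‖ := by ring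
      _ ≤ _ := by gcongr; exact le_max_right _ _

end ParabolicSemigroup

end Spaces

/-! ### Sewing lemma twisted by a semigroup -/

section Sewing

variable {E : Type*} [NormedAddCommGroup E] [NormedSpace ℝ E]

/-- The dyadic point `i / 2 ^ n`, clamped to `[s, t]`. -/
noncomputable def dyadicClamp (s t : ℝ) (n i : ℕ) : ℝ := max s (min t ((i : ℝ) / 2 ^ n))

/-- The twisted Riemann sum of `ξ` along the dyadic partition of level `n` of `[s, t]`. -/
noncomputable def twistedSum (T : ℝ → E →L[ℝ] E) (ξ : ℝ → ℝ → E) (s t : ℝ) (n : ℕ) : E :=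
  ∑ i ∈ Finset.range (2 ^ n),
    T (t - dyadicClamp s t n i) (ξ (dyadicClamp s t n i) (dyadicClamp s t n (i + 1)))

theorem dyadicClamp_mem {s t : ℝ} (h : s ≤ t) (n i : ℕ) : dyadicClamp s t n i ∈ Icc s t :=
  ⟨le_max_left _ _, max_le h (min_le_left _ _)⟩

theorem dyadicClamp_mono (s t : ℝ) (n : ℕ) {i j : ℕ} (h : i ≤ j) :
    dyadicClamp s t n i ≤ dyadicClamp s t n j := by
  unfold dyadicClamp; gcongr

theorem dyadicClamp_succ_sub_le (s t : ℝ) (n i : ℕ) :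
    dyadicClamp s t n (i + 1) - dyadicClamp s t n i ≤ (1 / 2) ^ n := by
  have hp : (0 : ℝ) ≤ (1 / 2) ^ n := by positivity
  have hx : ((i + 1 : ℕ) : ℝ) / 2 ^ n = (i : ℝ) / 2 ^ n + (1 / 2) ^ n := by
    push_cast; rw [add_div, one_div_pow]
  unfold dyadicClamp
  rw [hx]
  rcases le_total t ((i : ℝ) / 2 ^ n) with h1 | h1
  · rw [min_eq_left h1, min_eq_left (h1.trans (by linarith))]; simp
  · rw [min_eq_right h1, sub_le_iff_le_add]
    refine max_le ?_ ?_
    · linarith [le_max_left s ((i : ℝ) / 2 ^ n)]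
    · exact (min_le_right _ _).trans (by linarith [le_max_right s ((i : ℝ) / 2 ^ n)])

theorem dyadicClamp_zero {s t : ℝ} (hs : 0 ≤ s) (hst : s ≤ t) (n : ℕ) :
    dyadicClamp s t n 0 = s := by
  simp [dyadicClamp, min_eq_right (hs.trans hst), hs]

theorem dyadicClamp_two_pow {s t : ℝ} (hst : s ≤ t) (ht : t ≤ 1) (n : ℕ) :
    dyadicClamp s t n (2 ^ n) = t := by
  simp [dyadicClamp, min_eq_left ht, hst]

theorem dyadicClamp_two_mul (s t : ℝ) (n i : ℕ) :
    dyadicClamp s t (n + 1) (2 * i) = dyadicClamp s t n i := by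
  unfold dyadicClamp
  congr 2
  push_cast
  rw [pow_succ]
  field_simp

/-- All intervals use the same dyadic points of `[0, 1]`, only clamped differently. This makes the
sums over `[s, u]`, `[u, t]` and `[s, t]` comparable cell by cell. -/
theorem min_dyadicClamp {s u t : ℝ} (hsu : s ≤ u) (hut : u ≤ t) (n i : ℕ) :
    dyadicClamp s u n i = min u (dyadicClamp s t n i) := by
  unfold dyadicClamp
  rw [min_max_distrib_left, min_eq_right hsu, ← min_assoc, min_eq_left hut]

theorem max_dyadicClamp {s u t : ℝ} (hsu : s ≤ u) (n i : ℕ) :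
    dyadicClamp u t n i = max u (dyadicClamp s t n i) := by
  unfold dyadicClamp
  rw [← max_assoc, max_eq_left hsu]

theorem sum_range_two_mul {M : Type*} [AddCommMonoid M] (g : ℕ → M) (k : ℕ) :
    ∑ i ∈ Finset.range (2 * k), g i = ∑ i ∈ Finset.range k, (g (2 * i) + g (2 * i + 1)) := by
  induction k with
  | zero => simp
  | succ k ih =>
    rw [show 2 * (k + 1) = 2 * k + 1 + 1 by ring, Finset.sum_range_succ, Finset.sum_range_succ, ih,
      Finset.sum_range_succ, add_assoc]

/-- The sum of the increments raised to the power `η > 1` along a dyadic partition is small. -/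
theorem sum_dyadicClamp_rpow_le {s t μ η : ℝ} (hs : 0 ≤ s) (hst : s ≤ t) (ht : t ≤ 1)
    (hμ : 1 ≤ μ) (hη : μ < η) (n : ℕ) :
    ∑ i ∈ Finset.range (2 ^ n), (dyadicClamp s t n (i + 1) - dyadicClamp s t n i) ^ η
      ≤ (t - s) ^ μ * ((1 / 2 : ℝ) ^ (η - μ)) ^ n := by
  rcases hst.eq_or_lt with rfl | hlt
  · have : ∀ i, dyadicClamp s s n i = s := fun i => by
      have := dyadicClamp_mem (le_refl s) n i; exact le_antisymm this.2 this.1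
    simp [this, Real.zero_rpow (by linarith : η ≠ 0), Real.zero_rpow (by linarith : μ ≠ 0)]
  have h0 : 0 < t - s := sub_pos.2 hlt
  -- One factor of the increment is kept for telescoping. The remaining power `η - 1` is split into
  -- `μ - 1`, bounded through `t - s`, and `η - μ`, bounded through the mesh `2⁻ⁿ`.
  have hterm : ∀ i ∈ Finset.range (2 ^ n),
      (dyadicClamp s t n (i + 1) - dyadicClamp s t n i) ^ η ≤
      (dyadicClamp s t n (i + 1) - dyadicClamp s t n i) *
        ((t - s) ^ (μ - 1) * ((1 / 2 : ℝ) ^ (η - μ)) ^ n) := fun i _ => by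
    set d := dyadicClamp s t n (i + 1) - dyadicClamp s t n i with hd
    have hd0 : 0 ≤ d := sub_nonneg.2 (dyadicClamp_mono s t n (Nat.le_succ i))
    rcases hd0.eq_or_lt with h | h
    · rw [← h, Real.zero_rpow (by linarith), zero_mul]
    have e : d ^ η = d * (d ^ (μ - 1) * d ^ (η - μ)) := by
      rw [← Real.rpow_add h]
      nth_rw 2 [← Real.rpow_one d]
      rw [← Real.rpow_add h]; congr 1; ring
    have e2 : ((1 / 2 : ℝ) ^ (η - μ)) ^ n = ((1 / 2 : ℝ) ^ n) ^ (η - μ) := by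
      rw [← Real.rpow_natCast, ← Real.rpow_natCast, ← Real.rpow_mul (by norm_num),
        ← Real.rpow_mul (by norm_num), mul_comm]
    have h1 : d ≤ t - s := by
      linarith [(dyadicClamp_mem hst n (i + 1)).2, (dyadicClamp_mem hst n i).1]
    have h2 : d ≤ (1 / 2) ^ n := dyadicClamp_succ_sub_le s t n i
    have : 0 ≤ μ - 1 := by linarith
    have : 0 ≤ η - μ := by linarith
    rw [e, e2]
    gcongr
  refine (Finset.sum_le_sum hterm).trans_eq ?_
  rw [← Finset.sum_mul, Finset.sum_range_sub, dyadicClamp_two_pow hst ht, dyadicClamp_zero hs hst,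
    ← mul_assoc]
  congr 1
  nth_rw 1 [← Real.rpow_one (t - s)]
  rw [← Real.rpow_add h0]; congr 1; ring

/-- The hypotheses of the sewing lemma twisted by a semigroup on `[0, 1]`. -/
structure IsTwistedGerm (T : ℝ → E →L[ℝ] E) (M : ℝ) (ξ : ℝ → ℝ → E) (A η : ℝ) : Prop where
  map_zero : ∀ x, T 0 x = x
  map_add : ∀ s t, 0 ≤ s → 0 ≤ t → ∀ x, T (s + t) x = T s (T t x)
  norm_le : ∀ t ∈ Icc (0 : ℝ) 1, ∀ x, ‖T t x‖ ≤ M * ‖x‖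
  diag : ∀ s ∈ Icc (0 : ℝ) 1, ξ s s = 0
  defect : ∀ u m v, 0 ≤ u → u ≤ m → m ≤ v → v ≤ 1 →
    ‖T (m - u) (ξ u v - ξ u m) - ξ m v‖ ≤ A * (v - u) ^ η
  M_nonneg : 0 ≤ M
  A_nonneg : 0 ≤ A

variable {T : ℝ → E →L[ℝ] E} {M A η μ : ℝ} {ξ : ℝ → ℝ → E}

/-- Since `T (t - u) = T (t - m) T (m - u)`, the expression is `T (t - m)` applied to the local
defect. -/
theorem IsTwistedGerm.norm_defect_le (h : IsTwistedGerm T M ξ A η) {u m v t : ℝ} (hu : 0 ≤ u)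
    (hum : u ≤ m) (hmv : m ≤ v) (hvt : v ≤ t) (ht : t ≤ 1) :
    ‖T (t - u) (ξ u v) - T (t - u) (ξ u m) - T (t - m) (ξ m v)‖ ≤ M * A * (v - u) ^ η := by
  have e : ∀ x, T (t - u) x = T (t - m) (T (m - u) x) := fun x => by
    rw [← h.map_add _ _ (by linarith) (by linarith)]; congr 2; ring
  rw [e, e, ← map_sub, ← map_sub, ← map_sub, mul_assoc]
  refine (h.norm_le _ ⟨by linarith, by linarith⟩ _).trans ?_
  exact mul_le_mul_of_nonneg_left (h.defect u m v hu hum hmv (hvt.trans ht)) h.M_nonneg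

/-- The even points of level `n + 1` are the points of level `n`, so refinement produces one defect
per cell. -/
theorem IsTwistedGerm.norm_twistedSum_sub_succ_le (h : IsTwistedGerm T M ξ A η) (hμ : 1 ≤ μ)
    (hη : μ < η) {s t : ℝ} (hs : 0 ≤ s) (hst : s ≤ t) (ht : t ≤ 1) (n : ℕ) :
    ‖twistedSum T ξ s t n - twistedSum T ξ s t (n + 1)‖
      ≤ M * A * (t - s) ^ μ * ((1 / 2 : ℝ) ^ (η - μ)) ^ n := by
  have hM := h.M_nonneg
  have hA := h.A_nonneg
  unfold twistedSum
  rw [pow_succ' 2 n, sum_range_two_mul, ← Finset.sum_sub_distrib]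
  refine (norm_sum_le _ _).trans ?_
  refine (Finset.sum_le_sum (g := fun i => M * A *
    (dyadicClamp s t n (i + 1) - dyadicClamp s t n i) ^ η) fun i _ => ?_).trans ?_
  · have e : dyadicClamp s t (n + 1) (2 * i + 1 + 1) = dyadicClamp s t n (i + 1) := by
      rw [← dyadicClamp_two_mul s t n (i + 1)]; congr 1
    have h1 := dyadicClamp_mono s t (n + 1) (Nat.le_succ (2 * i))
    have h2 := dyadicClamp_mono s t (n + 1) (Nat.le_succ (2 * i + 1))
    rw [Nat.succ_eq_add_one, dyadicClamp_two_mul] at h1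
    rw [Nat.succ_eq_add_one, e] at h2
    rw [e, dyadicClamp_two_mul, ← sub_sub]
    exact h.norm_defect_le (hs.trans (dyadicClamp_mem hst n i).1) h1 h2
      (dyadicClamp_mem hst n (i + 1)).2 ht
  · rw [← Finset.mul_sum, mul_assoc (M * A)]
    exact mul_le_mul_of_nonneg_left (sum_dyadicClamp_rpow_le hs hst ht hμ hη n) (by positivity)

/-- Cells on either side of `u` cancel, because the germ vanishes on degenerate cells; only a cell
containing `u` contributes, and it contributes one defect. The bound tends to `0` with `n`, which
gives additivity in the limit. -/
theorem IsTwistedGerm.norm_twistedSum_add_le (h : IsTwistedGerm T M ξ A η) (hμ : 1 ≤ μ)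
    (hη : μ < η) {s u t : ℝ} (hs : 0 ≤ s) (hsu : s ≤ u) (hut : u ≤ t) (ht : t ≤ 1) (n : ℕ) :
    ‖twistedSum T ξ s t n - T (t - u) (twistedSum T ξ s u n) - twistedSum T ξ u t n‖
      ≤ M * A * (t - s) ^ μ * ((1 / 2 : ℝ) ^ (η - μ)) ^ n := by
  have hM := h.M_nonneg
  have hA := h.A_nonneg
  have hst := hsu.trans hut
  unfold twistedSum
  rw [map_sum, ← Finset.sum_sub_distrib, ← Finset.sum_sub_distrib]
  refine (norm_sum_le _ _).trans ?_
  refine (Finset.sum_le_sum (g := fun i => M * A *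
    (dyadicClamp s t n (i + 1) - dyadicClamp s t n i) ^ η) fun i _ => ?_).trans ?_
  · rw [min_dyadicClamp hsu hut n i, min_dyadicClamp hsu hut n (i + 1),
      max_dyadicClamp hsu n i, max_dyadicClamp hsu n (i + 1)]
    have hab := dyadicClamp_mono s t n (Nat.le_succ i)
    have ha := dyadicClamp_mem hst n i
    have hb := dyadicClamp_mem hst n (i + 1)
    rw [Nat.succ_eq_add_one] at hab
    set a := dyadicClamp s t n i
    set b := dyadicClamp s t n (i + 1)
    have hnn : 0 ≤ M * A * (b - a) ^ η :=
      mul_nonneg (by positivity) (Real.rpow_nonneg (by linarith) _)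
    have e : ∀ x, min u a ≤ u → T (t - u) (T (u - min u a) x) = T (t - min u a) x := fun x hx => by
      rw [← h.map_add _ _ (by linarith) (by linarith)]; congr 2; ring
    rw [e _ (min_le_left _ _)]
    have hu : ξ u u = 0 := h.diag u ⟨by linarith, by linarith⟩
    rcases le_total b u with hbu | hub
    · rw [min_eq_right hbu, min_eq_right (hab.trans hbu), max_eq_left hbu,
        max_eq_left (hab.trans hbu), hu]
      simpa using hnn
    rcases le_total u a with hua | hau
    · rw [min_eq_left hua, min_eq_left hub, max_eq_right hua, max_eq_right hub, hu]
      simpa using hnn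
    · rw [min_eq_right hau, min_eq_left hub, max_eq_left hau, max_eq_right hub]
      exact h.norm_defect_le (hs.trans ha.1) hau hub hb.2 ht
  · rw [← Finset.mul_sum, mul_assoc (M * A)]
    exact mul_le_mul_of_nonneg_left (sum_dyadicClamp_rpow_le hs hst ht hμ hη n) (by positivity)

/-- The sewing lemma twisted by a semigroup. -/
theorem IsTwistedGerm.exists_sewing [CompleteSpace E] (h : IsTwistedGerm T M ξ A η) (hμ : 1 ≤ μ)
    (hη : μ < η) : ∃ X : ℝ → ℝ → E,
      (∀ s u t, 0 ≤ s → s ≤ u → u ≤ t → t ≤ 1 → X s t = T (t - u) (X s u) + X u t) ∧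
      ∀ s t, 0 ≤ s → s ≤ t → t ≤ 1 →
        ‖X s t - T (t - s) (ξ s t)‖ ≤ M * A / (1 - (1 / 2 : ℝ) ^ (η - μ)) * (t - s) ^ μ := by
  set q : ℝ := (1 / 2 : ℝ) ^ (η - μ) with hq
  have hq0 : 0 ≤ q := by positivity
  have hq1 : q < 1 := Real.rpow_lt_one (by norm_num) (by norm_num) (by linarith)
  have hd : ∀ s t, 0 ≤ s → s ≤ t → t ≤ 1 → ∀ n,
      dist (twistedSum T ξ s t n) (twistedSum T ξ s t (n + 1)) ≤ M * A * (t - s) ^ μ * q ^ n :=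
    fun s t hs hst ht n => by
      rw [dist_eq_norm]; exact h.norm_twistedSum_sub_succ_le hμ hη hs hst ht n
  have hlim : ∀ s t, 0 ≤ s → s ≤ t → t ≤ 1 → Tendsto (twistedSum T ξ s t) atTop
      (𝓝 (limUnder atTop (twistedSum T ξ s t))) := fun s t hs hst ht =>
    (cauchySeq_of_le_geometric q _ hq1 (hd s t hs hst ht)).tendsto_limUnder
  refine ⟨fun s t => limUnder atTop (twistedSum T ξ s t), fun s u t hs hsu hut ht => ?_,
    fun s t hs hst ht => ?_⟩
  · have h1 := ((hlim s t hs (hsu.trans hut) ht).sub (((T (t - u)).continuous.tendsto _).comp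
      (hlim s u hs hsu (hut.trans ht)))).sub (hlim u t (hs.trans hsu) hut ht)
    have h2 : Tendsto (fun n => M * A * (t - s) ^ μ * q ^ n) atTop (𝓝 0) := by
      simpa using (tendsto_pow_atTop_nhds_zero_of_lt_one hq0 hq1).const_mul (M * A * (t - s) ^ μ)
    have h3 := squeeze_zero_norm (fun n => h.norm_twistedSum_add_le hμ hη hs hsu hut ht n) h2
    have := tendsto_nhds_unique h1 h3
    rw [sub_sub, sub_eq_zero] at this
    exact this
  · have := dist_le_of_le_geometric_of_tendsto₀ q _ hq1 (hd s t hs hst ht) (hlim s t hs hst ht)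
    -- At level `0` the grid is `{0, 1}`, clamped to `{s, t}`, so the sum is the germ itself.
    have e : twistedSum T ξ s t 0 = T (t - s) (ξ s t) := by
      have h1 := dyadicClamp_two_pow hst ht 0
      rw [pow_zero] at h1
      simp [twistedSum, dyadicClamp_zero hs hst, h1]
    rw [e, dist_comm, dist_eq_norm] at this
    exact this.trans_eq (by ring)

end Sewing

/-! ### Gaining space regularity for additive functionals -/

section Lift

variable {B : ℝ → Type*} [∀ β, NormedAddCommGroup (B β)] [∀ β, NormedSpace ℝ (B β)]
variable {𝓑 : InterpolationFamily B} (S : ParabolicSemigroup 𝓑)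

/-- A twisted additive functional all of whose increments over `[u, v]` are regularised by
`S (v - u)` takes values in the smaller space. -/
theorem ParabolicSemigroup.exists_lift_of_increments {a b κ : ℝ} (hκ : 0 < κ) :
    ∃ C : ℝ, 0 ≤ C ∧ ∀ (X : ℝ → ℝ → B a) (A p N : ℝ), 0 < p → 0 ≤ N →
      (∀ s u t, 0 ≤ s → s ≤ u → u ≤ t → t ≤ 1 → X s t = S.S a (t - u) (X s u) + X u t) →
      (∀ s t, 0 ≤ s → s ≤ t → t ≤ 1 → ‖X s t‖ ≤ A * (t - s) ^ p) →
      (∀ u v, 0 ≤ u → u < v → v ≤ 1 → ∃ x : B b, 𝓑.emb b a x = S.S a (v - u) (X u v) ∧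
        ‖x‖ ≤ N * (v - u) ^ κ) →
      ∀ s t, 0 ≤ s → s ≤ t → t ≤ 1 →
        ∃ x : B b, 𝓑.emb b a x = X s t ∧ ‖x‖ ≤ C * N * (t - s) ^ κ := by
  set q : ℝ := (1 / 2 : ℝ) ^ κ with hq
  have hq0 : 0 ≤ q := by positivity
  have hq1 : q < 1 := Real.rpow_lt_one (by norm_num) (by norm_num) hκ
  refine ⟨(1 - q)⁻¹, by simpa using hq1.le, fun X A p N hp hN hadd hsmall hreg s t hs hst ht => ?_⟩
  have := 𝓑.complete b
  rcases hst.eq_or_lt with rfl | hlt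
  · refine ⟨0, ?_, by simp [Real.zero_rpow hκ.ne']⟩
    have := hsmall s s hs le_rfl ht
    rw [sub_self, Real.zero_rpow hp.ne', mul_zero] at this
    rw [_root_.map_zero, norm_le_zero_iff.1 this]
  -- The distance to `t` is halved at each step, so `t - τ (k + 1) = τ (k + 1) - τ k`: in the
  -- telescoped `X s t` each increment carries exactly the smoothing that `hreg` requires.
  set τ : ℕ → ℝ := fun k => t - (t - s) * (1 / 2) ^ k with hτ
  have h0 : 0 < t - s := sub_pos.2 hlt
  have hpow : ∀ k : ℕ, (1 / 2 : ℝ) ^ k ≤ 1 := fun k => pow_le_one₀ (by norm_num) (by norm_num)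
  have hpow0 : ∀ k : ℕ, 0 < (1 / 2 : ℝ) ^ k := fun k => by positivity
  have hτs : ∀ k, s ≤ τ k := fun k => by simp only [hτ]; nlinarith [hpow k]
  have hτt : ∀ k, τ k < t := fun k => by simp only [hτ]; nlinarith [hpow0 k]
  have hd1 : ∀ k, τ (k + 1) - τ k = (t - s) * (1 / 2) ^ (k + 1) := fun k => by
    simp only [hτ, pow_succ]; ring
  have hd2 : ∀ k, t - τ (k + 1) = (t - s) * (1 / 2) ^ (k + 1) := fun k => by
    simp only [hτ]; ring
  have hlt' : ∀ k, τ k < τ (k + 1) := fun k => by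
    rw [← sub_pos, hd1]; exact mul_pos h0 (hpow0 _)
  choose x hx hxn using fun k => hreg (τ k) (τ (k + 1)) (hs.trans (hτs k)) (hlt' k)
    ((hτt _).le.trans ht)
  have hxn' : ∀ k, ‖x k‖ ≤ N * (t - s) ^ κ * q ^ k := fun k => by
    refine (hxn k).trans ?_
    rw [hd1, Real.mul_rpow h0.le (hpow0 _).le, ← mul_assoc]
    gcongr
    rw [hq, ← Real.rpow_natCast, ← Real.rpow_natCast, ← Real.rpow_mul (by norm_num),
      ← Real.rpow_mul (by norm_num)]
    refine Real.rpow_le_rpow_of_exponent_ge (by norm_num) (by norm_num) ?_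
    push_cast; nlinarith
  have hgeo : HasSum (fun k : ℕ => N * (t - s) ^ κ * q ^ k) (N * (t - s) ^ κ * (1 - q)⁻¹) :=
    (hasSum_geometric_of_lt_one hq0 hq1).mul_left _
  have hsum : Summable x := Summable.of_norm_bounded hgeo.summable hxn'
  refine ⟨∑' k, x k, ?_, ?_⟩
  · have h1 := ((𝓑.emb b a).hasSum hsum.hasSum).tendsto_sum_nat
    have hpart : ∀ n, ∑ k ∈ Finset.range n, 𝓑.emb b a (x k) = X s t - X (τ n) t := fun n => by
      induction n with
      | zero => simp [hτ]
      | succ n ih =>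
        rw [Finset.sum_range_succ, ih, hx, hd1, ← hd2,
          hadd (τ n) (τ (n + 1)) t (hs.trans (hτs n)) (hlt' n).le (hτt _).le ht]
        abel
    -- The unsummed tail has no bound in `B b`; it is enough that it vanishes in `B a`, where the
    -- sum is identified.
    have h2 : Tendsto (fun n => X (τ n) t) atTop (𝓝 0) := by
      refine squeeze_zero_norm (fun n => hsmall _ _ (hs.trans (hτs n)) (hτt n).le ht) ?_
      have h3 : Tendsto (fun n => t - τ n) atTop (𝓝 0) := by
        have := (tendsto_pow_atTop_nhds_zero_of_lt_one (r := (1 / 2 : ℝ)) (by norm_num)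
          (by norm_num)).const_mul (t - s)
        simpa [hτ] using this
      have h4 := (h3.rpow_const (p := p) (Or.inr hp.le)).const_mul A
      simpa [Real.zero_rpow hp.ne'] using h4
    have h5 : Tendsto (fun n => X s t - X (τ n) t) atTop (𝓝 (X s t)) := by
      simpa using h2.const_sub (X s t)
    simp only [hpart] at h1
    exact tendsto_nhds_unique h1 h5
  · refine (tsum_of_norm_bounded hgeo hxn').trans_eq (by ring)

end Lift

/-! ### Supremum and Hölder norms -/

section Holder

variable {E : Type*} [NormedAddCommGroup E]

theorem IsHolder.norm_le {θ : ℝ} (hθ : 0 < θ) {Q : ℝ → ℝ → E} (h : IsHolder θ Q) {s t : ℝ}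
    (hs : 0 ≤ s) (hst : s ≤ t) (ht : t ≤ 1) : ‖Q s t‖ ≤ holderNorm θ Q * (t - s) ^ θ := by
  obtain ⟨C, hC⟩ := h
  -- On the diagonal the quotient carries no information; there `Q s s = 0` because `0 ^ θ = 0`.
  rcases hst.eq_or_lt with rfl | hlt
  · have := hC (s, s) ⟨hs, le_rfl, ht⟩
    simpa [Real.zero_rpow hθ.ne'] using this
  have h0 : 0 < (t - s) ^ θ := Real.rpow_pos_of_pos (sub_pos.2 hlt) _
  rw [← div_le_iff₀ h0]
  refine le_ciSup (f := fun p : simplex => ‖Q p.1.1 p.1.2‖ / (p.1.2 - p.1.1) ^ θ)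
    ⟨max C 0, ?_⟩ ⟨(s, t), hs, hst, ht⟩
  rintro _ ⟨⟨p, hp⟩, rfl⟩
  have hp0 : 0 ≤ (p.2 - p.1) ^ θ := Real.rpow_nonneg (sub_nonneg.2 hp.2.1) _
  refine div_le_of_le_mul₀ hp0 (le_max_right _ _) ((hC p hp).trans ?_)
  gcongr
  exact le_max_left _ _

theorem holderNorm_nonneg (θ : ℝ) (Q : ℝ → ℝ → E) : 0 ≤ holderNorm θ Q :=
  Real.iSup_nonneg fun p => div_nonneg (norm_nonneg _)
    (Real.rpow_nonneg (sub_nonneg.2 p.2.2.1) _)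

theorem holderNorm_le {θ N : ℝ} (hN : 0 ≤ N) {Q : ℝ → ℝ → E}
    (h : ∀ s t, 0 ≤ s → s ≤ t → t ≤ 1 → ‖Q s t‖ ≤ N * (t - s) ^ θ) : holderNorm θ Q ≤ N := by
  have : Nonempty simplex := ⟨⟨(0, 0), by simp [simplex]⟩⟩
  exact ciSup_le fun p => div_le_of_le_mul₀ (Real.rpow_nonneg (sub_nonneg.2 p.2.2.1) _) hN
    (h _ _ p.2.1 p.2.2.1 p.2.2.2)

theorem supNorm_nonneg (U : ℝ → E) : 0 ≤ supNorm U := Real.iSup_nonneg fun _ => norm_nonneg _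

theorem supNorm_le {N : ℝ} {U : ℝ → E} (h : ∀ t ∈ Icc (0 : ℝ) 1, ‖U t‖ ≤ N) : supNorm U ≤ N := by
  have : Nonempty (Icc (0 : ℝ) 1) := ⟨⟨0, by simp⟩⟩
  exact ciSup_le fun t => h t t.2

/-- Continuity makes the supremum a genuine one: the real supremum of an unbounded family is `0`. -/
theorem norm_le_supNorm {U : ℝ → E} (h : ContinuousOn U (Icc 0 1)) {t : ℝ}
    (ht : t ∈ Icc (0 : ℝ) 1) : ‖U t‖ ≤ supNorm U := by
  obtain ⟨C, hC⟩ := isCompact_Icc.exists_bound_of_continuousOn h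
  exact le_ciSup (f := fun t : Icc (0 : ℝ) 1 => ‖U t‖)
    ⟨C, by rintro _ ⟨t, rfl⟩; exact hC t t.2⟩ ⟨t, ht⟩

end Holder

/-! ### Rough paths, controlled bounds and the germ of the rough integral -/

section Paths

variable {γ : ℝ} (W : RoughPath γ)

namespace RoughPath

theorem rho_nonneg : 0 ≤ W.rho := add_nonneg (holderNorm_nonneg _ _) (holderNorm_nonneg _ _)

theorem abs_path_le (hγ : 0 < γ) {s t : ℝ} (hs : 0 ≤ s) (hst : s ≤ t) (ht : t ≤ 1) :
    |W.path t - W.path s| ≤ W.rho * (t - s) ^ γ := by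
  refine (W.path_holder.norm_le hγ hs hst ht).trans ?_
  have : 0 ≤ t - s := sub_nonneg.2 hst
  unfold rho
  gcongr
  exact le_add_of_nonneg_right (holderNorm_nonneg _ _)

theorem abs_area_le (hγ : 0 < γ) {s t : ℝ} (hs : 0 ≤ s) (hst : s ≤ t) (ht : t ≤ 1) :
    |W.area s t| ≤ W.rho * (t - s) ^ (2 * γ) := by
  refine (W.area_holder.norm_le (by linarith) hs hst ht).trans ?_
  have : 0 ≤ t - s := sub_nonneg.2 hst
  unfold rho
  gcongr
  exact le_add_of_nonneg_left (holderNorm_nonneg _ _)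

theorem area_self {s : ℝ} (hs : s ∈ Icc (0 : ℝ) 1) : W.area s s = 0 := by
  have := W.chen s s s hs.1 le_rfl le_rfl hs.2
  linarith

end RoughPath

variable {B : ℝ → Type*} [∀ β, NormedAddCommGroup (B β)] [∀ β, NormedSpace ℝ (B β)]
variable (𝓑 : InterpolationFamily B)

/-- Quantitative bounds for a controlled rough path `(V, V')` with values in `B a × B b`, whose
increments are measured in `B c`. -/
structure ControlledBound {a b : ℝ} (c : ℝ) (V : ℝ → B a) (V' : ℝ → B b) (N : ℝ) : Prop where
  bound : ∀ t ∈ Icc (0 : ℝ) 1, ‖V t‖ ≤ N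
  bound_deriv : ∀ t ∈ Icc (0 : ℝ) 1, ‖V' t‖ ≤ N
  holder_deriv : ∀ s t, 0 ≤ s → s ≤ t → t ≤ 1 → ‖𝓑.emb b c (V' t - V' s)‖ ≤ N * (t - s) ^ γ
  holder_remainder : ∀ s t, 0 ≤ s → s ≤ t → t ≤ 1 →
    ‖𝓑.emb a c (V t - V s) - (W.path t - W.path s) • 𝓑.emb b c (V' s)‖ ≤ N * (t - s) ^ (2 * γ)

variable {𝓑 W}

theorem ControlledBound.nonneg {a b c N : ℝ} {V : ℝ → B a} {V' : ℝ → B b}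
    (h : ControlledBound W 𝓑 c V V' N) : 0 ≤ N :=
  (norm_nonneg _).trans (h.bound 0 (by simp))

theorem ControlledBound.mono {a b c N N' : ℝ} {V : ℝ → B a} {V' : ℝ → B b}
    (h : ControlledBound W 𝓑 c V V' N) (hN : N ≤ N') : ControlledBound W 𝓑 c V V' N' where
  bound t ht := (h.bound t ht).trans hN
  bound_deriv t ht := (h.bound_deriv t ht).trans hN
  holder_deriv s t hs hst ht := (h.holder_deriv s t hs hst ht).trans
    (mul_le_mul_of_nonneg_right hN (Real.rpow_nonneg (sub_nonneg.2 hst) _))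
  holder_remainder s t hs hst ht := (h.holder_remainder s t hs hst ht).trans
    (mul_le_mul_of_nonneg_right hN (Real.rpow_nonneg (sub_nonneg.2 hst) _))

theorem ControlledBound.add {a b c N N₂ : ℝ} {V V₂ : ℝ → B a} {V' V₂' : ℝ → B b}
    (h : ControlledBound W 𝓑 c V V' N) (h₂ : ControlledBound W 𝓑 c V₂ V₂' N₂) :
    ControlledBound W 𝓑 c (fun t => V t + V₂ t) (fun t => V' t + V₂' t) (N + N₂) where
  bound t ht := (norm_add_le _ _).trans (add_le_add (h.bound t ht) (h₂.bound t ht))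
  bound_deriv t ht := (norm_add_le _ _).trans (add_le_add (h.bound_deriv t ht)
    (h₂.bound_deriv t ht))
  holder_deriv s t hs hst ht := by
    rw [add_sub_add_comm, map_add, add_mul]
    exact (norm_add_le _ _).trans (add_le_add (h.holder_deriv s t hs hst ht)
      (h₂.holder_deriv s t hs hst ht))
  holder_remainder s t hs hst ht := by
    rw [add_sub_add_comm, map_add, map_add, smul_add, add_sub_add_comm, add_mul]
    exact (norm_add_le _ _).trans (add_le_add (h.holder_remainder s t hs hst ht)
      (h₂.holder_remainder s t hs hst ht))

theorem ControlledBound.smul {a b c N : ℝ} {V : ℝ → B a} {V' : ℝ → B b}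
    (h : ControlledBound W 𝓑 c V V' N) (k : ℝ) :
    ControlledBound W 𝓑 c (fun t => k • V t) (fun t => k • V' t) (|k| * N) where
  bound t ht := by
    rw [norm_smul]; exact mul_le_mul_of_nonneg_left (h.bound t ht) (abs_nonneg k)
  bound_deriv t ht := by
    rw [norm_smul]; exact mul_le_mul_of_nonneg_left (h.bound_deriv t ht) (abs_nonneg k)
  holder_deriv s t hs hst ht := by
    rw [← smul_sub, map_smul, norm_smul, mul_assoc]
    exact mul_le_mul_of_nonneg_left (h.holder_deriv s t hs hst ht) (abs_nonneg k)
  holder_remainder s t hs hst ht := by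
    rw [← smul_sub, map_smul, map_smul, smul_comm, ← smul_sub, norm_smul, mul_assoc]
    exact mul_le_mul_of_nonneg_left (h.holder_remainder s t hs hst ht) (abs_nonneg k)

variable (W 𝓑)

/-- The germ `V_u W_{u,v} + V'_u 𝕎_{u,v}` of the rough integral. -/
noncomputable def germ {a b : ℝ} (c : ℝ) (V : ℝ → B a) (V' : ℝ → B b) (u v : ℝ) : B c :=
  (W.path v - W.path u) • 𝓑.emb a c (V u) + W.area u v • 𝓑.emb b c (V' u)

theorem riemannSum_eq {𝓑 : InterpolationFamily B} (S : ParabolicSemigroup 𝓑) {a b : ℝ} (c : ℝ)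
    (V : ℝ → B a) (V' : ℝ → B b) (t : ℝ) (n : ℕ) (p : ℕ → ℝ) :
    riemannSum S W c V V' t n p
      = ∑ i ∈ Finset.range n, S.S c (t - p i) (germ W 𝓑 c V V' (p i) (p (i + 1))) := by
  simp [riemannSum, germ]

/-- Chen's relation cancels the product of increments of `W` against the leading part of `V m - V
u`. What remains pairs `W` with the remainder and `𝕎` with an increment of `V'`, both of order `3γ`.
-/
theorem germ_sub_sub {a b : ℝ} (c : ℝ) (V : ℝ → B a) (V' : ℝ → B b) {u m v : ℝ} (hu : 0 ≤ u)
    (hum : u ≤ m) (hmv : m ≤ v) (hv : v ≤ 1) :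
    germ W 𝓑 c V V' u v - germ W 𝓑 c V V' u m - germ W 𝓑 c V V' m v
      = -((W.path v - W.path m) • (𝓑.emb a c (V m - V u)
          - (W.path m - W.path u) • 𝓑.emb b c (V' u)))
        - W.area m v • 𝓑.emb b c (V' m - V' u) := by
  have hc : W.area u v = W.area u m + W.area m v
      + (W.path m - W.path u) * (W.path v - W.path m) := by
    linarith [W.chen u m v hu hum hmv hv]
  simp only [germ, hc, map_sub]
  module

variable {𝓑}

theorem rpow_mul_rpow_le {x y τ p q : ℝ} (hx : 0 ≤ x) (hxτ : x ≤ τ) (hy : 0 ≤ y) (hyτ : y ≤ τ)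
    (hp : 0 ≤ p) (hq : 0 ≤ q) : x ^ p * y ^ q ≤ τ ^ (p + q) := by
  have h0 := hx.trans hxτ
  rw [Real.rpow_add_of_nonneg h0 hp hq]
  gcongr

/-- The twisted defect is `S (m - u)` applied to the untwisted one, plus `S (m - u) - Id` applied to
the germ on `[m, v]`. In the latter the gaps `2γ` and `γ` between the spaces complement the
exponents `γ` of `W` and `2γ` of `𝕎`, so every term has order `3γ`. -/
theorem exists_isTwistedGerm (S : ParabolicSemigroup 𝓑) {a b c : ℝ} (hγ : 0 < γ) (hγ' : γ ≤ 1 / 2) (hac : a - c = 2 * γ)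
    (hbc : b - c = γ) : ∃ M A : ℝ, 1 ≤ M ∧ 0 ≤ A ∧ ∀ (W : RoughPath γ) (V : ℝ → B a) (V' : ℝ → B b)
      (N : ℝ), ControlledBound W 𝓑 c V V' N →
      IsTwistedGerm (S.S c) M (germ W 𝓑 c V V') (A * W.rho * N) (3 * γ) := by
  obtain ⟨M, hM1, hM⟩ := S.exists_norm_le c
  obtain ⟨Ca, hCa0, hCa⟩ := S.exists_sub_id_le (a := c) (b := a) (by linarith) (by linarith)
  obtain ⟨Cb, hCb0, hCb⟩ := S.exists_sub_id_le (a := c) (b := b) (by linarith) (by linarith)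
  rw [hac] at hCa
  rw [hbc] at hCb
  refine ⟨M, 2 * M + Ca + Cb, hM1, by positivity, fun W V V' N h => ?_⟩
  have hN := h.nonneg
  have hρ := W.rho_nonneg
  refine ⟨S.map_zero c, fun s t hs ht => S.map_add c s t hs ht, hM, fun s hs => ?_,
    fun u m v hu hum hmv hv => ?_, by linarith, by positivity⟩
  · simp [germ, W.area_self hs]
  have e : S.S c (m - u) (germ W 𝓑 c V V' u v - germ W 𝓑 c V V' u m) - germ W 𝓑 c V V' m v
      = S.S c (m - u) (germ W 𝓑 c V V' u v - germ W 𝓑 c V V' u m - germ W 𝓑 c V V' m v)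
        + ((W.path v - W.path m) • (S.S c (m - u) (𝓑.emb a c (V m)) - 𝓑.emb a c (V m))
        + W.area m v • (S.S c (m - u) (𝓑.emb b c (V' m)) - 𝓑.emb b c (V' m))) := by
    simp only [map_sub, smul_sub]
    simp only [germ, map_add, map_smul]
    abel
  have h1 : (0 : ℝ) ≤ m - u := sub_nonneg.2 hum
  have h2 : (0 : ℝ) ≤ v - m := sub_nonneg.2 hmv
  have h3 : (0 : ℝ) ≤ v - u := by linarith
  have hmu : m - u ∈ Icc (0 : ℝ) 1 := ⟨h1, by linarith⟩
  have hm : m ∈ Icc (0 : ℝ) 1 := ⟨by linarith, by linarith⟩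
  have p1 : (m - u) ^ (2 * γ) * (v - m) ^ γ ≤ (v - u) ^ (3 * γ) :=
    (rpow_mul_rpow_le (τ := v - u) h1 (by linarith) h2 (by linarith) (by linarith)
      hγ.le).trans_eq (by congr 1; ring)
  have p2 : (m - u) ^ γ * (v - m) ^ (2 * γ) ≤ (v - u) ^ (3 * γ) :=
    (rpow_mul_rpow_le (τ := v - u) h1 (by linarith) h2 (by linarith) hγ.le
      (by linarith)).trans_eq (by congr 1; ring)
  have hW := W.abs_path_le hγ hm.1 hmv hv
  have hA := W.abs_area_le hγ hm.1 hmv hv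
  rw [e, germ_sub_sub W 𝓑 c V V' hu hum hmv hv]
  have t1 : ‖-((W.path v - W.path m) • (𝓑.emb a c (V m - V u)
      - (W.path m - W.path u) • 𝓑.emb b c (V' u))) - W.area m v • 𝓑.emb b c (V' m - V' u)‖
      ≤ 2 * W.rho * N * (v - u) ^ (3 * γ) := by
    refine (norm_sub_le _ _).trans ?_
    rw [norm_neg, norm_smul, norm_smul, Real.norm_eq_abs, Real.norm_eq_abs]
    calc _ ≤ (W.rho * (v - m) ^ γ) * (N * (m - u) ^ (2 * γ))
          + (W.rho * (v - m) ^ (2 * γ)) * (N * (m - u) ^ γ) := by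
          gcongr
          · exact h.holder_remainder u m hu hum hm.2
          · exact h.holder_deriv u m hu hum hm.2
      _ = W.rho * N * ((m - u) ^ (2 * γ) * (v - m) ^ γ)
          + W.rho * N * ((m - u) ^ γ * (v - m) ^ (2 * γ)) := by ring
      _ ≤ W.rho * N * (v - u) ^ (3 * γ) + W.rho * N * (v - u) ^ (3 * γ) := by gcongr
      _ = _ := by ring
  have t2 : ‖(W.path v - W.path m) • (S.S c (m - u) (𝓑.emb a c (V m)) - 𝓑.emb a c (V m))‖
      ≤ Ca * W.rho * N * (v - u) ^ (3 * γ) := by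
    rw [norm_smul, Real.norm_eq_abs]
    calc _ ≤ (W.rho * (v - m) ^ γ) * (Ca * (m - u) ^ (2 * γ) * N) := by
          gcongr
          refine (hCa _ hmu _).trans ?_
          gcongr
          exact h.bound m hm
      _ = Ca * W.rho * N * ((m - u) ^ (2 * γ) * (v - m) ^ γ) := by ring
      _ ≤ _ := by gcongr
  have t3 : ‖W.area m v • (S.S c (m - u) (𝓑.emb b c (V' m)) - 𝓑.emb b c (V' m))‖
      ≤ Cb * W.rho * N * (v - u) ^ (3 * γ) := by
    rw [norm_smul, Real.norm_eq_abs]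
    calc _ ≤ (W.rho * (v - m) ^ (2 * γ)) * (Cb * (m - u) ^ γ * N) := by
          gcongr
          refine (hCb _ hmu _).trans ?_
          gcongr
          exact h.bound_deriv m hm
      _ = Cb * W.rho * N * ((m - u) ^ γ * (v - m) ^ (2 * γ)) := by ring
      _ ≤ _ := by gcongr
  calc _ ≤ M * (2 * W.rho * N * (v - u) ^ (3 * γ))
        + (Ca * W.rho * N * (v - u) ^ (3 * γ) + Cb * W.rho * N * (v - u) ^ (3 * γ)) := by
        refine (norm_add_le _ _).trans (add_le_add ?_ ((norm_add_le _ _).trans (add_le_add t2 t3)))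
        exact (hM _ hmu _).trans (mul_le_mul_of_nonneg_left t1 (by linarith))
    _ = _ := by ring

/-- Increments of a controlled rough path in an intermediate space, by mollification with `S`. -/
theorem exists_norm_emb_sub_le (S : ParabolicSemigroup 𝓑) {a b c d : ℝ} (hγ : 0 < γ) (hγ' : γ ≤ 1 / 2) (hcd : c ≤ d)
    (hdb : d ≤ b) (hba : b ≤ a) (had : γ ≤ a - d) (had' : a - d ≤ 1) (hdc : d - c ≤ γ) :
    ∃ C : ℝ, 0 ≤ C ∧ ∀ (W : RoughPath γ) (V : ℝ → B a) (V' : ℝ → B b) (N : ℝ),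
      ControlledBound W 𝓑 c V V' N → ∀ s t, 0 ≤ s → s ≤ t → t ≤ 1 →
      ‖𝓑.emb a d (V t - V s)‖ ≤ C * (1 + W.rho) * N * (t - s) ^ γ := by
  obtain ⟨M, hM1, hM⟩ := S.exists_norm_le d
  obtain ⟨Ca, hCa0, hCa⟩ := S.exists_sub_id_le (a := d) (b := a) (by linarith) (by linarith)
  obtain ⟨Cb, hCb0, hCb⟩ := 𝓑.exists_norm_emb_le b d
  obtain ⟨Cs, hCs0, hCs⟩ := S.exists_smoothing (a := c) (b := d) hcd (by linarith)
  refine ⟨2 * Ca + M * Cb + Cs, by positivity, fun W V V' N h s t hs hst ht => ?_⟩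
  have hN := h.nonneg
  have hρ := W.rho_nonneg
  rcases hst.eq_or_lt with rfl | hlt
  · simp [Real.zero_rpow hγ.ne']
  have h0 : 0 < t - s := sub_pos.2 hlt
  have h1 : t - s ≤ 1 := by linarith
  have hI : t - s ∈ Icc (0 : ℝ) 1 := ⟨h0.le, h1⟩
  obtain ⟨y, hy, hyn⟩ := hCs (t - s) ⟨h0, h1⟩ (𝓑.emb a c (V t - V s)
    - (W.path t - W.path s) • 𝓑.emb b c (V' s))
  -- The increment is compared with its mollification over time `t - s`. The error gains `a - d ≥
  -- γ`; in the mollified part the remainder, of order `2γ` in `B c`, loses only `d - c ≤ γ` on its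
  -- way to `B d`.
  have e : 𝓑.emb a d (V t - V s) = -(S.S d (t - s) (𝓑.emb a d (V t - V s))
      - 𝓑.emb a d (V t - V s)) + ((W.path t - W.path s) • S.S d (t - s) (𝓑.emb b d (V' s)) + y) := by
    have : S.S d (t - s) (𝓑.emb a d (V t - V s))
        = (W.path t - W.path s) • S.S d (t - s) (𝓑.emb b d (V' s)) + y := by
      refine 𝓑.emb_injective hcd ?_
      rw [map_add, map_smul, hy, S.emb_S hcd h0.le, S.emb_S hcd h0.le,
        𝓑.emb_emb hcd (hdb.trans hba), 𝓑.emb_emb hcd hdb, map_sub (S.S c (t - s)), map_smul]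
      abel
    rw [← this]; abel
  have hs1 : s ∈ Icc (0 : ℝ) 1 := ⟨hs, by linarith⟩
  have ht1 : t ∈ Icc (0 : ℝ) 1 := ⟨by linarith, ht⟩
  have b1 : ‖S.S d (t - s) (𝓑.emb a d (V t - V s)) - 𝓑.emb a d (V t - V s)‖
      ≤ 2 * Ca * N * (t - s) ^ γ := by
    calc _ ≤ Ca * (t - s) ^ (a - d) * ‖V t - V s‖ := hCa _ hI _
      _ ≤ Ca * (t - s) ^ γ * (N + N) := by
          have := Real.rpow_le_rpow_of_exponent_ge h0 h1 had
          gcongr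
          exact (norm_sub_le _ _).trans (add_le_add (h.bound t ht1) (h.bound s hs1))
      _ = _ := by ring
  have b2 : ‖(W.path t - W.path s) • S.S d (t - s) (𝓑.emb b d (V' s))‖
      ≤ M * Cb * W.rho * N * (t - s) ^ γ := by
    rw [norm_smul, Real.norm_eq_abs]
    calc _ ≤ (W.rho * (t - s) ^ γ) * (M * (Cb * N)) := by
          gcongr
          · exact W.abs_path_le hγ hs hst ht
          · refine (hM _ hI _).trans ?_
            gcongr
            exact (hCb _).trans (mul_le_mul_of_nonneg_left (h.bound_deriv s hs1) hCb0)
      _ = _ := by ring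
  have b3 : ‖y‖ ≤ Cs * N * (t - s) ^ γ := by
    calc _ ≤ Cs * (t - s) ^ (-(d - c)) * (N * (t - s) ^ (2 * γ)) := by
          refine hyn.trans ?_
          gcongr
          exact h.holder_remainder s t hs hst ht
      _ = Cs * N * ((t - s) ^ (-(d - c)) * (t - s) ^ (2 * γ)) := by ring
      _ = Cs * N * (t - s) ^ (-(d - c) + 2 * γ) := by rw [Real.rpow_add h0]
      _ ≤ _ := mul_le_mul_of_nonneg_left
          (Real.rpow_le_rpow_of_exponent_ge h0 h1 (by linarith)) (by positivity)
  rw [e]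
  refine (norm_add_le _ _).trans ?_
  rw [norm_neg]
  have b4 := norm_add_le ((W.path t - W.path s) • S.S d (t - s) (𝓑.emb b d (V' s))) y
  have hp : 0 ≤ (t - s) ^ γ := by positivity
  -- The nonnegative terms that complete the sum of the bounds to the product `C * (1 + ρ)`.
  have r1 : 0 ≤ 2 * Ca * W.rho * N * (t - s) ^ γ := by positivity
  have r2 : 0 ≤ M * Cb * N * (t - s) ^ γ := by positivity
  have r3 : 0 ≤ Cs * W.rho * N * (t - s) ^ γ := by positivity
  linear_combination b1 + b2 + b3 + b4 + r1 + r2 + r3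

end Paths

/-! ### Convergence of Riemann sums along arbitrary partitions -/

section Partition

variable {E : Type*} [NormedAddCommGroup E] [NormedSpace ℝ E]
variable {T : ℝ → E →L[ℝ] E} {M A η μ : ℝ} {ξ : ℝ → ℝ → E}

theorem partition_mem_Icc {t : ℝ} {n : ℕ} {p : ℕ → ℝ} (h0 : p 0 = 0) (hn : p n = t)
    (h : ∀ i < n, p i < p (i + 1)) {i : ℕ} (hi : i ≤ n) : p i ∈ Icc 0 t := by
  have hmono : ∀ i j, i ≤ j → j ≤ n → p i ≤ p j := fun i j hij => by
    induction j, hij using Nat.le_induction with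
    | base => exact fun _ => le_rfl
    | succ j _ ih => exact fun hj => (ih (by omega)).trans (h j (by omega)).le
  exact ⟨h0 ▸ hmono 0 i (Nat.zero_le _) hi, hn ▸ hmono i n hi le_rfl⟩

/-- The sewn functional is the limit of the Riemann sums along all partitions. -/
theorem IsTwistedGerm.riemann_tendsto (h : IsTwistedGerm T M ξ A η) (hμ : 1 < μ) {K : ℝ}
    (hK : 0 ≤ K) {X : ℝ → ℝ → E}
    (hX : ∀ s u t, 0 ≤ s → s ≤ u → u ≤ t → t ≤ 1 → X s t = T (t - u) (X s u) + X u t)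
    (hXξ : ∀ s t, 0 ≤ s → s ≤ t → t ≤ 1 → ‖X s t - T (t - s) (ξ s t)‖ ≤ K * (t - s) ^ μ)
    {t : ℝ} (ht : t ∈ Icc (0 : ℝ) 1) {ε : ℝ} (hε : 0 < ε) :
    ∃ ζ > 0, ∀ (n : ℕ) (p : ℕ → ℝ), p 0 = 0 → p n = t →
      (∀ i < n, p i < p (i + 1) ∧ p (i + 1) - p i < ζ) →
      ‖∑ i ∈ Finset.range n, T (t - p i) (ξ (p i) (p (i + 1))) - X 0 t‖ < ε := by
  have hM := h.M_nonneg
  have hd : 0 < M * K + 1 := by positivity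
  -- The mesh is chosen with `ζ ^ (μ - 1) = ε / (M K + 1)`: each cell then errs by at most `M K ζ ^
  -- (μ - 1)` times its length, and the lengths add up to `t ≤ 1`.
  refine ⟨(ε / (M * K + 1)) ^ (1 / (μ - 1)), by positivity, fun n p h0 hn hp => ?_⟩
  set ζ := (ε / (M * K + 1)) ^ (1 / (μ - 1)) with hζ
  have hζpos : 0 < ζ := by positivity
  have hζμ : ζ ^ (μ - 1) = ε / (M * K + 1) := by
    rw [hζ, ← Real.rpow_mul (by positivity), one_div_mul_cancel (by linarith), Real.rpow_one]
  have hmem := fun {i : ℕ} (hi : i ≤ n) => partition_mem_Icc h0 hn (fun i hi => (hp i hi).1) hi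
  have h00 : X 0 0 = 0 := by
    have := hX 0 0 0 le_rfl le_rfl le_rfl zero_le_one
    rw [sub_self, h.map_zero] at this
    simpa using this
  have hsum : ∀ k ≤ n, T (t - p k) (X 0 (p k))
      = ∑ i ∈ Finset.range k, T (t - p (i + 1)) (X (p i) (p (i + 1))) := fun k => by
    induction k with
    | zero => intro _; simp [h0, h00]
    | succ k ih =>
      intro hk
      have a1 := hmem (Nat.le_of_succ_le hk)
      have a2 := hmem hk
      have a3 := (hp k hk).1
      rw [Finset.sum_range_succ, ← ih (Nat.le_of_succ_le hk),
        hX 0 (p k) (p (k + 1)) le_rfl a1.1 a3.le (a2.2.trans ht.2), _root_.map_add,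
        ← h.map_add _ _ (sub_nonneg.2 a2.2) (sub_nonneg.2 a3.le)]
      congr 3; ring
  have hX0 : X 0 t = ∑ i ∈ Finset.range n, T (t - p (i + 1)) (X (p i) (p (i + 1))) := by
    rw [← hsum n le_rfl, hn, sub_self, h.map_zero]
  rw [hX0, ← Finset.sum_sub_distrib]
  have hterm : ∀ i ∈ Finset.range n, ‖T (t - p i) (ξ (p i) (p (i + 1)))
      - T (t - p (i + 1)) (X (p i) (p (i + 1)))‖
      ≤ M * K * (ε / (M * K + 1)) * (p (i + 1) - p i) := fun i hi => by
    have hi' := Finset.mem_range.1 hi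
    have a1 := hmem hi'.le
    have a2 := hmem (Nat.succ_le_of_lt hi')
    rw [Nat.succ_eq_add_one] at a2
    obtain ⟨a3, a4⟩ := hp i hi'
    have e : T (t - p i) (ξ (p i) (p (i + 1)))
        = T (t - p (i + 1)) (T (p (i + 1) - p i) (ξ (p i) (p (i + 1)))) := by
      rw [← h.map_add _ _ (sub_nonneg.2 a2.2) (sub_nonneg.2 a3.le)]; congr 2; ring
    have hd0 : 0 < p (i + 1) - p i := sub_pos.2 a3
    rw [e, ← map_sub]
    refine (h.norm_le _ ⟨sub_nonneg.2 a2.2, by linarith [a2.1, ht.2]⟩ _).trans ?_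
    rw [norm_sub_rev, mul_assoc, mul_assoc]
    refine mul_le_mul_of_nonneg_left ((hXξ _ _ a1.1 a3.le (a2.2.trans ht.2)).trans ?_) hM
    gcongr
    calc (p (i + 1) - p i) ^ μ = (p (i + 1) - p i) ^ (μ - 1) * (p (i + 1) - p i) := by
          nth_rw 3 [← Real.rpow_one (p (i + 1) - p i)]
          rw [← Real.rpow_add hd0]; congr 1; ring
      _ ≤ ζ ^ (μ - 1) * (p (i + 1) - p i) := by
          have : 0 ≤ μ - 1 := by linarith
          gcongr
      _ = _ := by rw [hζμ]
  refine (norm_sum_le_of_le _ hterm).trans_lt ?_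
  rw [← Finset.mul_sum, Finset.sum_range_sub, h0, hn, sub_zero]
  calc M * K * (ε / (M * K + 1)) * t ≤ M * K * (ε / (M * K + 1)) * 1 := by
        gcongr; exact ht.2
    _ < ε := by
        rw [mul_one, mul_div_assoc', div_lt_iff₀ hd]; nlinarith

end Partition

/-! ### The rough convolution -/

section Convolution

variable {B : ℝ → Type*} [∀ β, NormedAddCommGroup (B β)] [∀ β, NormedSpace ℝ (B β)]
variable {𝓑 : InterpolationFamily B} {γ α σ : ℝ}

/-- The semigroup smoothes the germ of the rough convolution. -/
theorem exists_smoothing_germ (S : ParabolicSemigroup 𝓑) (hγ : 0 < γ) (hγ' : γ ≤ 1 / 2)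
    (hσ : 0 ≤ σ) (hσ' : σ < γ) : ∃ C : ℝ, 0 ≤ C ∧ ∀ (W : RoughPath γ) (V : ℝ → B (α - σ))
      (V' : ℝ → B (α - γ - σ)) (N : ℝ), ControlledBound W 𝓑 (α - 2 * γ - σ) V V' N →
      ∀ s t, 0 ≤ s → s < t → t ≤ 1 → ∃ y : B α,
        𝓑.emb α (α - 2 * γ - σ) y
          = S.S (α - 2 * γ - σ) (t - s) (germ W 𝓑 (α - 2 * γ - σ) V V' s t) ∧
        ‖y‖ ≤ C * (W.rho * N) * (t - s) ^ (γ - σ) ∧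
        ‖𝓑.emb α (α - 2 * γ) y
          - (W.path t - W.path s) • 𝓑.emb (α - σ) (α - 2 * γ) (V s)‖
          ≤ C * (W.rho * N) * (t - s) ^ (2 * γ) := by
  obtain ⟨C₁, hC₁0, hC₁⟩ := S.exists_smoothing (a := α - σ) (b := α) (by linarith) (by linarith)
  obtain ⟨C₂, hC₂0, hC₂⟩ := S.exists_smoothing (a := α - γ - σ) (b := α) (by linarith)
    (by linarith)
  obtain ⟨C₃, hC₃0, hC₃⟩ := S.exists_sub_id_le (a := α - 2 * γ) (b := α - σ) (by linarith)
    (by linarith)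
  obtain ⟨M, hM1, hM⟩ := S.exists_norm_le (α - 2 * γ)
  obtain ⟨E, hE0, hE⟩ := 𝓑.exists_norm_emb_le (α - γ - σ) (α - 2 * γ)
  refine ⟨C₁ + C₂ + C₃ + M * E, by positivity, fun W V V' N h s t hs hst ht => ?_⟩
  have hN := h.nonneg
  have hρ := W.rho_nonneg
  have h0 : 0 < t - s := sub_pos.2 hst
  have h1 : t - s ≤ 1 := by linarith
  have hs1 : s ∈ Icc (0 : ℝ) 1 := ⟨hs, by linarith⟩
  have hVs := h.bound s hs1
  have hVs' := h.bound_deriv s hs1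
  have hW := W.abs_path_le hγ hs hst.le ht
  have hA := W.abs_area_le hγ hs hst.le ht
  have hle : ∀ {p q : ℝ}, q ≤ p → (t - s) ^ p ≤ (t - s) ^ q := fun hpq =>
    Real.rpow_le_rpow_of_exponent_ge h0 h1 hpq
  obtain ⟨y, hy, hyn⟩ := hC₁ (t - s) ⟨h0, h1⟩ (V s)
  obtain ⟨z, hz, hzn⟩ := hC₂ (t - s) ⟨h0, h1⟩ (V' s)
  -- Smoothing `V s` costs `σ` against the exponent `γ` of `W`, smoothing `V' s` costs `γ + σ`
  -- against `2γ` of `𝕎`; both leave `γ - σ`.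
  refine ⟨(W.path t - W.path s) • y + W.area s t • z, ?_, ?_, ?_⟩
  · rw [map_add, map_smul, map_smul, germ, map_add, map_smul, map_smul,
      ← 𝓑.emb_emb (a := α - 2 * γ - σ) (b := α - σ) (c := α) (by linarith) (by linarith) y,
      ← 𝓑.emb_emb (a := α - 2 * γ - σ) (b := α - γ - σ) (c := α) (by linarith) (by linarith) z,
      hy, hz, S.emb_S (by linarith) h0.le, S.emb_S (by linarith) h0.le]
  · have b1 : ‖(W.path t - W.path s) • y‖ ≤ C₁ * (W.rho * N) * (t - s) ^ (γ - σ) := by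
      rw [norm_smul, Real.norm_eq_abs]
      calc _ ≤ (W.rho * (t - s) ^ γ) * (C₁ * (t - s) ^ (-(α - (α - σ))) * N) := by
            gcongr
            exact hyn.trans (by gcongr)
        _ = C₁ * (W.rho * N) * ((t - s) ^ γ * (t - s) ^ (-(α - (α - σ)))) := by ring
        _ = _ := by rw [← Real.rpow_add h0]; congr 2; ring
    have b2 : ‖W.area s t • z‖ ≤ C₂ * (W.rho * N) * (t - s) ^ (γ - σ) := by
      rw [norm_smul, Real.norm_eq_abs]
      calc _ ≤ (W.rho * (t - s) ^ (2 * γ)) * (C₂ * (t - s) ^ (-(α - (α - γ - σ))) * N) := by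
            gcongr
            exact hzn.trans (by gcongr)
        _ = C₂ * (W.rho * N) * ((t - s) ^ (2 * γ) * (t - s) ^ (-(α - (α - γ - σ)))) := by ring
        _ = _ := by rw [← Real.rpow_add h0]; congr 2; ring
    have r : 0 ≤ (C₃ + M * E) * (W.rho * N) * (t - s) ^ (γ - σ) := by positivity
    refine (norm_add_le _ _).trans ?_
    linear_combination b1 + b2 + r
  · have e1 : 𝓑.emb α (α - 2 * γ) y
        = S.S (α - 2 * γ) (t - s) (𝓑.emb (α - σ) (α - 2 * γ) (V s)) := by
      rw [← 𝓑.emb_emb (a := α - 2 * γ) (b := α - σ) (c := α) (by linarith) (by linarith) y, hy,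
        S.emb_S (by linarith) h0.le]
    have e2 : 𝓑.emb α (α - 2 * γ) z
        = S.S (α - 2 * γ) (t - s) (𝓑.emb (α - γ - σ) (α - 2 * γ) (V' s)) := by
      rw [← 𝓑.emb_emb (a := α - 2 * γ) (b := α - γ - σ) (c := α) (by linarith) (by linarith) z, hz,
        S.emb_S (by linarith) h0.le]
    -- Removing the leading term leaves `S - Id` on `V s`, which gains `2γ - σ`, in total `3γ - σ ≥
    -- 2γ`. The area term already has order `2γ`.
    rw [map_add, map_smul, map_smul, e1, e2, add_sub_right_comm, ← smul_sub]
    have b1 : ‖(W.path t - W.path s) • (S.S (α - 2 * γ) (t - s) (𝓑.emb (α - σ) (α - 2 * γ) (V s))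
        - 𝓑.emb (α - σ) (α - 2 * γ) (V s))‖ ≤ C₃ * (W.rho * N) * (t - s) ^ (2 * γ) := by
      rw [norm_smul, Real.norm_eq_abs]
      calc _ ≤ (W.rho * (t - s) ^ γ) * (C₃ * (t - s) ^ (α - σ - (α - 2 * γ)) * N) := by
            gcongr
            exact (hC₃ _ ⟨h0.le, h1⟩ _).trans (by gcongr)
        _ = C₃ * (W.rho * N) * ((t - s) ^ γ * (t - s) ^ (α - σ - (α - 2 * γ))) := by ring
        _ = C₃ * (W.rho * N) * (t - s) ^ (γ + (α - σ - (α - 2 * γ))) := by rw [Real.rpow_add h0]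
        _ ≤ _ := mul_le_mul_of_nonneg_left (hle (by linarith)) (by positivity)
    have b2 : ‖W.area s t • S.S (α - 2 * γ) (t - s) (𝓑.emb (α - γ - σ) (α - 2 * γ) (V' s))‖
        ≤ M * E * (W.rho * N) * (t - s) ^ (2 * γ) := by
      rw [norm_smul, Real.norm_eq_abs]
      calc _ ≤ (W.rho * (t - s) ^ (2 * γ)) * (M * (E * N)) := by
            gcongr
            refine (hM _ ⟨h0.le, h1⟩ _).trans ?_
            gcongr
            exact (hE _).trans (by gcongr)
        _ = _ := by ring
    have r : 0 ≤ (C₁ + C₂) * (W.rho * N) * (t - s) ^ (2 * γ) := by positivity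
    refine (norm_add_le _ _).trans ?_
    linear_combination b1 + b2 + r

/-- Existence of the rough convolution of a controlled rough path with the semigroup, as an element
of `B α`, with its increments. -/
theorem exists_roughConvolution (S : ParabolicSemigroup 𝓑) (hγ : 1 / 3 < γ) (hγ' : γ ≤ 1 / 2)
    (hσ : 0 ≤ σ) (hσ' : σ < γ) : ∃ C κ : ℝ, 0 ≤ C ∧ 0 < κ ∧ ∀ (W : RoughPath γ)
      (V : ℝ → B (α - σ)) (V' : ℝ → B (α - γ - σ)) (N : ℝ),
      ControlledBound W 𝓑 (α - 2 * γ - σ) V V' N → ∃ x : ℝ → ℝ → B α,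
        (∀ s u t, 0 ≤ s → s ≤ u → u ≤ t → t ≤ 1 → x s t = S.S α (t - u) (x s u) + x u t) ∧
        (∀ s t, 0 ≤ s → s ≤ t → t ≤ 1 → ‖x s t‖ ≤ C * (W.rho * N) * (t - s) ^ κ) ∧
        (∀ s t, 0 ≤ s → s ≤ t → t ≤ 1 →
          ‖𝓑.emb α (α - 2 * γ) (x s t)
            - (W.path t - W.path s) • 𝓑.emb (α - σ) (α - 2 * γ) (V s)‖
          ≤ C * (W.rho * N) * (t - s) ^ (2 * γ)) ∧
        ∀ t ∈ Icc (0 : ℝ) 1, IsRoughConvolution S W (α - 2 * γ - σ) V V' t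
          (𝓑.emb α (α - 2 * γ - σ) (x 0 t)) := by
  have hγ0 : 0 < γ := by linarith
  -- The sewing exponent lies below `3γ`, above `1` so that Riemann sums converge, and above `2γ +
  -- σ` so that a positive power `κ` survives smoothing from `B c` to `B α`.
  obtain ⟨μ, hμ, hμη⟩ := exists_between
    (max_lt (by linarith : (1 : ℝ) < 3 * γ) (by linarith : 2 * γ + σ < 3 * γ))
  have hμ1 : 1 < μ := (le_max_left _ _).trans_lt hμ
  have hμ2 : 2 * γ + σ < μ := (le_max_right _ _).trans_lt hμ
  set c := α - 2 * γ - σ with hc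
  have hcα : c ≤ α := by linarith
  set κ := μ - (2 * γ + σ) with hκ
  have hκ0 : 0 < κ := by linarith
  have := 𝓑.complete c
  obtain ⟨M, A, hM1, hA0, hgerm⟩ := exists_isTwistedGerm S (a := α - σ) (b := α - γ - σ) (c := c)
    hγ0 hγ' (by linarith) (by linarith)
  obtain ⟨Cg, hCg0, hCg⟩ := exists_smoothing_germ (α := α) S hγ0 hγ' hσ hσ'
  obtain ⟨Cs, hCs0, hCs⟩ := S.exists_smoothing (a := c) (b := α) hcα (by linarith)
  obtain ⟨Mα, hMα1, hMα⟩ := S.exists_norm_le α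
  obtain ⟨E, hE0, hE⟩ := 𝓑.exists_norm_emb_le α c
  obtain ⟨Cl, hCl0, hCl⟩ := S.exists_lift_of_increments (a := c) (b := α) hκ0
  obtain ⟨Ci, hCi0, hCi⟩ := 𝓑.interpolation_rpow (a := c) (b := α - 2 * γ) (c := α) (by linarith)
    (by linarith) (by linarith)
  set q : ℝ := (1 / 2 : ℝ) ^ (3 * γ - μ) with hq
  have hq1 : 0 < 1 - q :=
    sub_pos.2 (Real.rpow_lt_one (by norm_num) (by norm_num) (by linarith))
  set K := M * A / (1 - q) with hK
  have hK0 : 0 ≤ K := by positivity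
  set L := Cl * (Cs * K + Mα * Cg) with hL
  have hL0 : 0 ≤ L := by positivity
  refine ⟨L + (Ci * (K + L + Cg) + Cg), κ, by positivity, hκ0, fun W V V' N h => ?_⟩
  have hN := h.nonneg
  have hρ := W.rho_nonneg
  have hρN : 0 ≤ W.rho * N := by positivity
  have hG := hgerm W V V' N h
  obtain ⟨X, hXadd, hXle⟩ := hG.exists_sewing hμ1.le hμη
  replace hXle : ∀ s t, 0 ≤ s → s ≤ t → t ≤ 1 →
      ‖X s t - S.S c (t - s) (germ W 𝓑 c V V' s t)‖ ≤ K * (W.rho * N) * (t - s) ^ μ :=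
    fun s t hs hst ht => (hXle s t hs hst ht).trans_eq (by rw [hK]; ring)
  have hle : ∀ {s t p r : ℝ}, 0 ≤ s → s < t → t ≤ 1 → r ≤ p → (t - s) ^ p ≤ (t - s) ^ r :=
    fun hs hst ht hpr =>
      Real.rpow_le_rpow_of_exponent_ge (sub_pos.2 hst) (by linarith) hpr
  -- Both inputs come from splitting `X` into the sewing error and the smoothed germ, which already
  -- lies in `B α` with exponent `γ - σ > κ`.
  have hlift := hCl X ((K + E * Cg) * (W.rho * N)) κ ((Cs * K + Mα * Cg) * (W.rho * N)) hκ0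
    (by positivity) hXadd
    (fun s t hs hst ht => by
      rcases hst.eq_or_lt with rfl | hlt
      · have := hXle s s hs le_rfl ht
        rw [hG.diag s ⟨hs, ht⟩, map_zero, sub_zero, sub_self,
          Real.zero_rpow (by linarith : μ ≠ 0)] at this
        rw [sub_self, Real.zero_rpow hκ0.ne']
        simpa using this
      obtain ⟨y, hy, hyn, -⟩ := hCg W V V' N h s t hs hlt ht
      have h0 : 0 < t - s := sub_pos.2 hlt
      rw [← sub_add_cancel (X s t) (S.S c (t - s) (germ W 𝓑 c V V' s t)), ← hy]
      refine (norm_add_le _ _).trans ?_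
      calc _ ≤ K * (W.rho * N) * (t - s) ^ κ + E * (Cg * (W.rho * N) * (t - s) ^ κ) := by
            refine add_le_add ?_ ((hE _).trans (mul_le_mul_of_nonneg_left (hyn.trans ?_) hE0))
            · rw [hy]
              exact (hXle s t hs hst ht).trans (mul_le_mul_of_nonneg_left
                (hle hs hlt ht (by linarith)) (by positivity))
            · exact mul_le_mul_of_nonneg_left (hle hs hlt ht (by linarith)) (by positivity)
        _ = _ := by ring)
    (fun u v hu huv hv => by
      obtain ⟨y, hy, hyn, -⟩ := hCg W V V' N h u v hu huv hv
      have h0 : 0 < v - u := sub_pos.2 huv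
      obtain ⟨z, hz, hzn⟩ := hCs (v - u) ⟨h0, by linarith⟩
        (X u v - S.S c (v - u) (germ W 𝓑 c V V' u v))
      refine ⟨z + S.S α (v - u) y, ?_, ?_⟩
      · rw [map_add, hz, S.emb_S hcα h0.le, hy, map_sub, sub_add_cancel]
      refine (norm_add_le _ _).trans ?_
      calc _ ≤ Cs * (v - u) ^ (-(α - c)) * (K * (W.rho * N) * (v - u) ^ μ)
            + Mα * (Cg * (W.rho * N) * (v - u) ^ κ) := by
            refine add_le_add ?_ ?_
            · refine hzn.trans ?_
              gcongr
              exact hXle u v hu huv.le hv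
            · refine (hMα _ ⟨h0.le, by linarith⟩ y).trans ?_
              gcongr
              exact hyn.trans (mul_le_mul_of_nonneg_left (hle hu huv hv (by linarith))
                (by positivity))
        _ = Cs * K * (W.rho * N) * ((v - u) ^ (-(α - c)) * (v - u) ^ μ)
            + Mα * Cg * (W.rho * N) * (v - u) ^ κ := by ring
        _ = _ := by
            rw [← Real.rpow_add h0, show -(α - c) + μ = κ by rw [hκ, hc]; ring]; ring)
  have hlift' : ∀ s t, ∃ x : B α, 0 ≤ s → s ≤ t → t ≤ 1 → 𝓑.emb α c x = X s t ∧
      ‖x‖ ≤ L * (W.rho * N) * (t - s) ^ κ := fun s t => by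
    by_cases hst : 0 ≤ s ∧ s ≤ t ∧ t ≤ 1
    · obtain ⟨x, hx, hxn⟩ := hlift s t hst.1 hst.2.1 hst.2.2
      exact ⟨x, fun _ _ _ => ⟨hx, hxn.trans_eq (by rw [hL]; ring)⟩⟩
    · exact ⟨0, fun h1 h2 h3 => absurd ⟨h1, h2, h3⟩ hst⟩
  choose x hx using hlift'
  refine ⟨x, fun s u t hs hsu hut ht => ?_, fun s t hs hst ht => ?_, fun s t hs hst ht => ?_,
    fun t ht => ?_⟩
  · refine 𝓑.emb_injective hcα ?_
    rw [(hx s t hs (hsu.trans hut) ht).1, map_add, S.emb_S hcα (sub_nonneg.2 hut),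
      (hx s u hs hsu (hut.trans ht)).1, (hx u t (hs.trans hsu) hut ht).1,
      hXadd s u t hs hsu hut ht]
  · refine (hx s t hs hst ht).2.trans ?_
    have := Real.rpow_nonneg (sub_nonneg.2 hst) κ
    gcongr
    exact le_add_of_nonneg_right (by positivity)
  · obtain ⟨hx1, hx2⟩ := hx s t hs hst ht
    rcases hst.eq_or_lt with rfl | hlt
    · rw [sub_self, Real.zero_rpow hκ0.ne', mul_zero, norm_le_zero_iff] at hx2
      simp [hx2, Real.zero_rpow (by linarith : 2 * γ ≠ 0)]
    obtain ⟨y, hy, hyn, hyr⟩ := hCg W V V' N h s t hs hlt ht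
    have h0 : 0 < t - s := sub_pos.2 hlt
    -- The sewing error `x s t - y` has order `μ` in `B c` and `κ` in `B α`; interpolation gives
    -- more than `2γ` in between, since `μ = κ + 2γ + σ`.
    have b1 : ‖𝓑.emb α (α - 2 * γ) (x s t - y)‖
        ≤ Ci * ((K + L + Cg) * (W.rho * N)) * (t - s) ^ (2 * γ) := by
      refine hCi (x s t - y) _ (t - s) μ κ (2 * γ) (by positivity) h0 (by linarith) ?_ ?_ ?_
      · rw [map_sub, hx1, hy]
        refine (hXle s t hs hst ht).trans ?_
        gcongr
        linarith
      · refine (norm_sub_le _ _).trans ?_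
        have b3 : Cg * (W.rho * N) * (t - s) ^ (γ - σ) ≤ Cg * (W.rho * N) * (t - s) ^ κ :=
          mul_le_mul_of_nonneg_left (hle hs hlt ht (by linarith)) (by positivity)
        have r : 0 ≤ K * (W.rho * N) * (t - s) ^ κ := by positivity
        linear_combination hx2 + hyn + b3 + r
      · have e1 : α - c = 2 * γ + σ := by rw [hc]; ring
        have e2 : α - 2 * γ - c = σ := by rw [hc]; ring
        have : 0 ≤ κ * (2 * γ + σ) := by positivity
        rw [e1, e2, sub_sub_cancel]
        have hμκ : μ = κ + (2 * γ + σ) := by rw [hκ]; ring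
        rw [hμκ]; linarith
    have e : 𝓑.emb α (α - 2 * γ) (x s t) - (W.path t - W.path s) • 𝓑.emb (α - σ) (α - 2 * γ) (V s)
        = 𝓑.emb α (α - 2 * γ) (x s t - y) + (𝓑.emb α (α - 2 * γ) y
          - (W.path t - W.path s) • 𝓑.emb (α - σ) (α - 2 * γ) (V s)) := by
      rw [map_sub]; abel
    rw [e]
    have r : 0 ≤ L * (W.rho * N) * (t - s) ^ (2 * γ) := by positivity
    refine (norm_add_le _ _).trans ?_
    linear_combination b1 + hyr + r
  · intro ε hε
    rw [(hx 0 t le_rfl ht.1 ht.2).1]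
    obtain ⟨ζ, hζ, hlim⟩ := hG.riemann_tendsto hμ1 (by positivity) hXadd hXle ht hε
    refine ⟨ζ, hζ, fun n p h1 h2 h3 => ?_⟩
    rw [riemannSum_eq]
    exact hlim n p h1 h2 h3

/-- Partitions of `[0, t]` of arbitrarily small mesh exist. -/
theorem exists_partition {t : ℝ} (ht : 0 ≤ t) {ζ : ℝ} (hζ : 0 < ζ) :
    ∃ (n : ℕ) (p : ℕ → ℝ), p 0 = 0 ∧ p n = t ∧ ∀ i < n, p i < p (i + 1) ∧ p (i + 1) - p i < ζ := by
  rcases ht.eq_or_lt with rfl | h0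
  · exact ⟨0, fun _ => 0, rfl, rfl, fun i hi => absurd hi (Nat.not_lt_zero i)⟩
  obtain ⟨n, hn⟩ := exists_nat_gt (t / ζ)
  have hn0 : (0 : ℝ) < n := (div_pos h0 hζ).trans hn
  refine ⟨n, fun i => t * i / n, by simp, by field_simp, fun i _ => ?_⟩
  have e : t * ((i + 1 : ℕ) : ℝ) / n - t * i / n = t / n := by push_cast; ring
  have h1 : 0 < t / n := by positivity
  refine ⟨by linarith, ?_⟩
  rw [e, div_lt_iff₀ hn0, mul_comm]
  exact (div_lt_iff₀ hζ).1 hn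

theorem IsRoughConvolution.unique {S : ParabolicSemigroup 𝓑} {W : RoughPath γ} {a b c : ℝ}
    {V : ℝ → B a} {V' : ℝ → B b} {t : ℝ} (ht : 0 ≤ t) {z w : B c}
    (hz : IsRoughConvolution S W c V V' t z) (hw : IsRoughConvolution S W c V V' t w) : z = w := by
  rw [← sub_eq_zero, ← norm_le_zero_iff]
  refine le_of_forall_pos_le_add fun ε hε => ?_
  obtain ⟨η₁, h₁, H₁⟩ := hz (ε / 2) (half_pos hε)
  obtain ⟨η₂, h₂, H₂⟩ := hw (ε / 2) (half_pos hε)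
  obtain ⟨n, p, p0, pn, hp⟩ := exists_partition ht (lt_min h₁ h₂)
  have k₁ := H₁ n p p0 pn fun i hi => ⟨(hp i hi).1, (hp i hi).2.trans_le (min_le_left _ _)⟩
  have k₂ := H₂ n p p0 pn fun i hi => ⟨(hp i hi).1, (hp i hi).2.trans_le (min_le_right _ _)⟩
  have e : z - w = (riemannSum S W c V V' t n p - w) - (riemannSum S W c V V' t n p - z) := by abel
  rw [e]
  have := norm_sub_le (riemannSum S W c V V' t n p - w) (riemannSum S W c V V' t n p - z)
  linarith

/-- Riemann sums are linear in `(V, V')`. With uniqueness, this identifies the integral of a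
difference of integrands with the difference of the integrals. -/
theorem IsRoughConvolution.sub {S : ParabolicSemigroup 𝓑} {W : RoughPath γ} {a b c : ℝ}
    {V V₂ : ℝ → B a} {V' V₂' : ℝ → B b} {t : ℝ} {z w : B c}
    (hz : IsRoughConvolution S W c V V' t z) (hw : IsRoughConvolution S W c V₂ V₂' t w) :
    IsRoughConvolution S W c (fun s => V s - V₂ s) (fun s => V' s - V₂' s) t (z - w) := by
  intro ε hε
  obtain ⟨η₁, h₁, H₁⟩ := hz (ε / 2) (half_pos hε)
  obtain ⟨η₂, h₂, H₂⟩ := hw (ε / 2) (half_pos hε)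
  refine ⟨min η₁ η₂, lt_min h₁ h₂, fun n p p0 pn hp => ?_⟩
  have k₁ := H₁ n p p0 pn fun i hi => ⟨(hp i hi).1, (hp i hi).2.trans_le (min_le_left _ _)⟩
  have k₂ := H₂ n p p0 pn fun i hi => ⟨(hp i hi).1, (hp i hi).2.trans_le (min_le_right _ _)⟩
  have e : riemannSum S W c (fun s => V s - V₂ s) (fun s => V' s - V₂' s) t n p - (z - w)
      = (riemannSum S W c V V' t n p - z) - (riemannSum S W c V₂ V₂' t n p - w) := by
    have : riemannSum S W c (fun s => V s - V₂ s) (fun s => V' s - V₂' s) t n p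
        = riemannSum S W c V V' t n p - riemannSum S W c V₂ V₂' t n p := by
      simp only [riemannSum, ← Finset.sum_sub_distrib]
      refine Finset.sum_congr rfl fun i _ => ?_
      simp only [map_sub, smul_sub]; abel
    rw [this]; abel
  rw [e]
  have := norm_sub_le (riemannSum S W c V V' t n p - z) (riemannSum S W c V₂ V₂' t n p - w)
  linarith

end Convolution

/-! ### The drift convolution and control of mild paths -/

section Mild

variable {B : ℝ → Type*} [∀ β, NormedAddCommGroup (B β)] [∀ β, NormedSpace ℝ (B β)]
variable {𝓑 : InterpolationFamily B} {γ α σ δ : ℝ}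

/-- Strong continuity handles a frozen argument; the uniform operator bound handles its variation.
-/
theorem ParabolicSemigroup.continuousOn_convolution (S : ParabolicSemigroup 𝓑) {β t : ℝ}
    (ht : t ≤ 1) {Φ : ℝ → B β} (hΦ : ContinuousOn Φ (Icc 0 1)) :
    ContinuousOn (fun r => S.S β (t - r) (Φ r)) (Icc 0 t) := by
  obtain ⟨M, hM1, hM⟩ := S.exists_norm_le β
  intro r₀ hr₀
  have h1 : ContinuousWithinAt (fun r => S.S β (t - r) (Φ r₀)) (Icc 0 t) r₀ :=
    ((S.continuousOn β (Φ r₀)).comp (f := fun r : ℝ => t - r) (by fun_prop)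
      (fun r hr => sub_nonneg.2 hr.2)) r₀ hr₀
  have h2 : ContinuousWithinAt Φ (Icc 0 t) r₀ :=
    (hΦ r₀ ⟨hr₀.1, hr₀.2.trans ht⟩).mono (Icc_subset_Icc_right ht)
  have h3 : Tendsto (fun r => S.S β (t - r) (Φ r - Φ r₀)) (𝓝[Icc 0 t] r₀) (𝓝 0) := by
    have h4 : Tendsto (fun r => M * ‖Φ r - Φ r₀‖) (𝓝[Icc 0 t] r₀) (𝓝 0) := by
      simpa using ((h2.tendsto.sub_const (Φ r₀)).norm).const_mul M
    refine squeeze_zero_norm' ?_ h4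
    filter_upwards [self_mem_nhdsWithin] with r hr
    exact hM _ ⟨sub_nonneg.2 hr.2, by linarith [hr.1]⟩ _
  have h5 := h3.add h1.tendsto
  rw [zero_add] at h5
  refine h5.congr fun r => ?_
  rw [map_sub, sub_add_cancel]

theorem ParabolicSemigroup.intervalIntegrable_convolution (S : ParabolicSemigroup 𝓑) {β s u t : ℝ}
    (hs : 0 ≤ s) (hsu : s ≤ u) (hut : u ≤ t) (ht : t ≤ 1) {Φ : ℝ → B β}
    (hΦ : ContinuousOn Φ (Icc 0 1)) :
    IntervalIntegrable (fun r => S.S β (t - r) (Φ r)) MeasureTheory.volume s u := by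
  refine ContinuousOn.intervalIntegrable ((S.continuousOn_convolution ht hΦ).mono ?_)
  rw [uIcc_of_le hsu]
  exact Icc_subset_Icc hs hut

/-- The convolution of a continuous path in `B (α - δ)` with the semigroup, as an element of `B α`,
with its increments. -/
theorem exists_driftConvolution (S : ParabolicSemigroup 𝓑) (hγ : 0 < γ) (hγ' : γ ≤ 1 / 2)
    (hδ : 0 ≤ δ) (hδ' : δ < 1) : ∃ C κ : ℝ, 0 ≤ C ∧ 0 < κ ∧ ∀ (Φ : ℝ → B (α - δ)) (N : ℝ),
      ContinuousOn Φ (Icc 0 1) → (∀ t ∈ Icc (0 : ℝ) 1, ‖Φ t‖ ≤ N) → ∃ x : ℝ → ℝ → B α,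
        (∀ s u t, 0 ≤ s → s ≤ u → u ≤ t → t ≤ 1 → x s t = S.S α (t - u) (x s u) + x u t) ∧
        (∀ s t, 0 ≤ s → s ≤ t → t ≤ 1 → ‖x s t‖ ≤ C * N * (t - s) ^ κ) ∧
        (∀ s t, 0 ≤ s → s ≤ t → t ≤ 1 →
          ‖𝓑.emb α (α - 2 * γ) (x s t)‖ ≤ C * N * (t - s) ^ (2 * γ)) ∧
        ∀ t ∈ Icc (0 : ℝ) 1,
          𝓑.emb α (α - δ) (x 0 t) = ∫ r in (0 : ℝ)..t, S.S (α - δ) (t - r) (Φ r) := by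
  have hκ0 : 0 < 1 - δ := by linarith
  have hcα : α - δ ≤ α := by linarith
  have := 𝓑.complete (α - δ)
  obtain ⟨M, hM1, hM⟩ := S.exists_norm_le (α - δ)
  obtain ⟨Cs, hCs0, hCs⟩ := S.exists_smoothing (a := α - δ) (b := α) hcα (by linarith)
  obtain ⟨Cl, hCl0, hCl⟩ := S.exists_lift_of_increments (a := α - δ) (b := α) hκ0
  -- For `δ ≤ 2γ` the target contains `B (α - δ)` and the linear bound suffices, as `2γ ≤ 1`;
  -- otherwise the target lies between `B (α - δ)` and `B α`.
  have hinterp : ∃ Ci : ℝ, 0 ≤ Ci ∧ ∀ (x : B α) (N τ : ℝ), 0 ≤ N → 0 < τ → τ ≤ 1 →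
      ‖𝓑.emb α (α - δ) x‖ ≤ N * τ ^ (1 : ℝ) → ‖x‖ ≤ N * τ ^ (1 - δ) →
      ‖𝓑.emb α (α - 2 * γ) x‖ ≤ Ci * N * τ ^ (2 * γ) := by
    rcases le_or_gt δ (2 * γ) with h | h
    · obtain ⟨E, hE0, hE⟩ := 𝓑.exists_norm_emb_le (α - δ) (α - 2 * γ)
      refine ⟨E, hE0, fun x N τ hN hτ hτ1 hx _ => ?_⟩
      rw [← 𝓑.emb_emb (a := α - 2 * γ) (b := α - δ) (c := α) (by linarith) hcα, mul_assoc]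
      refine (hE _).trans (mul_le_mul_of_nonneg_left (hx.trans ?_) hE0)
      exact mul_le_mul_of_nonneg_left
        (Real.rpow_le_rpow_of_exponent_ge hτ hτ1 (by linarith)) hN
    · obtain ⟨Ci, hCi0, hCi⟩ := 𝓑.interpolation_rpow (a := α - δ) (b := α - 2 * γ) (c := α)
        (by linarith) (by linarith) (by linarith)
      refine ⟨Ci, hCi0, fun x N τ hN hτ hτ1 hx hx' =>
        hCi x N τ 1 (1 - δ) (2 * γ) hN hτ hτ1 hx hx' ?_⟩
      nlinarith
  obtain ⟨Ci, hCi0, hCi⟩ := hinterp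
  set L := Cl * (Cs * M) with hL
  have hL0 : 0 ≤ L := by positivity
  refine ⟨L + Ci * (L + M), 1 - δ, by positivity, hκ0, fun Φ N hΦ hΦN => ?_⟩
  have hN : 0 ≤ N := (norm_nonneg _).trans (hΦN 0 (by simp))
  set X : ℝ → ℝ → B (α - δ) := fun s t => ∫ r in s..t, S.S (α - δ) (t - r) (Φ r) with hX
  have hXadd : ∀ s u t, 0 ≤ s → s ≤ u → u ≤ t → t ≤ 1 →
      X s t = S.S (α - δ) (t - u) (X s u) + X u t := fun s u t hs hsu hut ht => by
    simp only [hX]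
    rw [← ContinuousLinearMap.intervalIntegral_comp_comm _
      (S.intervalIntegrable_convolution hs hsu le_rfl (hut.trans ht) hΦ),
      ← intervalIntegral.integral_add_adjacent_intervals
        (S.intervalIntegrable_convolution hs hsu hut ht hΦ)
        (S.intervalIntegrable_convolution (hs.trans hsu) hut le_rfl ht hΦ)]
    congr 1
    refine intervalIntegral.integral_congr fun r hr => ?_
    rw [uIcc_of_le hsu] at hr
    change S.S (α - δ) (t - r) (Φ r) = S.S (α - δ) (t - u) (S.S (α - δ) (u - r) (Φ r))
    rw [← S.map_add _ _ _ (sub_nonneg.2 hut) (sub_nonneg.2 hr.2), sub_add_sub_cancel]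
  have hXle : ∀ s t, 0 ≤ s → s ≤ t → t ≤ 1 → ‖X s t‖ ≤ M * N * (t - s) ^ (1 : ℝ) :=
    fun s t hs hst ht => by
      rw [Real.rpow_one, ← abs_of_nonneg (sub_nonneg.2 hst)]
      refine intervalIntegral.norm_integral_le_of_norm_le_const fun r hr => ?_
      rw [uIoc_of_le hst] at hr
      refine (hM _ ⟨sub_nonneg.2 hr.2, by linarith [hr.1]⟩ _).trans ?_
      gcongr
      exact hΦN r ⟨by linarith [hr.1], hr.2.trans ht⟩
  have hlift := hCl X (M * N) 1 (Cs * M * N) one_pos (by positivity) hXadd hXle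
    (fun u v hu huv hv => by
      have h0 : 0 < v - u := sub_pos.2 huv
      obtain ⟨z, hz, hzn⟩ := hCs (v - u) ⟨h0, by linarith⟩ (X u v)
      refine ⟨z, hz, hzn.trans ?_⟩
      calc _ ≤ Cs * (v - u) ^ (-(α - (α - δ))) * (M * N * (v - u) ^ (1 : ℝ)) := by
            gcongr
            exact hXle u v hu huv.le hv
        _ = Cs * M * N * ((v - u) ^ (-(α - (α - δ))) * (v - u) ^ (1 : ℝ)) := by ring
        _ = _ := by rw [← Real.rpow_add h0]; congr 2; ring)
  have hlift' : ∀ s t, ∃ x : B α, 0 ≤ s → s ≤ t → t ≤ 1 → 𝓑.emb α (α - δ) x = X s t ∧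
      ‖x‖ ≤ L * N * (t - s) ^ (1 - δ) := fun s t => by
    by_cases hst : 0 ≤ s ∧ s ≤ t ∧ t ≤ 1
    · obtain ⟨x, hx, hxn⟩ := hlift s t hst.1 hst.2.1 hst.2.2
      exact ⟨x, fun _ _ _ => ⟨hx, hxn.trans_eq (by rw [hL]; ring)⟩⟩
    · exact ⟨0, fun h1 h2 h3 => absurd ⟨h1, h2, h3⟩ hst⟩
  choose x hx using hlift'
  refine ⟨x, fun s u t hs hsu hut ht => ?_, fun s t hs hst ht => ?_, fun s t hs hst ht => ?_,
    fun t ht => (hx 0 t le_rfl ht.1 ht.2).1⟩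
  · refine 𝓑.emb_injective hcα ?_
    rw [(hx s t hs (hsu.trans hut) ht).1, map_add, S.emb_S hcα (sub_nonneg.2 hut),
      (hx s u hs hsu (hut.trans ht)).1, (hx u t (hs.trans hsu) hut ht).1,
      hXadd s u t hs hsu hut ht]
  · refine (hx s t hs hst ht).2.trans ?_
    have := Real.rpow_nonneg (sub_nonneg.2 hst) (1 - δ)
    gcongr
    exact le_add_of_nonneg_right (by positivity)
  · obtain ⟨hx1, hx2⟩ := hx s t hs hst ht
    rcases hst.eq_or_lt with rfl | hlt
    · rw [sub_self, Real.zero_rpow hκ0.ne', mul_zero, norm_le_zero_iff] at hx2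
      simp [hx2, Real.zero_rpow (by linarith : 2 * γ ≠ 0)]
    have h0 : 0 < t - s := sub_pos.2 hlt
    refine (hCi (x s t) ((L + M) * N) (t - s) (by positivity) h0 (by linarith) ?_ ?_).trans ?_
    · rw [hx1]
      refine (hXle s t hs hst ht).trans ?_
      gcongr
      linarith
    · refine hx2.trans ?_
      gcongr
      linarith
    · have r : 0 ≤ L * N * (t - s) ^ (2 * γ) := by positivity
      linear_combination r

/-- A path with small twisted increments is continuous. -/
theorem ParabolicSemigroup.continuousOn_of_increments (S : ParabolicSemigroup 𝓑) {β κ C : ℝ}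
    (hκ : 0 < κ) {x : ℝ → ℝ → B β}
    (hadd : ∀ s u t, 0 ≤ s → s ≤ u → u ≤ t → t ≤ 1 → x s t = S.S β (t - u) (x s u) + x u t)
    (hle : ∀ s t, 0 ≤ s → s ≤ t → t ≤ 1 → ‖x s t‖ ≤ C * (t - s) ^ κ) :
    ContinuousOn (fun t => x 0 t) (Icc 0 1) := by
  have hC : 0 ≤ C := by
    have := (norm_nonneg _).trans (hle 0 1 le_rfl zero_le_one le_rfl)
    simpa using this
  rw [Metric.continuousOn_iff]
  intro t ht ε hε
  have hlim : Tendsto (fun h : ℝ => C * (2 * h) ^ κ) (𝓝[>] 0) (𝓝 0) := by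
    have h1 : Tendsto (fun h : ℝ => 2 * h) (𝓝[>] 0) (𝓝 0) := by
      have : Tendsto (fun h : ℝ => 2 * h) (𝓝 0) (𝓝 (2 * 0)) := by
        exact (continuous_const.mul continuous_id).tendsto 0
      rw [mul_zero] at this
      exact this.mono_left nhdsWithin_le_nhds
    have := (h1.rpow_const (p := κ) (Or.inr hκ.le)).const_mul C
    simpa [Real.zero_rpow hκ.ne'] using this
  obtain ⟨h, hhε, hh0⟩ : ∃ h : ℝ, C * (2 * h) ^ κ < ε / 3 ∧ 0 < h := by
    have := (hlim.eventually (gt_mem_nhds (by positivity : 0 < ε / 3))).and self_mem_nhdsWithin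
    exact this.exists
  -- Both paths are restarted at a time `s₀` shortly before `t`. The increments from `s₀` are small,
  -- and the rest is one orbit of the semigroup, which is continuous; this covers `r` on both sides
  -- of `t`.
  set s₀ := max 0 (t - h) with hs₀
  have hs0 : 0 ≤ s₀ := le_max_left _ _
  have hs0t : s₀ ≤ t := max_le ht.1 (by linarith)
  have hs0h : t - h ≤ s₀ := le_max_right _ _
  obtain ⟨d, hd, hcont⟩ := Metric.continuousOn_iff.1 (S.continuousOn β (x 0 s₀)) (t - s₀)
    (sub_nonneg.2 hs0t) (ε / 3) (by positivity)
  refine ⟨min d h, lt_min hd hh0, fun r hr hrt => ?_⟩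
  rw [Real.dist_eq] at hrt
  have hrd : |r - t| < d := hrt.trans_le (min_le_left _ _)
  have hrh := abs_lt.1 (hrt.trans_le (min_le_right _ _))
  have hs0r : s₀ ≤ r := max_le hr.1 (by linarith [hrh.1])
  have k1 := hcont (r - s₀) (sub_nonneg.2 hs0r) (by rwa [Real.dist_eq, sub_sub_sub_cancel_right])
  have k2 : ∀ v, s₀ ≤ v → v ≤ 1 → v ≤ t + h → ‖x s₀ v‖ < ε / 3 := fun v h1 h2 h3 => by
    refine ((hle s₀ v hs0 h1 h2).trans ?_).trans_lt hhε
    have : 0 ≤ v - s₀ := sub_nonneg.2 h1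
    gcongr
    linarith
  have k3 := k2 r hs0r hr.2 (by linarith [hrh.2])
  have k4 := k2 t hs0t ht.2 (by linarith)
  rw [dist_eq_norm] at k1 ⊢
  have e : x 0 r - x 0 t = (S.S β (r - s₀) (x 0 s₀) - S.S β (t - s₀) (x 0 s₀))
      + (x s₀ r - x s₀ t) := by
    rw [hadd 0 s₀ r le_rfl hs0 hs0r hr.2, hadd 0 s₀ t le_rfl hs0 hs0t ht.2]; abel
  rw [e]
  have k5 := norm_add_le (S.S β (r - s₀) (x 0 s₀) - S.S β (t - s₀) (x 0 s₀)) (x s₀ r - x s₀ t)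
  have k6 := norm_sub_le (x s₀ r) (x s₀ t)
  linarith

/-- A mild path with derivative `V` is controlled. -/
theorem exists_controlledBound_of_increments (S : ParabolicSemigroup 𝓑) (hγ : 0 < γ)
    (hγ' : γ ≤ 1 / 2) (hσ : 0 ≤ σ) (hσ' : σ < γ) : ∃ C : ℝ, 0 ≤ C ∧ ∀ (W : RoughPath γ)
      (V : ℝ → B (α - σ)) (V' : ℝ → B (α - γ - σ)) (N K κ : ℝ) (x : ℝ → ℝ → B α), 0 < κ → 0 ≤ K →
      ControlledBound W 𝓑 (α - 2 * γ - σ) V V' N →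
      (∀ s u t, 0 ≤ s → s ≤ u → u ≤ t → t ≤ 1 → x s t = S.S α (t - u) (x s u) + x u t) →
      (∀ t ∈ Icc (0 : ℝ) 1, ‖x 0 t‖ ≤ K) →
      (∀ s t, 0 ≤ s → s ≤ t → t ≤ 1 → ‖𝓑.emb α (α - 2 * γ) (x s t)
        - (W.path t - W.path s) • 𝓑.emb (α - σ) (α - 2 * γ) (V s)‖ ≤ K * (t - s) ^ (2 * γ)) →
      ControlledBound W 𝓑 (α - 2 * γ) (fun t => x 0 t) (fun t => 𝓑.emb (α - σ) (α - γ) (V t))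
        (C * (K + (1 + W.rho) * N)) := by
  obtain ⟨E, hE0, hE⟩ := 𝓑.exists_norm_emb_le (α - σ) (α - γ)
  obtain ⟨Ca, hCa0, hCa⟩ := S.exists_sub_id_le (a := α - 2 * γ) (b := α) (by linarith) (by linarith)
  -- The new Gubinelli derivative `V` must be `γ`-Hölder in `B (α - 2γ)`, which is `σ` better than
  -- the space controlling `V`; mollification gains this, and `σ < γ` keeps the target below the
  -- space of `V'`.
  obtain ⟨Ch, hCh0, hCh⟩ := exists_norm_emb_sub_le S (a := α - σ) (b := α - γ - σ)
    (c := α - 2 * γ - σ) (d := α - 2 * γ) hγ hγ' (by linarith) (by linarith) (by linarith)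
    (by linarith) (by linarith) (by linarith)
  refine ⟨1 + E + Ca + Ch, by positivity, fun W V V' N K κ x hκ hK h hadd hxK hrem => ?_⟩
  have hN := h.nonneg
  have hρ := W.rho_nonneg
  have r1 : 0 ≤ E * (K + (1 + W.rho) * N) := by positivity
  have r2 : 0 ≤ Ca * (1 + W.rho) * N := by positivity
  have r3 : 0 ≤ Ch * K := by positivity
  have r4 : 0 ≤ (1 + W.rho) * N := by positivity
  have r5 : 0 ≤ Ca * K := by positivity
  have r6 : 0 ≤ Ch * (1 + W.rho) * N := by positivity
  have r7 : 0 ≤ E * K := by positivity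
  have r8 : 0 ≤ E * W.rho * N := by positivity
  refine ⟨fun t ht => ?_, fun t ht => ?_, fun s t hs hst ht => ?_, fun s t hs hst ht => ?_⟩
  · linear_combination hxK t ht + r1 + r2 + r3 + r4 + r5 + r6
  · have := (hE (V t)).trans (mul_le_mul_of_nonneg_left (h.bound t ht) hE0)
    linear_combination this + r2 + r3 + r4 + r5 + r6 + r7 + r8 + hK
  · rw [← map_sub, 𝓑.emb_emb (by linarith) (by linarith)]
    refine (hCh W V V' N h s t hs hst ht).trans ?_
    have := Real.rpow_nonneg (sub_nonneg.2 hst) γ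
    refine mul_le_mul_of_nonneg_right ?_ this
    linear_combination r1 + r2 + r3 + r4 + r5 + hK
  · rw [𝓑.emb_emb (by linarith) (by linarith)]
    have ht' : t - s ∈ Icc (0 : ℝ) 1 := ⟨sub_nonneg.2 hst, by linarith⟩
    -- The increment is `(S (t - s) - Id) (x 0 s) + x s t`, and the first term gains `2γ` in `B (α -
    -- 2γ)`.
    have e : 𝓑.emb α (α - 2 * γ) (x 0 t - x 0 s)
        - (W.path t - W.path s) • 𝓑.emb (α - σ) (α - 2 * γ) (V s)
        = (S.S (α - 2 * γ) (t - s) (𝓑.emb α (α - 2 * γ) (x 0 s)) - 𝓑.emb α (α - 2 * γ) (x 0 s))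
        + (𝓑.emb α (α - 2 * γ) (x s t)
          - (W.path t - W.path s) • 𝓑.emb (α - σ) (α - 2 * γ) (V s)) := by
      rw [hadd 0 s t le_rfl hs hst ht, ← S.emb_S (by linarith) ht'.1, map_sub, map_add]; abel
    rw [e]
    have hp := Real.rpow_nonneg (sub_nonneg.2 hst) (2 * γ)
    have b1 : ‖S.S (α - 2 * γ) (t - s) (𝓑.emb α (α - 2 * γ) (x 0 s))
        - 𝓑.emb α (α - 2 * γ) (x 0 s)‖ ≤ Ca * K * (t - s) ^ (2 * γ) := by
      refine (hCa _ ht' _).trans ?_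
      rw [sub_sub_cancel]
      have := mul_le_mul_of_nonneg_left (hxK s ⟨hs, hst.trans ht⟩)
        (mul_nonneg hCa0 hp)
      linear_combination this
    refine (norm_add_le _ _).trans ((add_le_add b1 (hrem s t hs hst ht)).trans ?_)
    rw [← add_mul]
    refine mul_le_mul_of_nonneg_right ?_ hp
    linear_combination r1 + r2 + r3 + r4 + r6

end Mild

/-! ### The norm of controlled rough paths -/

section Norms

variable {B : ℝ → Type*} [∀ β, NormedAddCommGroup (B β)] [∀ β, NormedSpace ℝ (B β)]
variable {𝓑 : InterpolationFamily B} {γ α : ℝ} {W : RoughPath γ}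
  {U U₂ : ℝ → B α} {U' U₂' : ℝ → B (α - γ)}

theorem emb_remainder (hγ : 0 < γ) (s t : ℝ) :
    𝓑.emb (α - γ) (α - 2 * γ) (remainder 𝓑 α W U U' s t) = 𝓑.emb α (α - 2 * γ) (U t - U s)
      - (W.path t - W.path s) • 𝓑.emb (α - γ) (α - 2 * γ) (U' s) := by
  rw [remainder, map_sub, map_smul, 𝓑.emb_emb (by linarith) (by linarith)]

theorem IsControlled.controlledBound (hγ : 0 < γ) (h : IsControlled 𝓑 α W U U') :
    ControlledBound W 𝓑 (α - 2 * γ) U U' (crpNorm 𝓑 α W U U') := by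
  have h1 := supNorm_nonneg U
  have h2 := supNorm_nonneg U'
  have h3 := holderNorm_nonneg γ (fun s t => 𝓑.emb (α - γ) (α - 2 * γ) (U' t - U' s))
  have h4 := holderNorm_nonneg (2 * γ)
    (fun s t => 𝓑.emb (α - γ) (α - 2 * γ) (remainder 𝓑 α W U U' s t))
  refine ⟨fun t ht => ?_, fun t ht => ?_, fun s t hs hst ht => ?_, fun s t hs hst ht => ?_⟩
  · refine (norm_le_supNorm h.cont ht).trans ?_
    unfold crpNorm; linarith
  · refine (norm_le_supNorm h.cont_deriv ht).trans ?_
    unfold crpNorm; linarith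
  · refine (h.holder_deriv.norm_le hγ hs hst ht).trans ?_
    refine mul_le_mul_of_nonneg_right ?_ (Real.rpow_nonneg (sub_nonneg.2 hst) _)
    unfold crpNorm; linarith
  · rw [← emb_remainder hγ]
    refine (h.holder_remainder_two.norm_le (by linarith) hs hst ht).trans ?_
    refine mul_le_mul_of_nonneg_right ?_ (Real.rpow_nonneg (sub_nonneg.2 hst) _)
    unfold crpNorm; linarith

theorem ControlledBound.crpNorm_le (hγ : 0 < γ) {N : ℝ}
    (h : ControlledBound W 𝓑 (α - 2 * γ) U U' N) : crpNorm 𝓑 α W U U' ≤ 4 * N := by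
  have h1 := supNorm_le h.bound
  have h2 := supNorm_le h.bound_deriv
  have h3 := holderNorm_le h.nonneg h.holder_deriv
  have h4 := holderNorm_le (Q := fun s t => 𝓑.emb (α - γ) (α - 2 * γ) (remainder 𝓑 α W U U' s t))
    h.nonneg (fun s t hs hst ht => by
      rw [emb_remainder hγ]; exact h.holder_remainder s t hs hst ht)
  unfold crpNorm; linarith

/-- The `γ`-Hölder bound of the remainder in `B (α - γ)` is not part of `ControlledBound`; it
follows from mollifying the increments. -/
theorem ControlledBound.isControlled (S : ParabolicSemigroup 𝓑) (hγ : 0 < γ) (hγ' : γ ≤ 1 / 2)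
    {N : ℝ} (h : ControlledBound W 𝓑 (α - 2 * γ) U U' N) (hU : ContinuousOn U (Icc 0 1))
    (hU' : ContinuousOn U' (Icc 0 1)) : IsControlled 𝓑 α W U U' := by
  obtain ⟨C, hC0, hC⟩ := exists_norm_emb_sub_le S (a := α) (b := α - γ) (c := α - 2 * γ)
    (d := α - γ) hγ hγ' (by linarith) le_rfl (by linarith) (by linarith) (by linarith) (by linarith)
  refine ⟨hU, hU', ⟨N, fun p hp => h.holder_deriv _ _ hp.1 hp.2.1 hp.2.2⟩,
    ⟨C * (1 + W.rho) * N + W.rho * N, fun p hp => ?_⟩, ⟨N, fun p hp => ?_⟩⟩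
  · have hN := h.nonneg
    have hρ := W.rho_nonneg
    have hp0 := Real.rpow_nonneg (sub_nonneg.2 hp.2.1) γ
    rw [remainder, add_mul]
    refine (norm_sub_le _ _).trans (add_le_add (hC W U U' N h _ _ hp.1 hp.2.1 hp.2.2) ?_)
    rw [norm_smul, Real.norm_eq_abs]
    calc _ ≤ (W.rho * (p.2 - p.1) ^ γ) * N := by
          gcongr
          · exact W.abs_path_le hγ hp.1 hp.2.1 hp.2.2
          · exact h.bound_deriv _ ⟨hp.1, hp.2.1.trans hp.2.2⟩
      _ = _ := by ring
  · refine (congrArg norm (emb_remainder hγ _ _)).trans_le ?_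
    exact h.holder_remainder _ _ hp.1 hp.2.1 hp.2.2

theorem supNorm_add_le {E : Type*} [NormedAddCommGroup E] {u v : ℝ → E}
    (hu : ContinuousOn u (Icc 0 1)) (hv : ContinuousOn v (Icc 0 1)) :
    supNorm (fun t => u t + v t) ≤ supNorm u + supNorm v :=
  supNorm_le fun _ ht => (norm_add_le _ _).trans
    (add_le_add (norm_le_supNorm hu ht) (norm_le_supNorm hv ht))

theorem holderNorm_add_le {E : Type*} [NormedAddCommGroup E] {θ : ℝ} (hθ : 0 < θ)
    {P Q : ℝ → ℝ → E} (hP : IsHolder θ P) (hQ : IsHolder θ Q) :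
    holderNorm θ (fun s t => P s t + Q s t) ≤ holderNorm θ P + holderNorm θ Q :=
  holderNorm_le (add_nonneg (holderNorm_nonneg _ _) (holderNorm_nonneg _ _))
    fun s t hs hst ht => by
      rw [add_mul]
      exact (norm_add_le _ _).trans
        (add_le_add (hP.norm_le hθ hs hst ht) (hQ.norm_le hθ hs hst ht))

/-- Passing through `ControlledBound` would lose a factor `4`; the constant `1` is what makes the
norm itself a Lipschitz function of the path, as the cut-off requires. -/
theorem IsControlled.crpNorm_add_le (hγ : 0 < γ) (h : IsControlled 𝓑 α W U U')
    (h₂ : IsControlled 𝓑 α W U₂ U₂') :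
    crpNorm 𝓑 α W (fun t => U t + U₂ t) (fun t => U' t + U₂' t)
      ≤ crpNorm 𝓑 α W U U' + crpNorm 𝓑 α W U₂ U₂' := by
  have h1 := supNorm_add_le h.cont h₂.cont
  have h2 := supNorm_add_le h.cont_deriv h₂.cont_deriv
  have h3 := holderNorm_add_le hγ h.holder_deriv h₂.holder_deriv
  have h4 := holderNorm_add_le (by linarith) h.holder_remainder_two h₂.holder_remainder_two
  have e3 : (fun s t => 𝓑.emb (α - γ) (α - 2 * γ) (U' t + U₂' t - (U' s + U₂' s)))
      = fun s t => 𝓑.emb (α - γ) (α - 2 * γ) (U' t - U' s)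
        + 𝓑.emb (α - γ) (α - 2 * γ) (U₂' t - U₂' s) := by
    ext s t; rw [← map_add]; congr 1; abel
  have e4 : (fun s t => 𝓑.emb (α - γ) (α - 2 * γ)
        (remainder 𝓑 α W (fun t => U t + U₂ t) (fun t => U' t + U₂' t) s t))
      = fun s t => 𝓑.emb (α - γ) (α - 2 * γ) (remainder 𝓑 α W U U' s t)
        + 𝓑.emb (α - γ) (α - 2 * γ) (remainder 𝓑 α W U₂ U₂' s t) := by
    ext s t
    rw [← map_add]
    congr 1
    simp only [remainder, map_sub, map_add, smul_add]
    abel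
  unfold crpNorm
  rw [e3, e4]
  linarith

theorem IsControlled.sub (S : ParabolicSemigroup 𝓑) (hγ : 0 < γ) (hγ' : γ ≤ 1 / 2)
    (h : IsControlled 𝓑 α W U U') (h₂ : IsControlled 𝓑 α W U₂ U₂') :
    IsControlled 𝓑 α W (fun t => U t - U₂ t) (fun t => U' t - U₂' t) := by
  refine ControlledBound.isControlled S hγ hγ' ?_ (h.cont.sub h₂.cont)
    (h.cont_deriv.sub h₂.cont_deriv)
    (N := crpNorm 𝓑 α W U U' + |-1| * crpNorm 𝓑 α W U₂ U₂')
  have := (h.controlledBound hγ).add ((h₂.controlledBound hγ).smul (-1))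
  simpa [sub_eq_add_neg] using this

theorem IsControlled.crpNorm_le_add_sub (S : ParabolicSemigroup 𝓑) (hγ : 0 < γ)
    (hγ' : γ ≤ 1 / 2) (h : IsControlled 𝓑 α W U U') (h₂ : IsControlled 𝓑 α W U₂ U₂') :
    crpNorm 𝓑 α W U U' ≤ crpNorm 𝓑 α W U₂ U₂'
      + crpNorm 𝓑 α W (fun t => U t - U₂ t) (fun t => U' t - U₂' t) := by
  have := h₂.crpNorm_add_le hγ (h.sub S hγ hγ' h₂)
  simpa using this

theorem holderNorm_neg {E : Type*} [NormedAddCommGroup E] (θ : ℝ) (Q : ℝ → ℝ → E) :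
    holderNorm θ (fun s t => -Q s t) = holderNorm θ Q := by
  simp [holderNorm]

theorem crpNorm_sub_comm :
    crpNorm 𝓑 α W (fun t => U t - U₂ t) (fun t => U' t - U₂' t)
      = crpNorm 𝓑 α W (fun t => U₂ t - U t) (fun t => U₂' t - U' t) := by
  have e1 : supNorm (fun t => U t - U₂ t) = supNorm (fun t => U₂ t - U t) := by
    simp only [supNorm, norm_sub_rev]
  have e2 : supNorm (fun t => U' t - U₂' t) = supNorm (fun t => U₂' t - U' t) := by
    simp only [supNorm, norm_sub_rev]
  have e3 : holderNorm γ (fun s t => 𝓑.emb (α - γ) (α - 2 * γ) (U' t - U₂' t - (U' s - U₂' s)))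
      = holderNorm γ (fun s t => 𝓑.emb (α - γ) (α - 2 * γ) (U₂' t - U' t - (U₂' s - U' s))) := by
    rw [← holderNorm_neg]
    congr 1
    ext s t
    rw [← map_neg]; congr 1; abel
  have e4 : holderNorm (2 * γ) (fun s t => 𝓑.emb (α - γ) (α - 2 * γ)
        (remainder 𝓑 α W (fun t => U t - U₂ t) (fun t => U' t - U₂' t) s t))
      = holderNorm (2 * γ) (fun s t => 𝓑.emb (α - γ) (α - 2 * γ)
        (remainder 𝓑 α W (fun t => U₂ t - U t) (fun t => U₂' t - U' t) s t)) := by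
    rw [← holderNorm_neg]
    congr 1
    ext s t
    rw [← map_neg]; congr 1
    simp only [remainder, map_sub, smul_sub]; abel
  unfold crpNorm
  rw [e1, e2, e3, e4]

end Norms

/-! ### Second order differences and Taylor remainders -/

section Calculus

variable {E F : Type*} [NormedAddCommGroup E] [NormedSpace ℝ E] [NormedAddCommGroup F]
  [NormedSpace ℝ F]

/-- A twice differentiable map with bounded, Lipschitz first and second derivatives, whose
derivative vanishes at the origin. -/
structure SmoothBound (Φ : E → F) (C : ℝ) : Prop where
  differentiable : Differentiable ℝ Φ
  differentiable_fderiv : Differentiable ℝ (fderiv ℝ Φ)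
  norm_fderiv_le : ∀ x, ‖fderiv ℝ Φ x‖ ≤ C * ‖x‖
  norm_fderiv_sub_le : ∀ x y, ‖fderiv ℝ Φ x - fderiv ℝ Φ y‖ ≤ C * ‖x - y‖
  norm_fderiv_two_le : ∀ x, ‖fderiv ℝ (fderiv ℝ Φ) x‖ ≤ C
  norm_fderiv_two_sub_le : ∀ x y,
    ‖fderiv ℝ (fderiv ℝ Φ) x - fderiv ℝ (fderiv ℝ Φ) y‖ ≤ C * ‖x - y‖

theorem norm_sub_le_of_fderiv_le {Ψ : E → F} {C : ℝ} (h : Differentiable ℝ Ψ)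
    (hC : ∀ x, ‖fderiv ℝ Ψ x‖ ≤ C) (x y : E) : ‖Ψ x - Ψ y‖ ≤ C * ‖x - y‖ :=
  convex_univ.norm_image_sub_le_of_norm_fderiv_le (fun z _ => h z) (fun z _ => hC z)
    (mem_univ y) (mem_univ x)

theorem SmoothBound.nonneg {Φ : E → F} {C : ℝ} (h : SmoothBound Φ C) : 0 ≤ C :=
  (norm_nonneg (fderiv ℝ (fderiv ℝ Φ) 0)).trans (h.norm_fderiv_two_le 0)

theorem SmoothBound.norm_sub_le {Φ : E → F} {C : ℝ} (h : SmoothBound Φ C) {R : ℝ} {x y : E}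
    (hx : ‖x‖ ≤ R) (hy : ‖y‖ ≤ R) : ‖Φ x - Φ y‖ ≤ C * R * ‖x - y‖ := by
  refine (convex_closedBall (0 : E) R).norm_image_sub_le_of_norm_fderiv_le
    (fun z _ => h.differentiable z) (fun z hz => ?_) (by simpa using hy) (by simpa using hx)
  exact (h.norm_fderiv_le z).trans (mul_le_mul_of_nonneg_left (by simpa using hz) h.nonneg)

theorem hasDerivAt_line (x h : E) (l : ℝ) : HasDerivAt (fun l : ℝ => x + l • h) h l := by
  simpa using ((hasDerivAt_id l).smul_const h).const_add x

/-- Second order differences of a `C¹` map with Lipschitz derivative. -/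
theorem norm_second_difference_le {Ψ : E → F} {b₁ b₂ : ℝ} (h : Differentiable ℝ Ψ)
    (hb₂ : 0 ≤ b₂) (h₁ : ∀ x, ‖fderiv ℝ Ψ x‖ ≤ b₁)
    (h₂ : ∀ x y, ‖fderiv ℝ Ψ x - fderiv ℝ Ψ y‖ ≤ b₂ * ‖x - y‖) (a b c e : E) :
    ‖Ψ a - Ψ b - (Ψ c - Ψ e)‖
      ≤ b₁ * ‖a - b - (c - e)‖ + b₂ * (‖a - c‖ + ‖b - e‖) * ‖c - e‖ := by
  -- The mean value inequality is applied to `Ψ (u l) - Ψ (v l)`, with `u` and `v` the segments from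
  -- `b` to `a` and from `e` to `c`.
  set u : ℝ → E := fun l => b + l • (a - b)
  set v : ℝ → E := fun l => e + l • (c - e)
  have hu : ∀ l, HasDerivAt u (a - b) l := hasDerivAt_line b (a - b)
  have hv : ∀ l, HasDerivAt v (c - e) l := hasDerivAt_line e (c - e)
  have hg : ∀ l ∈ Icc (0 : ℝ) 1, HasDerivWithinAt (fun l => Ψ (u l) - Ψ (v l))
      (fderiv ℝ Ψ (u l) (a - b) - fderiv ℝ Ψ (v l) (c - e)) (Icc 0 1) l := fun l _ =>
    (((h (u l)).hasFDerivAt.comp_hasDerivAt l (hu l)).sub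
      ((h (v l)).hasFDerivAt.comp_hasDerivAt l (hv l))).hasDerivWithinAt
  have := norm_image_sub_le_of_norm_deriv_le_segment_01' hg
    (C := b₁ * ‖a - b - (c - e)‖ + b₂ * (‖a - c‖ + ‖b - e‖) * ‖c - e‖) (fun l hl => by
      have e1 : fderiv ℝ Ψ (u l) (a - b) - fderiv ℝ Ψ (v l) (c - e)
          = fderiv ℝ Ψ (u l) (a - b - (c - e)) + (fderiv ℝ Ψ (u l) - fderiv ℝ Ψ (v l)) (c - e) := by
        simp only [map_sub, sub_apply]; abel
      rw [e1]
      refine (norm_add_le _ _).trans (add_le_add (ContinuousLinearMap.le_of_opNorm_le _ (h₁ _) _)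
        (ContinuousLinearMap.le_of_opNorm_le _ ((h₂ _ _).trans ?_) _))
      refine mul_le_mul_of_nonneg_left ?_ hb₂
      have e2 : u l - v l = l • (a - c) + (1 - l) • (b - e) := by
        simp only [u, v]; module
      rw [e2]
      refine (norm_add_le _ _).trans ?_
      rw [norm_smul, norm_smul, Real.norm_of_nonneg hl.1,
        Real.norm_of_nonneg (sub_nonneg.2 hl.2.le)]
      refine add_le_add (mul_le_of_le_one_left (norm_nonneg _) hl.2.le)
        (mul_le_of_le_one_left (norm_nonneg _) (by linarith [hl.1])))
  have e3 : Ψ (u 1) - Ψ (v 1) - (Ψ (u 0) - Ψ (v 0)) = Ψ a - Ψ b - (Ψ c - Ψ e) := by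
    simp only [u, v, one_smul, zero_smul, add_zero, add_sub_cancel]; abel
  rwa [e3] at this

/-- Differences of first order Taylor remainders. -/
theorem SmoothBound.norm_taylor_sub_le {Φ : E → F} {C : ℝ} (hΦ : SmoothBound Φ C)
    (x h x' h' : E) :
    ‖(Φ (x + h) - Φ x - fderiv ℝ Φ x h) - (Φ (x' + h') - Φ x' - fderiv ℝ Φ x' h')‖
      ≤ C * ‖h‖ * ‖h - h'‖
        + C * (‖h - h'‖ + (2 * ‖x - x'‖ + ‖h - h'‖) * ‖h'‖) * ‖h'‖ := by
  have hC := hΦ.nonneg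
  -- Along a segment the Taylor remainder has derivative `(DΦ(x + l h) - DΦ(x)) h`; its difference
  -- for the two data involves a second difference of `DΦ`.
  have hq : ∀ (x h : E) (l : ℝ), HasDerivAt
      (fun l : ℝ => Φ (x + l • h) - Φ x - l • fderiv ℝ Φ x h)
      (fderiv ℝ Φ (x + l • h) h - fderiv ℝ Φ x h) l := fun x h l => by
    have h1 := ((hΦ.differentiable (x + l • h)).hasFDerivAt.comp_hasDerivAt l (hasDerivAt_line x h l)).sub_const
      (Φ x)
    have h2 := (hasDerivAt_id l).smul_const (fderiv ℝ Φ x h)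
    rw [one_smul] at h2
    exact h1.sub h2
  have := norm_image_sub_le_of_norm_deriv_le_segment_01'
    (fun l _ => ((hq x h l).sub (hq x' h' l)).hasDerivWithinAt (s := Icc 0 1))
    (C := C * ‖h‖ * ‖h - h'‖ + C * (‖h - h'‖ + (2 * ‖x - x'‖ + ‖h - h'‖) * ‖h'‖) * ‖h'‖)
    (fun l hl => by
      have hl0 : |l| ≤ 1 := by rw [abs_of_nonneg hl.1]; exact hl.2.le
      have hle : ∀ w : E, ‖l • w‖ ≤ ‖w‖ := fun w => by
        rw [norm_smul, Real.norm_eq_abs]; exact mul_le_of_le_one_left (norm_nonneg _) hl0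
      have e1 : fderiv ℝ Φ (x + l • h) h - fderiv ℝ Φ x h
          - (fderiv ℝ Φ (x' + l • h') h' - fderiv ℝ Φ x' h')
          = (fderiv ℝ Φ (x + l • h) - fderiv ℝ Φ x) (h - h')
            + (fderiv ℝ Φ (x + l • h) - fderiv ℝ Φ x
              - (fderiv ℝ Φ (x' + l • h') - fderiv ℝ Φ x')) h' := by
        simp only [map_sub, sub_apply]; abel
      rw [e1]
      refine (norm_add_le _ _).trans (add_le_add (ContinuousLinearMap.le_of_opNorm_le _ ?_ _)
        (ContinuousLinearMap.le_of_opNorm_le _ ?_ _))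
      · refine (hΦ.norm_fderiv_sub_le _ _).trans (mul_le_mul_of_nonneg_left ?_ hC)
        rw [add_sub_cancel_left]; exact hle h
      · refine (norm_second_difference_le hΦ.differentiable_fderiv hC hΦ.norm_fderiv_two_le
          hΦ.norm_fderiv_two_sub_le _ _ _ _).trans ?_
        have e2 : x + l • h - x - (x' + l • h' - x') = l • (h - h') := by module
        have e3 : x + l • h - (x' + l • h') = (x - x') + l • (h - h') := by module
        have e4 : x' + l • h' - x' = l • h' := by module
        have k1 := hle (h - h')
        have k2 : ‖x - x' + l • (h - h')‖ ≤ ‖x - x'‖ + ‖h - h'‖ :=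
          (norm_add_le _ _).trans (by gcongr)
        have k3 := hle h'
        rw [e2, e3, e4]
        calc _ ≤ C * ‖h - h'‖ + C * ((‖x - x'‖ + ‖h - h'‖) + ‖x - x'‖) * ‖h'‖ := by gcongr
          _ = _ := by ring)
  simpa using this

variable {Φ : E → F} {C P R D : ℝ}

/-- Increments of the derivative path `DΦ(Y) H`, Lipschitz in `(Y, H)`. -/
theorem SmoothBound.norm_fderiv_increment_le (hΦ : SmoothBound Φ C) (hP : 1 ≤ P) (hR : 0 ≤ R)
    (hR1 : R ≤ 1) (hD : 0 ≤ D) {τ : ℝ} (hτ : 0 ≤ τ) {Y Z H K Y₂ Z₂ H₂ K₂ : E}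
    (hY₂ : ‖Y₂‖ ≤ P * R) (hK : ‖K‖ ≤ P * R)
    (hd₂ : ‖Y₂ - Z₂‖ ≤ P * D) (hd : ‖Y - Z‖ ≤ P * D) (hd' : ‖H - K‖ ≤ P * D)
    (hiY : ‖Y₂ - Y‖ ≤ P * R * τ) (hiZ : ‖Z₂ - Z‖ ≤ P * R * τ)
    (hid : ‖Y₂ - Z₂ - (Y - Z)‖ ≤ P * D * τ)
    (hiK : ‖K₂ - K‖ ≤ P * R * τ) (hid' : ‖H₂ - K₂ - (H - K)‖ ≤ P * D * τ) :
    ‖(fderiv ℝ Φ Y₂ H₂ - fderiv ℝ Φ Z₂ K₂) - (fderiv ℝ Φ Y H - fderiv ℝ Φ Z K)‖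
      ≤ 8 * C * P ^ 3 * R * D * τ := by
  have hC := hΦ.nonneg
  -- A product rule for differences: each term carries at least one `R`, one `D` and one `τ`.
  -- Surplus powers of `R` are absorbed by `R ≤ 1`, and `P ≥ 1` levels the powers of `P`.
  have e : (fderiv ℝ Φ Y₂ H₂ - fderiv ℝ Φ Z₂ K₂) - (fderiv ℝ Φ Y H - fderiv ℝ Φ Z K)
      = fderiv ℝ Φ Y₂ (H₂ - K₂ - (H - K)) + (fderiv ℝ Φ Y₂ - fderiv ℝ Φ Y) (H - K)
        + (fderiv ℝ Φ Y₂ - fderiv ℝ Φ Z₂) (K₂ - K)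
        + (fderiv ℝ Φ Y₂ - fderiv ℝ Φ Z₂ - (fderiv ℝ Φ Y - fderiv ℝ Φ Z)) K := by
    simp only [map_sub, sub_apply]; abel
  have b1 : ‖fderiv ℝ Φ Y₂ (H₂ - K₂ - (H - K))‖ ≤ C * (P * R) * (P * D * τ) :=
    ContinuousLinearMap.le_of_opNorm_le_of_le _
      ((hΦ.norm_fderiv_le _).trans (by gcongr)) hid'
  have b2 : ‖(fderiv ℝ Φ Y₂ - fderiv ℝ Φ Y) (H - K)‖ ≤ C * (P * R * τ) * (P * D) :=
    ContinuousLinearMap.le_of_opNorm_le_of_le _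
      ((hΦ.norm_fderiv_sub_le _ _).trans (by gcongr)) hd'
  have b3 : ‖(fderiv ℝ Φ Y₂ - fderiv ℝ Φ Z₂) (K₂ - K)‖ ≤ C * (P * D) * (P * R * τ) :=
    ContinuousLinearMap.le_of_opNorm_le_of_le _
      ((hΦ.norm_fderiv_sub_le _ _).trans (by gcongr)) hiK
  have b4 : ‖(fderiv ℝ Φ Y₂ - fderiv ℝ Φ Z₂ - (fderiv ℝ Φ Y - fderiv ℝ Φ Z)) K‖
      ≤ (C * (P * D * τ) + C * (P * R * τ + P * R * τ) * (P * D)) * (P * R) :=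
    ContinuousLinearMap.le_of_opNorm_le_of_le _
      ((norm_second_difference_le hΦ.differentiable_fderiv hC hΦ.norm_fderiv_two_le
        hΦ.norm_fderiv_two_sub_le _ _ _ _).trans (by gcongr)) hK
  rw [e]
  have k1 : C * P ^ 2 * R * D * τ ≤ C * P ^ 3 * R * D * τ := by
    gcongr
    norm_num
  have k2 : R * (C * P ^ 3 * R * D * τ) ≤ C * P ^ 3 * R * D * τ :=
    mul_le_of_le_one_left (by positivity) hR1
  have k3 : 0 ≤ C * P ^ 3 * R * D * τ := by positivity
  refine (norm_add_le _ _).trans ((add_le_add_left norm_add₃_le _).trans ?_)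
  linear_combination b1 + b2 + b3 + b4 + 4 * k1 + 2 * k2 + 2 * k3

/-- Remainders of the composition `Φ(Y)`, Lipschitz in the controlled path. -/
theorem SmoothBound.norm_remainder_sub_le (hΦ : SmoothBound Φ C) (hP : 1 ≤ P) (hR : 0 ≤ R)
    (hR1 : R ≤ 1) (hD : 0 ≤ D) {τ w : ℝ} (hτ : 0 ≤ τ) (hτ1 : τ ≤ 1) {Y Z H K Y₂ Z₂ : E}
    (hY : ‖Y‖ ≤ P * R) (hd : ‖Y - Z‖ ≤ P * D)
    (hiY : ‖Y₂ - Y‖ ≤ P * R * τ) (hiZ : ‖Z₂ - Z‖ ≤ P * R * τ)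
    (hid : ‖Y₂ - Z₂ - (Y - Z)‖ ≤ P * D * τ)
    (hrZ : ‖Z₂ - Z - w • K‖ ≤ R * τ ^ 2)
    (hrd : ‖Y₂ - Z₂ - (Y - Z) - w • (H - K)‖ ≤ D * τ ^ 2) :
    ‖Φ Y₂ - Φ Z₂ - (Φ Y - Φ Z) - w • (fderiv ℝ Φ Y H - fderiv ℝ Φ Z K)‖
      ≤ 8 * C * P ^ 3 * R * D * τ ^ 2 := by
  have hC := hΦ.nonneg
  -- The remainder of the composition is a Taylor remainder plus `DΦ` applied to the remainder of
  -- the path; taking differences in the latter gives two terms.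
  have e : Φ Y₂ - Φ Z₂ - (Φ Y - Φ Z) - w • (fderiv ℝ Φ Y H - fderiv ℝ Φ Z K)
      = ((Φ (Y + (Y₂ - Y)) - Φ Y - fderiv ℝ Φ Y (Y₂ - Y))
          - (Φ (Z + (Z₂ - Z)) - Φ Z - fderiv ℝ Φ Z (Z₂ - Z)))
        + fderiv ℝ Φ Y (Y₂ - Z₂ - (Y - Z) - w • (H - K))
        + (fderiv ℝ Φ Y - fderiv ℝ Φ Z) (Z₂ - Z - w • K) := by
    simp only [map_sub, map_smul, sub_apply, add_sub_cancel, smul_sub]; abel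
  have e2 : Y₂ - Y - (Z₂ - Z) = Y₂ - Z₂ - (Y - Z) := by abel
  have b1 := hΦ.norm_taylor_sub_le Y (Y₂ - Y) Z (Z₂ - Z)
  rw [e2] at b1
  have b1' : C * ‖Y₂ - Y‖ * ‖Y₂ - Z₂ - (Y - Z)‖
        + C * (‖Y₂ - Z₂ - (Y - Z)‖ + (2 * ‖Y - Z‖ + ‖Y₂ - Z₂ - (Y - Z)‖) * ‖Z₂ - Z‖) * ‖Z₂ - Z‖
      ≤ C * (P * R * τ) * (P * D * τ)
        + C * (P * D * τ + (2 * (P * D) + P * D * 1) * (P * R * τ)) * (P * R * τ) := by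
    have hid1 : ‖Y₂ - Z₂ - (Y - Z)‖ ≤ P * D * 1 := hid.trans (by gcongr)
    gcongr
  have b2 : ‖fderiv ℝ Φ Y (Y₂ - Z₂ - (Y - Z) - w • (H - K))‖ ≤ C * (P * R) * (D * τ ^ 2) :=
    ContinuousLinearMap.le_of_opNorm_le_of_le _
      ((hΦ.norm_fderiv_le _).trans (by gcongr)) hrd
  have b3 : ‖(fderiv ℝ Φ Y - fderiv ℝ Φ Z) (Z₂ - Z - w • K)‖ ≤ C * (P * D) * (R * τ ^ 2) :=
    ContinuousLinearMap.le_of_opNorm_le_of_le _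
      ((hΦ.norm_fderiv_sub_le _ _).trans (by gcongr)) hrZ
  rw [e]
  have k1 : C * P ^ 2 * R * D * τ ^ 2 ≤ C * P ^ 3 * R * D * τ ^ 2 := by
    gcongr
    norm_num
  have k2 : R * (C * P ^ 3 * R * D * τ ^ 2) ≤ C * P ^ 3 * R * D * τ ^ 2 :=
    mul_le_of_le_one_left (by positivity) hR1
  have k3 : 0 ≤ C * P ^ 3 * R * D * τ ^ 2 := by positivity
  have k4 : C * P ^ 1 * R * D * τ ^ 2 ≤ C * P ^ 3 * R * D * τ ^ 2 := by
    gcongr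
    norm_num
  refine norm_add₃_le.trans ?_
  linear_combination b1 + b1' + b2 + b3 + 2 * k1 + 3 * k2 + 2 * k4 + k3

theorem differentiable_iteratedFDeriv_fderiv {Ψ : E → F} {n : ℕ}
    (h : Differentiable ℝ (iteratedFDeriv ℝ (n + 1) Ψ)) :
    Differentiable ℝ (iteratedFDeriv ℝ n (fderiv ℝ Ψ)) := by
  have e := funext fun x => iteratedFDeriv_succ_eq_comp_right (𝕜 := ℝ) (f := Ψ) (x := x) (n := n)
  rw [e] at h
  exact (LinearIsometryEquiv.comp_differentiable_iff _).1 h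

theorem differentiable_of_iteratedFDeriv_zero {Ψ : E → F}
    (h : Differentiable ℝ (iteratedFDeriv ℝ 0 Ψ)) : Differentiable ℝ Ψ := by
  rw [iteratedFDeriv_zero_eq_comp] at h
  exact (LinearIsometryEquiv.comp_differentiable_iff _).1 h

theorem norm_fderiv_sub_le_of_iteratedFDeriv_two {Ψ : E → F} {C : ℝ}
    (h : Differentiable ℝ (fderiv ℝ Ψ)) (hC : ∀ x, ‖iteratedFDeriv ℝ 2 Ψ x‖ ≤ C) (x y : E) :
    ‖fderiv ℝ Ψ x - fderiv ℝ Ψ y‖ ≤ C * ‖x - y‖ := by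
  refine norm_sub_le_of_fderiv_le h (fun x => ?_) x y
  rw [← norm_iteratedFDeriv_zero (𝕜 := ℝ) (f := fderiv ℝ (fderiv ℝ Ψ)),
    norm_iteratedFDeriv_fderiv, norm_iteratedFDeriv_fderiv]
  exact hC x

/-- Bounds on the iterated derivatives up to order three give Lipschitz bounds. -/
theorem exists_smoothBound (hd : ∀ k : ℕ, k ≤ 2 → Differentiable ℝ (iteratedFDeriv ℝ k Φ))
    (hb : ∀ k : ℕ, 1 ≤ k → k ≤ 3 → ∃ C : ℝ, ∀ x, ‖iteratedFDeriv ℝ k Φ x‖ ≤ C)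
    (h0 : fderiv ℝ Φ 0 = 0) : ∃ C : ℝ, SmoothBound Φ C := by
  have d0 : Differentiable ℝ Φ := differentiable_of_iteratedFDeriv_zero (hd 0 (by norm_num))
  have d1 : Differentiable ℝ (fderiv ℝ Φ) := 
    differentiable_of_iteratedFDeriv_zero
      (differentiable_iteratedFDeriv_fderiv (n := 0) (hd 1 (by norm_num)))
  have d2 : Differentiable ℝ (fderiv ℝ (fderiv ℝ Φ)) :=
    differentiable_of_iteratedFDeriv_zero (differentiable_iteratedFDeriv_fderiv (n := 0)
      (differentiable_iteratedFDeriv_fderiv (n := 1) (hd 2 le_rfl)))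
  obtain ⟨C₂, hC₂⟩ := hb 2 (by norm_num) (by norm_num)
  obtain ⟨C₃, hC₃⟩ := hb 3 (by norm_num) le_rfl
  have n2 : ∀ x, ‖fderiv ℝ (fderiv ℝ Φ) x‖ ≤ max C₂ C₃ := fun x => by
    rw [← norm_iteratedFDeriv_zero (𝕜 := ℝ) (f := fderiv ℝ (fderiv ℝ Φ)),
      norm_iteratedFDeriv_fderiv, norm_iteratedFDeriv_fderiv]
    exact (hC₂ x).trans (le_max_left _ _)
  have n3 : ∀ x, ‖iteratedFDeriv ℝ 2 (fderiv ℝ Φ) x‖ ≤ max C₂ C₃ := fun x => by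
    rw [norm_iteratedFDeriv_fderiv]
    exact (hC₃ x).trans (le_max_right _ _)
  refine ⟨max C₂ C₃, d0, d1, fun x => ?_, norm_sub_le_of_fderiv_le d1 n2, n2,
    norm_fderiv_sub_le_of_iteratedFDeriv_two d2 n3⟩
  simpa [h0] using norm_sub_le_of_fderiv_le d1 n2 x 0

end Calculus

/-! ### Composition of controlled rough paths with `G` -/

section Composition

variable {B : ℝ → Type*} [∀ β, NormedAddCommGroup (B β)] [∀ β, NormedSpace ℝ (B β)]
variable {𝓑 : InterpolationFamily B} {γ α σ : ℝ} {G : ∀ β : ℝ, B β → B (β - σ)}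

theorem IsDiffusion.exists_smoothBound (hG : IsDiffusion 𝓑 α γ σ G) {β : ℝ}
    (hβ : β ∈ ({α, α - γ, α - 2 * γ} : Set ℝ)) : ∃ C : ℝ, SmoothBound (G β) C :=
  RoughCut.exists_smoothBound (hG.differentiable β hβ) (hG.bounded β hβ) (hG.fderiv_zero β hβ)

/-- Differentiating the compatibility relation by the chain rule. -/
theorem IsDiffusion.emb_fderiv (hG : IsDiffusion 𝓑 α γ σ G) {a b : ℝ}
    (ha : a ∈ ({α, α - γ, α - 2 * γ} : Set ℝ)) (hb : b ∈ ({α, α - γ, α - 2 * γ} : Set ℝ))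
    (hba : b ≤ a) (x h : B a) :
    𝓑.emb (a - σ) (b - σ) (fderiv ℝ (G a) x h)
      = fderiv ℝ (G b) (𝓑.emb a b x) (𝓑.emb a b h) := by
  obtain ⟨Ca, hCa⟩ := hG.exists_smoothBound ha
  obtain ⟨Cb, hCb⟩ := hG.exists_smoothBound hb
  have h1 := (𝓑.emb (a - σ) (b - σ)).hasFDerivAt.comp x (hCa.differentiable x).hasFDerivAt
  have h2 := (hCb.differentiable (𝓑.emb a b x)).hasFDerivAt.comp x (𝓑.emb a b).hasFDerivAt
  have e : (𝓑.emb (a - σ) (b - σ)) ∘ G a = G b ∘ 𝓑.emb a b :=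
    funext fun x => hG.compat a ha b hb hba x
  rw [e] at h1
  exact DFunLike.congr_fun (h1.unique h2) h

theorem ControlledBound.norm_emb_increment_le {W : RoughPath γ} (hγ : 0 < γ) {U : ℝ → B α}
    {U' : ℝ → B (α - γ)} {c N E : ℝ} (h : ControlledBound W 𝓑 c U U' N)
    (hE : 1 ≤ E) (hEb : ∀ x : B (α - γ), ‖𝓑.emb (α - γ) c x‖ ≤ E * ‖x‖) {s t : ℝ}
    (hs : 0 ≤ s) (hst : s ≤ t) (ht : t ≤ 1) :
    ‖𝓑.emb α c (U t - U s)‖ ≤ E * (1 + W.rho) * N * (t - s) ^ γ := by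
  have hN := h.nonneg
  have hρ := W.rho_nonneg
  have h0 : 0 ≤ t - s := sub_nonneg.2 hst
  have b1 : ‖(W.path t - W.path s) • 𝓑.emb (α - γ) c (U' s)‖
      ≤ (W.rho * (t - s) ^ γ) * (E * N) := by
    rw [norm_smul, Real.norm_eq_abs]
    gcongr
    · exact W.abs_path_le hγ hs hst ht
    · exact (hEb _).trans (mul_le_mul_of_nonneg_left (h.bound_deriv s ⟨hs, hst.trans ht⟩)
        (by linarith))
  have b2 : N * (t - s) ^ (2 * γ) ≤ N * (t - s) ^ γ := by
    rw [two_mul, Real.rpow_add_of_nonneg h0 hγ.le hγ.le]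
    have : (t - s) ^ γ ≤ 1 := Real.rpow_le_one h0 (by linarith) hγ.le
    have h3 : 0 ≤ (t - s) ^ γ := by positivity
    exact mul_le_mul_of_nonneg_left (mul_le_of_le_one_left h3 this) hN
  have b3 := h.holder_remainder s t hs hst ht
  have b4 : 1 * (N * (t - s) ^ γ) ≤ E * (N * (t - s) ^ γ) := by gcongr
  have e : 𝓑.emb α c (U t - U s) = (𝓑.emb α c (U t - U s)
      - (W.path t - W.path s) • 𝓑.emb (α - γ) c (U' s))
      + (W.path t - W.path s) • 𝓑.emb (α - γ) c (U' s) := by abel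
  rw [e]
  refine (norm_add_le _ _).trans ?_
  linear_combination b1 + b2 + b3 + b4

/-- The composition of a controlled rough path with `G` is controlled, locally Lipschitz with a
small constant near the origin. -/
theorem IsDiffusion.exists_controlledBound (hγ : 0 < γ)
    (hG : IsDiffusion 𝓑 α γ σ G) : ∃ C : ℝ, 0 < C ∧ ∀ (W : RoughPath γ) (R D : ℝ)
      (y z : ℝ → B α) (y' z' : ℝ → B (α - γ)), R ≤ 1 →
      ControlledBound W 𝓑 (α - 2 * γ) y y' R → ControlledBound W 𝓑 (α - 2 * γ) z z' R →
      ControlledBound W 𝓑 (α - 2 * γ) (fun t => y t - z t) (fun t => y' t - z' t) D →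
      ControlledBound W 𝓑 (α - 2 * γ - σ) (fun t => G α (y t) - G α (z t))
        (fun t => fderiv ℝ (G (α - γ)) (𝓑.emb α (α - γ) (y t)) (y' t)
          - fderiv ℝ (G (α - γ)) (𝓑.emb α (α - γ) (z t)) (z' t))
        (C * (1 + W.rho) ^ 3 * (R * D)) := by
  have m0 : α ∈ ({α, α - γ, α - 2 * γ} : Set ℝ) := by simp
  have m1 : α - γ ∈ ({α, α - γ, α - 2 * γ} : Set ℝ) := by simp
  have m2 : α - 2 * γ ∈ ({α, α - γ, α - 2 * γ} : Set ℝ) := by simp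
  obtain ⟨C₀, h₀⟩ := hG.exists_smoothBound m0
  obtain ⟨C₁, h₁⟩ := hG.exists_smoothBound m1
  obtain ⟨C₂, h₂⟩ := hG.exists_smoothBound m2
  have hC₀ := h₀.nonneg
  have hC₁ := h₁.nonneg
  have hC₂ := h₂.nonneg
  obtain ⟨E₀, hE₀0, hE₀⟩ := 𝓑.exists_norm_emb_le α (α - γ)
  obtain ⟨E₁, hE₁0, hE₁⟩ := 𝓑.exists_norm_emb_le (α - γ) (α - 2 * γ)
  obtain ⟨E₂, hE₂0, hE₂⟩ := 𝓑.exists_norm_emb_le α (α - 2 * γ)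
  set E := 1 + E₁ + E₂ with hE
  have hE1 : 1 ≤ E := by linarith
  refine ⟨1 + C₀ + 2 * C₁ * E₀ + 8 * C₂ * E ^ 3, by positivity,
    fun W R D y z y' z' hR1 hy hz hd => ?_⟩
  have hR := hy.nonneg
  have hD := hd.nonneg
  have hρ := W.rho_nonneg
  have hRD : 0 ≤ R * D := mul_nonneg hR hD
  have hρ3 : 1 ≤ (1 + W.rho) ^ 3 := one_le_pow₀ (by linarith)
  -- `P` dominates the embeddings into `B (α - 2γ)` and the Hölder constants of the increments; its
  -- cube is the source of `(1 + ρ)³`.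
  set P := E * (1 + W.rho) with hP
  have hEP : E ≤ P := le_mul_of_one_le_right (by linarith) (by linarith)
  have hP1 : 1 ≤ P := hE1.trans hEP
  have hbd : ∀ (x : B α) (r : ℝ), 0 ≤ r → ‖x‖ ≤ r → ‖𝓑.emb α (α - 2 * γ) x‖ ≤ P * r :=
    fun x r hr hx => (hE₂ x).trans (mul_le_mul (by linarith) hx (norm_nonneg _) (by linarith))
  have hbd' : ∀ (x : B (α - γ)) (r : ℝ), 0 ≤ r → ‖x‖ ≤ r →
      ‖𝓑.emb (α - γ) (α - 2 * γ) x‖ ≤ P * r :=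
    fun x r hr hx => (hE₁ x).trans (mul_le_mul (by linarith) hx (norm_nonneg _) (by linarith))
  have hEb : ∀ x : B (α - γ), ‖𝓑.emb (α - γ) (α - 2 * γ) x‖ ≤ E * ‖x‖ :=
    fun x => (hE₁ x).trans (mul_le_mul_of_nonneg_right (by linarith) (norm_nonneg _))
  have hfin : ∀ c : ℝ, 0 ≤ c → c ≤ 1 + C₀ + 2 * C₁ * E₀ + 8 * C₂ * E ^ 3 →
      c * (R * D) ≤ (1 + C₀ + 2 * C₁ * E₀ + 8 * C₂ * E ^ 3) * (1 + W.rho) ^ 3 * (R * D) :=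
    fun c hc hcle => by
      refine mul_le_mul_of_nonneg_right ?_ hRD
      exact hcle.trans (le_mul_of_one_le_right (hc.trans hcle) hρ3)
  have hfin' : ∀ τ : ℝ, 0 ≤ τ → 8 * C₂ * P ^ 3 * R * D * τ
      ≤ (1 + C₀ + 2 * C₁ * E₀ + 8 * C₂ * E ^ 3) * (1 + W.rho) ^ 3 * (R * D) * τ := fun τ hτ => by
    rw [hP, mul_pow]
    have r : 0 ≤ (1 + C₀ + 2 * C₁ * E₀) * (1 + W.rho) ^ 3 * (R * D) * τ := by positivity
    linear_combination r
  -- The supremum bounds use `G` on `B α` and `B (α - γ)`. For the Hölder bounds everything is moved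
  -- to `B (α - 2γ)`, where the increments of the paths are controlled.
  have e₁ : ∀ t, 𝓑.emb (α - σ) (α - 2 * γ - σ) (G α (y t) - G α (z t))
      = G (α - 2 * γ) (𝓑.emb α (α - 2 * γ) (y t)) - G (α - 2 * γ) (𝓑.emb α (α - 2 * γ) (z t)) :=
    fun t => by
      rw [map_sub, hG.compat α m0 _ m2 (by linarith), hG.compat α m0 _ m2 (by linarith)]
  have e₂ : ∀ t, 𝓑.emb (α - γ - σ) (α - 2 * γ - σ)
        (fderiv ℝ (G (α - γ)) (𝓑.emb α (α - γ) (y t)) (y' t)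
          - fderiv ℝ (G (α - γ)) (𝓑.emb α (α - γ) (z t)) (z' t))
      = fderiv ℝ (G (α - 2 * γ)) (𝓑.emb α (α - 2 * γ) (y t)) (𝓑.emb (α - γ) (α - 2 * γ) (y' t))
        - fderiv ℝ (G (α - 2 * γ)) (𝓑.emb α (α - 2 * γ) (z t))
          (𝓑.emb (α - γ) (α - 2 * γ) (z' t)) := fun t => by
    rw [map_sub, hG.emb_fderiv m1 m2 (by linarith), hG.emb_fderiv m1 m2 (by linarith),
      𝓑.emb_emb (by linarith) (by linarith), 𝓑.emb_emb (by linarith) (by linarith)]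
  refine ⟨fun t ht => ?_, fun t ht => ?_, fun s t hs hst ht => ?_, fun s t hs hst ht => ?_⟩
  · refine (h₀.norm_sub_le (hy.bound t ht) (hz.bound t ht)).trans
      (le_trans ?_ (hfin C₀ hC₀ ?_))
    · rw [mul_assoc]
      exact mul_le_mul_of_nonneg_left (mul_le_mul_of_nonneg_left (hd.bound t ht) hR) hC₀
    · have : 0 ≤ 2 * C₁ * E₀ + 8 * C₂ * E ^ 3 := by positivity
      linarith
  · have e : fderiv ℝ (G (α - γ)) (𝓑.emb α (α - γ) (y t)) (y' t)
          - fderiv ℝ (G (α - γ)) (𝓑.emb α (α - γ) (z t)) (z' t)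
        = fderiv ℝ (G (α - γ)) (𝓑.emb α (α - γ) (y t)) (y' t - z' t)
          + (fderiv ℝ (G (α - γ)) (𝓑.emb α (α - γ) (y t))
            - fderiv ℝ (G (α - γ)) (𝓑.emb α (α - γ) (z t))) (z' t) := by
      simp only [map_sub, sub_apply]; abel
    have b1 : ‖fderiv ℝ (G (α - γ)) (𝓑.emb α (α - γ) (y t)) (y' t - z' t)‖
        ≤ C₁ * (E₀ * R) * D :=
      ContinuousLinearMap.le_of_opNorm_le_of_le _ ((h₁.norm_fderiv_le _).trans
        (mul_le_mul_of_nonneg_left ((hE₀ _).trans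
          (mul_le_mul_of_nonneg_left (hy.bound t ht) hE₀0)) hC₁)) (hd.bound_deriv t ht)
    have b2 : ‖(fderiv ℝ (G (α - γ)) (𝓑.emb α (α - γ) (y t))
            - fderiv ℝ (G (α - γ)) (𝓑.emb α (α - γ) (z t))) (z' t)‖ ≤ C₁ * (E₀ * D) * R := by
      refine ContinuousLinearMap.le_of_opNorm_le_of_le _ ((h₁.norm_fderiv_sub_le _ _).trans
        (mul_le_mul_of_nonneg_left ?_ hC₁)) (hz.bound_deriv t ht)
      rw [← map_sub]
      exact (hE₀ _).trans (mul_le_mul_of_nonneg_left (hd.bound t ht) hE₀0)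
    rw [e]
    refine (norm_add_le _ _).trans ((add_le_add b1 b2).trans
      (le_trans ?_ (hfin (2 * C₁ * E₀) (by positivity) ?_)))
    · exact le_of_eq (by ring)
    · have : 0 ≤ C₀ + 8 * C₂ * E ^ 3 := by positivity
      linarith
  all_goals
    have hsI : s ∈ Icc (0 : ℝ) 1 := ⟨hs, hst.trans ht⟩
    have htI : t ∈ Icc (0 : ℝ) 1 := ⟨hs.trans hst, ht⟩
    have hτ : 0 ≤ (t - s) ^ γ := Real.rpow_nonneg (sub_nonneg.2 hst) _
    have hτ1 : (t - s) ^ γ ≤ 1 := Real.rpow_le_one (sub_nonneg.2 hst) (by linarith) hγ.le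
    have iy := hy.norm_emb_increment_le hγ hE1 hEb hs hst ht
    have iz := hz.norm_emb_increment_le hγ hE1 hEb hs hst ht
    have id := hd.norm_emb_increment_le hγ hE1 hEb hs hst ht
    have ds := hbd _ _ hD (hd.bound s hsI)
    simp only [map_sub] at iy iz id ds
  · rw [map_sub, e₂, e₂]
    have iK := hz.holder_deriv s t hs hst ht
    have id' := hd.holder_deriv s t hs hst ht
    have dt := hbd _ _ hD (hd.bound t htI)
    have ds' := hbd' _ _ hD (hd.bound_deriv s hsI)
    simp only [map_sub] at iK id' dt ds'
    refine (h₂.norm_fderiv_increment_le hP1 hR hR1 hD hτ (hbd _ _ hR (hy.bound t htI))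
      (hbd' _ _ hR (hz.bound_deriv s hsI)) dt ds ds' iy iz id ?_ ?_).trans (hfin' _ hτ)
    · exact iK.trans (mul_le_mul_of_nonneg_right (le_mul_of_one_le_left hR hP1) hτ)
    · exact id'.trans (mul_le_mul_of_nonneg_right (le_mul_of_one_le_left hD hP1) hτ)
  · have hsq : (t - s) ^ (2 * γ) = ((t - s) ^ γ) ^ 2 := by
      rw [two_mul, Real.rpow_add_of_nonneg (sub_nonneg.2 hst) hγ.le hγ.le, sq]
    have rz := hz.holder_remainder s t hs hst ht
    have rd := hd.holder_remainder s t hs hst ht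
    rw [hsq] at rz rd ⊢
    simp only [map_sub (𝓑.emb α (α - 2 * γ)), map_sub (𝓑.emb (α - γ) (α - 2 * γ))] at rz rd
    rw [map_sub, e₁, e₁, e₂]
    exact (h₂.norm_remainder_sub_le hP1 hR hR1 hD hτ hτ1 (hbd _ _ hR (hy.bound s hsI)) ds iy iz id
      rz rd).trans (hfin' _ (by positivity))

end Composition

/-! ### Cut-off, drift and the mild integral -/

section Truncation

variable {B : ℝ → Type*} [∀ β, NormedAddCommGroup (B β)] [∀ β, NormedSpace ℝ (B β)]
variable {𝓑 : InterpolationFamily B} {γ α σ δ : ℝ}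

/-- `f` is `C¹` on the compact `[0, 1]` and constant beyond `1`, so `f x = f (min x 1)`. -/
theorem IsCutoff.exists_lipschitz {f : ℝ → ℝ} (hf : IsCutoff f) :
    ∃ L : ℝ, 0 ≤ L ∧ ∀ x y, 0 ≤ x → 0 ≤ y → |f x - f y| ≤ L * |x - y| := by
  obtain ⟨K, hK⟩ := LocallyLipschitzOn.exists_lipschitzOnWith_of_compact isCompact_Icc
    (ContDiffOn.locallyLipschitzOn (convex_Icc (0 : ℝ) 1)
      ((hf.contDiffOn.mono Icc_subset_Ici_self).of_le (by norm_num)))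
  have hmin : ∀ x, 0 ≤ x → f x = f (min x 1) := fun x _ => by
    rcases le_total x 1 with h | h
    · rw [min_eq_left h]
    · rw [min_eq_right h, hf.eq_zero x h, hf.eq_zero 1 le_rfl]
  refine ⟨K, K.2, fun x y hx hy => ?_⟩
  rw [hmin x hx, hmin y hy]
  have := hK.dist_le_mul (min x 1) ⟨le_min hx zero_le_one, min_le_right _ _⟩ (min y 1)
    ⟨le_min hy zero_le_one, min_le_right _ _⟩
  rw [Real.dist_eq, Real.dist_eq] at this
  refine this.trans (mul_le_mul_of_nonneg_left ?_ K.2)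
  have := abs_min_sub_min_le_max x 1 y 1
  simpa using this

/-- For `R < r` the derivative is at most `M R` on the ball of radius `R`, as it vanishes at `0`.
For `R ≥ r` the global Lipschitz constant is at most `(L / r) R`. -/
theorem IsDrift.exists_norm_sub_le {E E' : Type*} [NormedAddCommGroup E] [NormedSpace ℝ E]
    [NormedAddCommGroup E'] [NormedSpace ℝ E'] {F : E → E'} (hF : IsDrift F) :
    ∃ C : ℝ, 0 ≤ C ∧ ∀ (R : ℝ) (x y : E), ‖x‖ ≤ R → ‖y‖ ≤ R → ‖F x - F y‖ ≤ C * R * ‖x - y‖ := by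
  obtain ⟨L, hL⟩ := hF.lipschitz
  obtain ⟨r, hr, hdiff, M, hM⟩ := hF.fderiv_lipschitz
  refine ⟨max (M : ℝ) (L / r), le_max_of_le_left M.2, fun R x y hx hy => ?_⟩
  have hR : 0 ≤ R := (norm_nonneg x).trans hx
  rcases lt_or_ge R r with h | h
  · have hsub : ∀ z ∈ Metric.closedBall (0 : E) R, z ∈ Metric.ball (0 : E) r := fun z hz =>
      Metric.closedBall_subset_ball h hz
    refine (convex_closedBall (0 : E) R).norm_image_sub_le_of_norm_fderiv_le
      (fun z hz => hdiff z (hsub z hz)) (fun z hz => ?_) (by simpa using hy) (by simpa using hx)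
    have := hM.dist_le_mul z (hsub z hz) 0 (Metric.mem_ball_self hr)
    rw [hF.fderiv_zero, dist_zero_right, dist_zero_right] at this
    refine this.trans (mul_le_mul (le_max_left _ _) (by simpa using hz) (norm_nonneg _)
      (le_max_of_le_left M.2))
  · have := hL.dist_le_mul x y
    rw [dist_eq_norm, dist_eq_norm] at this
    refine this.trans (mul_le_mul_of_nonneg_right ?_ (norm_nonneg _))
    calc (L : ℝ) = L / r * r := by field_simp
      _ ≤ max (M : ℝ) (L / r) * R := mul_le_mul (le_max_right _ _) h hr.le (le_max_of_le_left M.2)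

theorem ControlledBound.congr {W : RoughPath γ} {a b c N : ℝ} {V V₂ : ℝ → B a} {V' V₂' : ℝ → B b}
    (h : ControlledBound W 𝓑 c V V' N) (hV : EqOn V V₂ (Icc 0 1)) (hV' : EqOn V' V₂' (Icc 0 1)) :
    ControlledBound W 𝓑 c V₂ V₂' N where
  bound t ht := by rw [← hV ht]; exact h.bound t ht
  bound_deriv t ht := by rw [← hV' ht]; exact h.bound_deriv t ht
  holder_deriv s t hs hst ht := by
    rw [← hV' ⟨hs, hst.trans ht⟩, ← hV' ⟨hs.trans hst, ht⟩]; exact h.holder_deriv s t hs hst ht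
  holder_remainder s t hs hst ht := by
    rw [← hV' ⟨hs, hst.trans ht⟩, ← hV ⟨hs, hst.trans ht⟩, ← hV ⟨hs.trans hst, ht⟩]
    exact h.holder_remainder s t hs hst ht

theorem crpNorm_nonneg (W : RoughPath γ) (U : ℝ → B α) (U' : ℝ → B (α - γ)) :
    0 ≤ crpNorm 𝓑 α W U U' :=
  add_nonneg (add_nonneg (add_nonneg (supNorm_nonneg _) (supNorm_nonneg _))
    (holderNorm_nonneg _ _)) (holderNorm_nonneg _ _)

section Cut

variable {f : ℝ → ℝ} {W : RoughPath γ} {R : ℝ} {Y Z : ℝ → B α} {Y' Z' : ℝ → B (α - γ)}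

theorem IsControlled.controlledBound_cut (hγ : 0 < γ) (hf : IsCutoff f) (hR : 0 < R)
    (hY : IsControlled 𝓑 α W Y Y') :
    ControlledBound W 𝓑 (α - 2 * γ) (cut α f W R Y Y' 𝓑) (cutDeriv α f W R Y Y' 𝓑) R := by
  refine ((hY.controlledBound hγ).smul (f (crpNorm 𝓑 α W Y Y' / R))).mono ?_
  have hn := crpNorm_nonneg (𝓑 := 𝓑) W Y Y'
  set n := crpNorm 𝓑 α W Y Y'
  rcases le_or_gt n R with h | h
  · have := hf.mem_Icc (n / R) (by positivity)
    rw [abs_of_nonneg this.1]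
    exact (mul_le_of_le_one_left hn this.2).trans h
  · rw [hf.eq_zero _ ((one_le_div hR).2 h.le)]
    simpa using hR.le

/-- The difference is a cut-off multiple of `Y - Z` plus the difference of the cut-off factors, at
most `L D / R`, times one of the paths. That path is chosen with norm at most `R`, which cancels `1
/ R`; if both norms exceed `R`, both cut-offs vanish. -/
theorem IsControlled.controlledBound_cut_sub (S : ParabolicSemigroup 𝓑) (hγ : 0 < γ)
    (hγ' : γ ≤ 1 / 2) (hf : IsCutoff f) {L : ℝ} (hL0 : 0 ≤ L)
    (hL : ∀ x y, 0 ≤ x → 0 ≤ y → |f x - f y| ≤ L * |x - y|) (hR : 0 < R)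
    (hY : IsControlled 𝓑 α W Y Y') (hZ : IsControlled 𝓑 α W Z Z') :
    ControlledBound W 𝓑 (α - 2 * γ)
      (fun t => cut α f W R Y Y' 𝓑 t - cut α f W R Z Z' 𝓑 t)
      (fun t => cutDeriv α f W R Y Y' 𝓑 t - cutDeriv α f W R Z Z' 𝓑 t)
      ((1 + L) * crpNorm 𝓑 α W (fun t => Y t - Z t) (fun t => Y' t - Z' t)) := by
  have h1 := hY.crpNorm_le_add_sub S hγ hγ' hZ
  have h2 := hZ.crpNorm_le_add_sub S hγ hγ' hY
  rw [crpNorm_sub_comm] at h2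
  have hd := (hY.sub S hγ hγ' hZ).controlledBound hγ
  have hYb := hY.controlledBound hγ
  have hZb := hZ.controlledBound hγ
  have hn := hYb.nonneg
  have hm := hZb.nonneg
  have hD := hd.nonneg
  unfold cut cutDeriv
  set n := crpNorm 𝓑 α W Y Y'
  set m := crpNorm 𝓑 α W Z Z'
  set D := crpNorm 𝓑 α W (fun t => Y t - Z t) (fun t => Y' t - Z' t)
  have hfn := hf.mem_Icc (n / R) (by positivity)
  have hfm := hf.mem_Icc (m / R) (by positivity)
  have hfd : |f (n / R) - f (m / R)| ≤ L * D / R := by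
    refine (hL _ _ (by positivity) (by positivity)).trans ?_
    rw [← sub_div, abs_div, abs_of_pos hR, mul_div_assoc]
    have : |n - m| ≤ D := abs_sub_le_iff.2 ⟨by linarith, by linarith⟩
    gcongr
  have key : ∀ k : ℝ, 0 ≤ k → k ≤ R → |f (n / R) - f (m / R)| * k ≤ L * D := fun k hk hkR =>
    calc |f (n / R) - f (m / R)| * k ≤ (L * D / R) * R := by gcongr
      _ = L * D := by field_simp
  rcases le_or_gt n R with hnR | hnR
  · refine (((hd.smul (f (m / R))).add (hYb.smul (f (n / R) - f (m / R)))).mono ?_).congr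
      (fun t _ => ?_) (fun t _ => ?_)
    · have k1 := key n hn hnR
      have k2 : |f (m / R)| * D ≤ D := by
        rw [abs_of_nonneg hfm.1]; exact mul_le_of_le_one_left hD hfm.2
      linarith
    · simp only; module
    · simp only; module
  · refine (((hd.smul (f (n / R))).add (hZb.smul (f (n / R) - f (m / R)))).mono ?_).congr
      (fun t _ => ?_) (fun t _ => ?_)
    · have k1 : |f (n / R) - f (m / R)| * m ≤ L * D := by
        rcases le_or_gt m R with hmR | hmR
        · exact key m hm hmR
        · rw [hf.eq_zero _ ((one_le_div hR).2 hnR.le), hf.eq_zero _ ((one_le_div hR).2 hmR.le)]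
          simpa using mul_nonneg hL0 hD
      have k2 : |f (n / R)| * D ≤ D := by
        rw [abs_of_nonneg hfn.1]; exact mul_le_of_le_one_left hD hfn.2
      linarith
    · simp only; module
    · simp only; module

end Cut

/-- The mild integral of a drift `Φ` and a controlled rough path `(V, V')`. -/
theorem exists_mildIntegral (S : ParabolicSemigroup 𝓑) (hγ : 1 / 3 < γ) (hγ' : γ ≤ 1 / 2)
    (hσ : 0 ≤ σ) (hσ' : σ < γ) (hδ : 0 ≤ δ) (hδ' : δ < 1) :
    ∃ C₁ C₂ : ℝ, 0 ≤ C₁ ∧ 0 ≤ C₂ ∧ ∀ (W : RoughPath γ) (Φ : ℝ → B (α - δ)) (V : ℝ → B (α - σ))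
      (V' : ℝ → B (α - γ - σ)) (N₁ N₂ : ℝ), ContinuousOn Φ (Icc 0 1) →
      (∀ t ∈ Icc (0 : ℝ) 1, ‖Φ t‖ ≤ N₁) → ControlledBound W 𝓑 (α - 2 * γ - σ) V V' N₂ →
      ∃ d q : ℝ → B α,
        (∀ t ∈ Icc (0 : ℝ) 1,
          𝓑.emb α (α - δ) (d t) = ∫ r in (0 : ℝ)..t, S.S (α - δ) (t - r) (Φ r)) ∧
        (∀ t ∈ Icc (0 : ℝ) 1, IsRoughConvolution S W (α - 2 * γ - σ) V V' t
          (𝓑.emb α (α - 2 * γ - σ) (q t))) ∧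
        ContinuousOn (fun t => d t + q t) (Icc 0 1) ∧
        ControlledBound W 𝓑 (α - 2 * γ) (fun t => d t + q t)
          (fun t => 𝓑.emb (α - σ) (α - γ) (V t)) (C₁ * N₁ + C₂ * (1 + W.rho) * N₂) := by
  have hγ0 : 0 < γ := by linarith
  obtain ⟨Cd, κ₁, hCd0, hκ₁, hCd⟩ := exists_driftConvolution (α := α) S hγ0 hγ' hδ hδ'
  obtain ⟨Cq, κ₂, hCq0, hκ₂, hCq⟩ := exists_roughConvolution (α := α) S hγ hγ' hσ hσ'
  obtain ⟨C, hC0, hC⟩ := exists_controlledBound_of_increments (α := α) S hγ0 hγ' hσ hσ'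
  refine ⟨C * Cd, C * (Cq + 1), by positivity, by positivity,
    fun W Φ V V' N₁ N₂ hΦ hN₁ hV => ?_⟩
  obtain ⟨x, hxadd, hxle, hxrem, hxint⟩ := hCd Φ N₁ hΦ hN₁
  obtain ⟨y, hyadd, hyle, hyrem, hyint⟩ := hCq W V V' N₂ hV
  have hN₁0 : 0 ≤ N₁ := (norm_nonneg _).trans (hN₁ 0 (by simp))
  have hN₂0 := hV.nonneg
  have hρ := W.rho_nonneg
  have hone : ∀ {κ t : ℝ}, 0 < κ → t ∈ Icc (0 : ℝ) 1 → (t - 0) ^ κ ≤ 1 := fun hκ ht =>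
    Real.rpow_le_one (by linarith [ht.1]) (by linarith [ht.2]) hκ.le
  refine ⟨fun t => x 0 t, fun t => y 0 t, hxint, hyint,
    (S.continuousOn_of_increments hκ₁ hxadd hxle).add
      (S.continuousOn_of_increments hκ₂ hyadd hyle),
    (hC W V V' N₂ (Cd * N₁ + Cq * (W.rho * N₂)) 1 (fun s t => x s t + y s t) one_pos
      (by positivity) hV (fun s u t hs hsu hut ht => ?_) (fun t ht => ?_)
      (fun s t hs hst ht => ?_)).mono ?_⟩
  · rw [hxadd s u t hs hsu hut ht, hyadd s u t hs hsu hut ht, map_add]; abel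
  · refine (norm_add_le _ _).trans (add_le_add ?_ ?_)
    · exact (hxle 0 t le_rfl ht.1 ht.2).trans
        (mul_le_of_le_one_right (by positivity) (hone hκ₁ ht))
    · exact (hyle 0 t le_rfl ht.1 ht.2).trans
        (mul_le_of_le_one_right (by positivity) (hone hκ₂ ht))
  · rw [map_add, add_sub_assoc, add_mul]
    exact (norm_add_le _ _).trans (add_le_add (hxrem s t hs hst ht) (hyrem s t hs hst ht))
  · have r : 0 ≤ C * Cq * N₂ := by positivity
    linear_combination r

section Values

variable {S : ParabolicSemigroup 𝓑} {f : ℝ → ℝ} {F : B α → B (α - δ)}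
  {G : ∀ β : ℝ, B β → B (β - σ)} {W : RoughPath γ} {R : ℝ} {Y Z : ℝ → B α}
  {Y' Z' : ℝ → B (α - γ)}

theorem IsTruncValue.unique (hγ : 0 < γ) (hσ : 0 ≤ σ) (hδ : 0 ≤ δ) {t : ℝ} (ht : 0 ≤ t)
    {z w : B α} (hz : IsTruncValue S α σ δ f F G W R Y Y' t z)
    (hw : IsTruncValue S α σ δ f F G W R Y Y' t w) : z = w := by
  obtain ⟨d, q, rfl, -, hd, hq⟩ := hz
  obtain ⟨d₂, q₂, rfl, -, hd₂, hq₂⟩ := hw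
  rw [𝓑.emb_injective (by linarith : α - δ ≤ α) (hd.trans hd₂.symm),
    𝓑.emb_injective (by linarith : α - 2 * γ - σ ≤ α) (hq.unique ht hq₂)]

theorem truncMap_eq (hγ : 0 < γ) (hσ : 0 ≤ σ) (hδ : 0 ≤ δ) {t : ℝ} (ht : 0 ≤ t) {z : B α}
    (hz : IsTruncValue S α σ δ f F G W R Y Y' t z) : truncMap S α σ δ f F G W R Y Y' t = z := by
  have h : ∃ z : B α, IsTruncValue S α σ δ f F G W R Y Y' t z := ⟨z, hz⟩
  rw [truncMap, dif_pos h]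
  exact h.choose_spec.unique hγ hσ hδ ht hz

theorem IsControlled.continuousOn_cut (hY : IsControlled 𝓑 α W Y Y') :
    ContinuousOn (cut α f W R Y Y' 𝓑) (Icc 0 1) := hY.cont.const_smul _

theorem IsControlled.continuousOn_truncF (hF : IsDrift F) (hY : IsControlled 𝓑 α W Y Y') :
    ContinuousOn (truncF α δ f F W R Y Y' 𝓑) (Icc 0 1) := by
  obtain ⟨L, hL⟩ := hF.lipschitz
  exact hL.continuous.comp_continuousOn hY.continuousOn_cut

theorem IsControlled.continuousOn_truncG (hG : IsDiffusion 𝓑 α γ σ G)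
    (hY : IsControlled 𝓑 α W Y Y') : ContinuousOn (truncG α σ f G W R Y Y' 𝓑) (Icc 0 1) := by
  obtain ⟨C, hC⟩ := hG.exists_smoothBound (β := α) (by simp)
  exact hC.differentiable.continuous.comp_continuousOn hY.continuousOn_cut

/-- The Lipschitz estimate for the composition, against the zero path, with `G 0 = 0`. -/
theorem IsDiffusion.controlledBound_truncG (hγ : 0 < γ) (hf : IsCutoff f)
    (hG : IsDiffusion 𝓑 α γ σ G) (hR : 0 < R) (hR1 : R ≤ 1) (hY : IsControlled 𝓑 α W Y Y') :
    ∃ N, ControlledBound W 𝓑 (α - 2 * γ - σ) (truncG α σ f G W R Y Y' 𝓑)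
      (truncGDeriv α σ f G W R Y Y' 𝓑) N := by
  obtain ⟨C, -, hC⟩ := hG.exists_controlledBound hγ
  have hcut := hY.controlledBound_cut hγ hf hR
  have h0 : ControlledBound W 𝓑 (α - 2 * γ) (fun _ => (0 : B α)) (fun _ => (0 : B (α - γ))) R :=
    ⟨fun _ _ => by simpa using hR.le, fun _ _ => by simpa using hR.le,
      fun s t _ hst _ => by
        simpa using mul_nonneg hR.le (Real.rpow_nonneg (sub_nonneg.2 hst) γ),
      fun s t _ hst _ => by
        simpa using mul_nonneg hR.le (Real.rpow_nonneg (sub_nonneg.2 hst) (2 * γ))⟩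
  have := hC W R R _ _ _ _ hR1 hcut h0 (by simpa using hcut)
  refine ⟨_, this.congr (fun t _ => ?_) (fun t _ => ?_)⟩
  · simp [truncG, hG.map_zero α (by simp)]
  · simp [truncGDeriv]

end Values

end Truncation

end RoughCut

/-! ### The Lipschitz estimate for the truncated solution map -/

open RoughCut

theorem mainTheorem7 {B : ℝ → Type*} [∀ β, NormedAddCommGroup (B β)] [∀ β, NormedSpace ℝ (B β)]
    (𝓑 : RoughCut.InterpolationFamily B) (S : RoughCut.ParabolicSemigroup 𝓑)
    (α γ σ δ : ℝ) (hγ : 1 / 3 < γ) (hγ' : γ ≤ 1 / 2) (hσ : 0 ≤ σ) (hσ' : σ < γ)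
    (hδ : 0 ≤ δ) (hδ' : δ < 1) (f : ℝ → ℝ) (hf : RoughCut.IsCutoff f) :
    ∃ (C_F : (B α → B (α - δ)) → ℝ) (C_G : (∀ β : ℝ, B β → B (β - σ)) → ℝ) (C_W : ℝ → ℝ),
      (∀ F, 0 < C_F F) ∧ (∀ G, 0 < C_G G) ∧ (∀ ρ, 0 < C_W ρ) ∧
      ∀ (F : B α → B (α - δ)) (G : ∀ β : ℝ, B β → B (β - σ)),
        RoughCut.IsDrift F → RoughCut.IsDiffusion 𝓑 α γ σ G →
      ∀ (W : RoughCut.RoughPath γ) (K : ℝ), 0 < K →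
      ∀ R₀ R : ℝ, (C_F F + C_G G * C_W W.rho) * R₀ = K → R = min R₀ 1 →
        (∀ (Y : ℝ → B α) (Y' : ℝ → B (α - γ)), RoughCut.IsControlled 𝓑 α W Y Y' →
          (∀ t ∈ Set.Icc (0 : ℝ) 1, RoughCut.IsTruncValue S α σ δ f F G W R Y Y' t
            (RoughCut.truncMap S α σ δ f F G W R Y Y' t)) ∧
          RoughCut.IsControlled 𝓑 α W (RoughCut.truncMap S α σ δ f F G W R Y Y')
            (RoughCut.truncMapDeriv α σ f G W R Y Y' 𝓑)) ∧
        (∀ (Y Z : ℝ → B α) (Y' Z' : ℝ → B (α - γ)),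
          RoughCut.IsControlled 𝓑 α W Y Y' → RoughCut.IsControlled 𝓑 α W Z Z' →
          RoughCut.crpNorm 𝓑 α W
            (fun t => RoughCut.truncMap S α σ δ f F G W R Y Y' t
              - RoughCut.truncMap S α σ δ f F G W R Z Z' t)
            (fun t => RoughCut.truncMapDeriv α σ f G W R Y Y' 𝓑 t
              - RoughCut.truncMapDeriv α σ f G W R Z Z' 𝓑 t)
          ≤ K * RoughCut.crpNorm 𝓑 α W (fun t => Y t - Z t) (fun t => Y' t - Z' t)) := by
  have hγ0 : 0 < γ := by linarith
  obtain ⟨L, hL0, hL⟩ := hf.exists_lipschitz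
  obtain ⟨C₁, C₂, hC₁, hC₂, hmild⟩ := exists_mildIntegral (α := α) S hγ hγ' hσ hσ' hδ hδ'
  -- The constants are chosen for every map, with a default value when the assumption fails, so that
  -- they are functions of `F` and of `G` alone.
  have hF : ∀ F : B α → B (α - δ), ∃ C : ℝ, 0 ≤ C ∧ (IsDrift F → ∀ (R : ℝ) (x y : B α),
      ‖x‖ ≤ R → ‖y‖ ≤ R → ‖F x - F y‖ ≤ C * R * ‖x - y‖) := fun F => by
    by_cases h : IsDrift F
    · obtain ⟨C, hC0, hC⟩ := h.exists_norm_sub_le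
      exact ⟨C, hC0, fun _ => hC⟩
    · exact ⟨0, le_rfl, fun h' => absurd h' h⟩
  choose cF hcF0 hcF using hF
  have hG : ∀ G : ∀ β : ℝ, B β → B (β - σ), ∃ C : ℝ, 0 < C ∧ (IsDiffusion 𝓑 α γ σ G →
      ∀ (W : RoughPath γ) (R D : ℝ) (y z : ℝ → B α) (y' z' : ℝ → B (α - γ)), R ≤ 1 →
      ControlledBound W 𝓑 (α - 2 * γ) y y' R → ControlledBound W 𝓑 (α - 2 * γ) z z' R →
      ControlledBound W 𝓑 (α - 2 * γ) (fun t => y t - z t) (fun t => y' t - z' t) D →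
      ControlledBound W 𝓑 (α - 2 * γ - σ) (fun t => G α (y t) - G α (z t))
        (fun t => fderiv ℝ (G (α - γ)) (𝓑.emb α (α - γ) (y t)) (y' t)
          - fderiv ℝ (G (α - γ)) (𝓑.emb α (α - γ) (z t)) (z' t))
        (C * (1 + W.rho) ^ 3 * (R * D))) := fun G => by
    by_cases h : IsDiffusion 𝓑 α γ σ G
    · obtain ⟨C, hC0, hC⟩ := h.exists_controlledBound hγ0
      exact ⟨C, hC0, fun _ => hC⟩
    · exact ⟨1, one_pos, fun h' => absurd h' h⟩
  choose cG hcG0 hcG using hG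
  -- The `4` counts the terms of the norm, `1 + L` comes from the cut-off, and `+ 1` ensures
  -- positivity. Of the four powers of `1 + ρ`, three come from the composition and one from the
  -- mild integral; `|ρ|` makes the function positive for every real argument.
  refine ⟨fun F => 4 * C₁ * (1 + L) * cF F + 1, fun G => (4 * C₂ * (1 + L) + 1) * cG G,
    fun ρ => (1 + |ρ|) ^ 4, fun F => ?_, fun G => mul_pos (by positivity) (hcG0 G),
    fun ρ => by positivity, fun F G hFd hGd W K hK R₀ R hR₀ hR => ?_⟩
  · have := hcF0 F
    positivity
  have hF0 := hcF0 F
  have hG0 := hcG0 G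
  have hρ := W.rho_nonneg
  simp only [abs_of_nonneg hρ] at hR₀
  have hcoef : 0 < 4 * C₁ * (1 + L) * cF F + 1
      + (4 * C₂ * (1 + L) + 1) * cG G * (1 + W.rho) ^ 4 := by positivity
  have hR₀pos : 0 < R₀ := pos_of_mul_pos_right (hR₀ ▸ hK) hcoef.le
  have hRpos : 0 < R := hR ▸ lt_min hR₀pos one_pos
  have hR1 : R ≤ 1 := hR ▸ min_le_right _ _
  have hRR₀ : R ≤ R₀ := hR ▸ min_le_left _ _
  have hvalue : ∀ (Y : ℝ → B α) (Y' : ℝ → B (α - γ)), IsControlled 𝓑 α W Y Y' →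
      ∃ d q : ℝ → B α,
        (∀ t ∈ Icc (0 : ℝ) 1, 𝓑.emb α (α - δ) (d t)
          = ∫ r in (0 : ℝ)..t, S.S (α - δ) (t - r) (truncF α δ f F W R Y Y' 𝓑 r)) ∧
        (∀ t ∈ Icc (0 : ℝ) 1, IsRoughConvolution S W (α - 2 * γ - σ)
          (truncG α σ f G W R Y Y' 𝓑) (truncGDeriv α σ f G W R Y Y' 𝓑) t
          (𝓑.emb α (α - 2 * γ - σ) (q t))) ∧
        (∀ t ∈ Icc (0 : ℝ) 1, IsTruncValue S α σ δ f F G W R Y Y' t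
          (truncMap S α σ δ f F G W R Y Y' t)) ∧
        (∀ t ∈ Icc (0 : ℝ) 1, truncMap S α σ δ f F G W R Y Y' t = d t + q t) ∧
        IsControlled 𝓑 α W (truncMap S α σ δ f F G W R Y Y')
          (truncMapDeriv α σ f G W R Y Y' 𝓑) := fun Y Y' hY => by
    have hcF := hY.continuousOn_truncF (f := f) (R := R) hFd
    have hcG := hY.continuousOn_truncG (f := f) (R := R) hGd
    obtain ⟨N₁, hN₁⟩ := isCompact_Icc.exists_bound_of_continuousOn hcF
    obtain ⟨N₂, hN₂⟩ := hGd.controlledBound_truncG hγ0 hf hRpos hR1 hY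
    obtain ⟨d, q, hd, hq, hcont, hbound⟩ := hmild W _ _ _ N₁ N₂ hcF hN₁ hN₂
    have hv : ∀ t ∈ Icc (0 : ℝ) 1, IsTruncValue S α σ δ f F G W R Y Y' t (d t + q t) :=
      fun t ht => ⟨d t, q t, rfl,
        S.intervalIntegrable_convolution le_rfl ht.1 le_rfl ht.2 hcF, hd t ht, hq t ht⟩
    have he : ∀ t ∈ Icc (0 : ℝ) 1, truncMap S α σ δ f F G W R Y Y' t = d t + q t :=
      fun t ht => truncMap_eq hγ0 hσ hδ ht.1 (hv t ht)
    refine ⟨d, q, hd, hq, fun t ht => (he t ht).symm ▸ hv t ht, he, ?_⟩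
    exact (hbound.congr (fun t ht => (he t ht).symm) (fun t _ => rfl)).isControlled S hγ0 hγ'
      (hcont.congr he) ((𝓑.emb (α - σ) (α - γ)).continuous.comp_continuousOn hcG)
  refine ⟨fun Y Y' hY => ?_, fun Y Z Y' Z' hY hZ => ?_⟩
  · obtain ⟨_, _, -, -, hv, -, hc⟩ := hvalue Y Y' hY
    exact ⟨hv, hc⟩
  obtain ⟨d, q, hd, hq, -, he, -⟩ := hvalue Y Y' hY
  obtain ⟨d₂, q₂, hd₂, hq₂, -, he₂, -⟩ := hvalue Z Z' hZ
  have hYcut := hY.controlledBound_cut hγ0 hf hRpos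
  have hZcut := hZ.controlledBound_cut hγ0 hf hRpos
  have hcut := hY.controlledBound_cut_sub S hγ0 hγ' hf hL0 hL hRpos hZ
  set D := crpNorm 𝓑 α W (fun t => Y t - Z t) (fun t => Y' t - Z' t) with hDdef
  have hD : 0 ≤ D := crpNorm_nonneg _ _ _
  have hcFY := hY.continuousOn_truncF (f := f) (R := R) hFd
  have hcFZ := hZ.continuousOn_truncF (f := f) (R := R) hFd
  -- The mild integral of the differences of the data is bounded directly; `hdeq` and `hqeq`
  -- identify it with the difference of the two mild integrals.
  obtain ⟨d₃, q₃, hd₃, hq₃, -, hbound⟩ := hmild W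
    (fun t => truncF α δ f F W R Y Y' 𝓑 t - truncF α δ f F W R Z Z' 𝓑 t) _ _
    (cF F * R * ((1 + L) * D)) _ (hcFY.sub hcFZ)
    (fun t ht => (hcF F hFd R _ _ (hYcut.bound t ht) (hZcut.bound t ht)).trans
      (mul_le_mul_of_nonneg_left (hcut.bound t ht) (by positivity)))
    (hcG G hGd W R _ _ _ _ _ hR1 hYcut hZcut hcut)
  have hdeq : ∀ t ∈ Icc (0 : ℝ) 1, d₃ t = d t - d₂ t := fun t ht => by
    refine 𝓑.emb_injective (by linarith : α - δ ≤ α) ?_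
    rw [map_sub, hd₃ t ht, hd t ht, hd₂ t ht, ← intervalIntegral.integral_sub
      (S.intervalIntegrable_convolution le_rfl ht.1 le_rfl ht.2 hcFY)
      (S.intervalIntegrable_convolution le_rfl ht.1 le_rfl ht.2 hcFZ)]
    simp only [map_sub]
  have hqeq : ∀ t ∈ Icc (0 : ℝ) 1, q₃ t = q t - q₂ t := fun t ht => by
    refine 𝓑.emb_injective (by linarith : α - 2 * γ - σ ≤ α) ?_
    rw [map_sub]
    exact (hq₃ t ht).unique ht.1 ((hq t ht).sub (hq₂ t ht))
  have hfinal := (hbound.congr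
    (V₂ := fun t => truncMap S α σ δ f F G W R Y Y' t - truncMap S α σ δ f F G W R Z Z' t)
    (V₂' := fun t => truncMapDeriv α σ f G W R Y Y' 𝓑 t - truncMapDeriv α σ f G W R Z Z' 𝓑 t)
    (fun t ht => by simp only [hdeq t ht, hqeq t ht, he t ht, he₂ t ht]; abel)
    (fun t _ => map_sub _ _ _)).crpNorm_le hγ0
  refine hfinal.trans ?_
  calc _ = (4 * C₁ * (1 + L) * cF F + 4 * C₂ * (1 + L) * cG G * (1 + W.rho) ^ 4) * R * D := by
        ring
    _ ≤ (4 * C₁ * (1 + L) * cF F + 1 + (4 * C₂ * (1 + L) + 1) * cG G * (1 + W.rho) ^ 4)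
          * R₀ * D := by
        gcongr <;> linarith
    _ = K * D := by rw [hR₀]
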